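/- Let $G_A$ be a real Banach–Lie group with Lie algebra $\mathfrak g_A=T_{\mathbf 1}G_A$, and let $G_B\subseteq G_A$ be a Banach–Lie subgroup, that is, a subgroup which in the induced topology is a Banach–Lie group whose inclusion is smooth with injective differential $\mathfrak g_B\to\mathfrak g_A$ at $\mathbf 1$, of closed complemented range; we regard its Lie algebra $\mathfrak g_B$ as a subspace of $\mathfrak g_A$. Let $E\colon\mathfrak g_A\to\mathfrak g_A$ be a continuous linear map such that $(G_A,G_B;E)$ is a reductive structure: $E\circ E=E$, $\operatorname{Ran}E=\mathfrak g_B$, and $E\circ\mathrm{Ad}_{G_A}(g)=\mathrm{Ad}_{G_A}(g)\circ E$ for all $g\in G_B$. Let $\mathcal H_B$ be a complex Hilbert space and $\rho\colon G_B\to\mathcal B(\mathcal H_B)$ a uniformly continuous representation, i.e. a group homomorphism into the invertible operators that is continuous for the operator norm. Then $\rho$ is smooth; let $d\rho\colon\mathfrak g_B\to\mathcal B(\mathcal H_B)$ be its differential at $\mathbf 1$. Let $D=G_A\times_{G_B}\mathcal H_B$ be the quotient of $G_A\times\mathcal H_B$ by the relation $(g,f)\sim(gw,\rho(w^{-1})f)$,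 $w\in G_B$, with classes $[(g,f)]$, and let $\Pi\colon D\to G_A/G_B$, $[(g,f)]\mapsto gG_B$. With the quotient topologies, $G_A/G_B$ and $\Pi$ have a canonical structure of smooth Banach manifold and smooth complex vector bundle (with typical fibre $\mathcal H_B$ and fibre operations $[(g,f)]+[(g,f')]=[(g,f+f')]$, $c[(g,f)]=[(g,cf)]$), for which $G_A\to G_A/G_B$ and $Q\colon G_A\times\mathcal H_B\to D$, $Q(g,f)=[(g,f)]$, are smooth submersions. For $g\in G_A$, $X\in\mathfrak g_A$, $f,h\in\mathcal H_B$ let $[((g,X),(f,h))]\in T_{[(g,f)]}D$ be the image under $T_{(g,f)}Q$ of $(T_{\mathbf 1}(\lambda_g)X,h)$, where $\lambda_g(x)=gx$. Every tangent vector of $D$ is of this form, and $[((g,X),(f,h))]=[((g',X'),(f',h'))]$ if and only if there are $u\in G_B$, $Y\in\mathfrak g_B$ with $g'=gu$, $X'=\mathrm{Ad}(u^{-1})X+Y$, $f=\rho(u)f'$ and $h=\rho(u)d\rho(Y)f'+\rho(u)h'$; in other words $TD=(G_A\ltimes_{\mathrm{Ad}}\mathfrak g_A)\times_{G_B\ltimes_{\mathrm{Ad}}\mathfrak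 g_B}(\mathcal H_B\oplus\mathcal H_B)$. Then there is one and only one linear connection $\Phi_E\colon TD\to TD$ on $\Pi$ such that, for all $g\in G_A$, $X\in\mathfrak g_A$, $f,h\in\mathcal H_B$, $$\Phi_E\big([((g,X),(f,h))]\big)=[((g,E(X)),(f,h))]=[((g,0),(f,d\rho(E(X))f+h))].$$ Here a linear connection on $\Pi$ is a smooth map $\Phi\colon TD\to TD$ with $\Phi\circ\Phi=\Phi$ which maps each $T_xD$ into itself by a continuous linear map with range $\operatorname{Ker}(T_x\Pi)$, and which is (complex-)linear on the fibres of the vector bundle $T\Pi\colon TD\to T(G_A/G_B)$. -/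

import Mathlib

open scoped Manifold ContDiff
open Bundle

universe u v w x

noncomputable section

/-! ### Banach-Lie groups, adjoint action, reductive structures -/

section Reductive

variable {F : Type*} [NormedAddCommGroup F] [NormedSpace ℝ F]
  {G : Type*} [TopologicalSpace G] [ChartedSpace F G] [Group G]

/-- The adjoint action `Ad g : 𝔤 → 𝔤`, the differential at `1` of `x ↦ g x g⁻¹`
(a self-map of `𝔤 = T₁G`, because `g 1 g⁻¹ = 1`). -/
def LieAd (g : G) : GroupLieAlgebra 𝓘(ℝ, F) G →L[ℝ] GroupLieAlgebra 𝓘(ℝ, F) G :=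
  mfderiv 𝓘(ℝ, F) 𝓘(ℝ, F) (fun x : G => g * x * g⁻¹) (1 : G)

variable {FB : Type*} [NormedAddCommGroup FB] [NormedSpace ℝ FB]

/-- The differential at `1` of the inclusion of a subgroup, `𝔤_B → 𝔤_A`. Its range is the Lie
algebra of the subgroup, seen inside the one of the group. -/
def lieIncl (GB : Subgroup G) [ChartedSpace FB GB] :
    GroupLieAlgebra 𝓘(ℝ, FB) GB →L[ℝ] GroupLieAlgebra 𝓘(ℝ, F) G :=
  mfderiv 𝓘(ℝ, FB) 𝓘(ℝ, F) (Subtype.val : GB → G) (1 : GB)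

/-- A Banach-Lie subgroup: a subgroup which, with the induced topology, is a Banach-Lie group
whose inclusion is smooth and has, at `1`, an injective differential whose range is closed and
complemented. (The Lie group structure of `GB` lives on the subspace topology.) -/
structure IsBanachLieSubgroup (GB : Subgroup G) [ChartedSpace FB GB] : Prop where
  lieGroup : LieGroup 𝓘(ℝ, FB) ∞ GB
  contMDiff_val : ContMDiff 𝓘(ℝ, FB) 𝓘(ℝ, F) ∞ (Subtype.val : GB → G)
  injective : Function.Injective (lieIncl (F := F) (FB := FB) GB)
  closedComplemented : (lieIncl (F := F) (FB := FB) GB).range.ClosedComplemented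

/-- The conditions on the map `E` in a reductive structure `(G_A, G_B; E)`. -/
structure IsReductive (GB : Subgroup G) [ChartedSpace FB GB]
    (E : GroupLieAlgebra 𝓘(ℝ, F) G →L[ℝ] GroupLieAlgebra 𝓘(ℝ, F) G) : Prop where
  idem : ∀ X, E (E X) = E X
  range_eq : E.range = (lieIncl (F := F) (FB := FB) GB).range
  ad_comm : ∀ g ∈ GB, ∀ X, E (LieAd g X) = LieAd g (E X)

end Reductive

/-! ### The homogeneous vector bundle `G_A ×_{G_B} H_B → G_A / G_B` -/

section HomogeneousBundle

variable {G : Type*} [Group G] {GB : Subgroup G}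
  {H : Type*} [NormedAddCommGroup H] [InnerProductSpace ℂ H]

/-- `(g, f) ∼ (g', f')` iff `g' = g w` and `f' = ρ(w⁻¹) f` for some `w ∈ G_B`. -/
def homSetoid (ρ : GB →* (H →L[ℂ] H)) : Setoid (G × H) where
  r p p' := ∃ w : GB, p'.1 = p.1 * w ∧ p'.2 = ρ w⁻¹ p.2
  iseqv :=
    { refl := fun p => ⟨1, by simp, by simp⟩
      symm := by
        rintro ⟨g, f⟩ ⟨g', f'⟩ ⟨w, h1, h2⟩
        refine ⟨w⁻¹, ?_, ?_⟩
        · simp only at h1 ⊢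
          simp [h1]
        · simp only at h2 ⊢
          rw [h2, ← mul_apply_eq_comp, ← map_mul]
          simp
      trans := by
        rintro ⟨g, f⟩ ⟨g', f'⟩ ⟨g'', f''⟩ ⟨w, h1, h2⟩ ⟨w', h3, h4⟩
        refine ⟨w * w', ?_, ?_⟩
        · simp only at h1 h3 ⊢
          simp [h1, h3, mul_assoc]
        · simp only at h2 h4 ⊢
          rw [h4, h2, ← mul_apply_eq_comp, ← map_mul, mul_inv_rev] }

/-- The set `D = G_A ×_{G_B} H_B`. -/
def HomProd (ρ : GB →* (H →L[ℂ] H)) : Type _ := Quotient (homSetoid ρ)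

/-- The projection `[(g, f)] ↦ g G_B`. -/
def HomProd.proj {ρ : GB →* (H →L[ℂ] H)} : HomProd ρ → G ⧸ GB :=
  Quotient.lift (fun p : G × H => (p.1 : G ⧸ GB)) (by
    rintro ⟨g, f⟩ ⟨g', f'⟩ ⟨w, h1, -⟩
    refine QuotientGroup.eq.2 ?_
    simp only at h1 ⊢
    simp [h1])

/-- The fibre of `D → G_A / G_B` over `z`. -/
def HomFiber (ρ : GB →* (H →L[ℂ] H)) (z : G ⧸ GB) : Type _ :=
  {d : HomProd ρ // d.proj = z}

/-- The class `[(g, f)]` as a point of the total space of the bundle. The total space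
`TotalSpace H (HomFiber ρ)` is the disjoint union of the fibres of `HomProd ρ → G ⧸ GB`, that is,
`HomProd ρ` itself. -/
def homMk (ρ : GB →* (H →L[ℂ] H)) (p : G × H) : TotalSpace H (HomFiber ρ) :=
  ⟨(p.1 : G ⧸ GB), ⟨Quotient.mk (homSetoid ρ) p, rfl⟩⟩

theorem homMk_eq_iff (ρ : GB →* (H →L[ℂ] H)) (p p' : G × H) :
    homMk ρ p = homMk ρ p' ↔ ∃ w : GB, p'.1 = p.1 * w ∧ p'.2 = ρ w⁻¹ p.2 := by
  constructor
  · intro h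
    have h' : Quotient.mk (homSetoid ρ) p = Quotient.mk (homSetoid ρ) p' :=
      congrArg (fun x : TotalSpace H (HomFiber ρ) => x.2.1) h
    exact Quotient.exact h'
  · intro h
    have h' : Quotient.mk (homSetoid ρ) p = Quotient.mk (homSetoid ρ) p' :=
      Quotient.sound (s := homSetoid ρ) h
    have key : ∀ (z z' : G ⧸ GB) (d d' : HomProd ρ) (hd : d.proj = z) (hd' : d'.proj = z'),
        d = d' → (⟨z, ⟨d, hd⟩⟩ : TotalSpace H (HomFiber ρ)) = ⟨z', ⟨d', hd'⟩⟩ := by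
      rintro z z' d d' rfl rfl rfl
      rfl
    exact key _ _ _ _ rfl rfl h'

theorem homMk_surjective (ρ : GB →* (H →L[ℂ] H)) : Function.Surjective (homMk ρ) := by
  rintro ⟨z, ⟨d, rfl⟩⟩
  obtain ⟨p, rfl⟩ := Quotient.exists_rep d
  exact ⟨p, rfl⟩

/-- For `g` in the coset `z`, the bijection `f ↦ [(g, f)]` from `H` onto the fibre over `z`. -/
def homFiberEquiv (ρ : GB →* (H →L[ℂ] H)) {z : G ⧸ GB} (g : G) (hg : (g : G ⧸ GB) = z) :
    H ≃ HomFiber ρ z :=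
  Equiv.ofBijective (fun f => ⟨Quotient.mk (homSetoid ρ) (g, f), hg⟩) (by
    constructor
    · intro f f' h
      obtain ⟨w, h1, h2⟩ := Quotient.exact (congrArg Subtype.val h)
      have hw : w = 1 := by
        have : (w : G) = 1 := by simpa using h1.symm
        exact_mod_cast this
      subst hw
      simpa using h2.symm
    · rintro ⟨d, hd⟩
      obtain ⟨⟨g', f'⟩, rfl⟩ := Quotient.exists_rep d
      have hgg : (g : G ⧸ GB) = (g' : G ⧸ GB) := hg.trans hd.symm
      have hw : g⁻¹ * g' ∈ GB := QuotientGroup.eq.1 hgg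
      refine ⟨ρ ⟨g⁻¹ * g', hw⟩ f', Subtype.ext (Quotient.sound (s := homSetoid ρ) ?_)⟩
      refine ⟨⟨g⁻¹ * g', hw⟩, by simp, ?_⟩
      simp only
      rw [← mul_apply_eq_comp, ← map_mul]
      simp)

/-- The vector space structure of the fibres: `[(g, f)] + [(g, f')] = [(g, f + f')]`
(see `homFiberEquiv_add`; it does not depend on `g`). -/
instance (ρ : GB →* (H →L[ℂ] H)) (z : G ⧸ GB) : AddCommGroup (HomFiber ρ z) :=
  (homFiberEquiv ρ (Quotient.out z) (QuotientGroup.out_eq' z)).symm.addCommGroup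

/-- `c [(g, f)] = [(g, c f)]`, see `homFiberEquiv_smul`. -/
instance (ρ : GB →* (H →L[ℂ] H)) (z : G ⧸ GB) : Module ℂ (HomFiber ρ z) :=
  (homFiberEquiv ρ (Quotient.out z) (QuotientGroup.out_eq' z)).symm.module ℂ

theorem homFiberEquiv_change (ρ : GB →* (H →L[ℂ] H)) {z : G ⧸ GB} (g g' : G)
    (hg : (g : G ⧸ GB) = z) (hg' : (g' : G ⧸ GB) = z) (f : H) :
    homFiberEquiv ρ g hg f = homFiberEquiv ρ g' hg'
      (ρ (⟨g⁻¹ * g', QuotientGroup.eq.1 (hg.trans hg'.symm)⟩ : GB)⁻¹ f) := by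
  refine Subtype.ext (Quotient.sound (s := homSetoid ρ) ?_)
  exact ⟨⟨g⁻¹ * g', QuotientGroup.eq.1 (hg.trans hg'.symm)⟩, by simp, rfl⟩

theorem homFiberEquiv_add (ρ : GB →* (H →L[ℂ] H)) {z : G ⧸ GB} (g : G) (hg : (g : G ⧸ GB) = z)
    (f f' : H) :
    homFiberEquiv ρ g hg (f + f') = homFiberEquiv ρ g hg f + homFiberEquiv ρ g hg f' := by
  have hz := QuotientGroup.out_eq' z
  rw [homFiberEquiv_change ρ g (Quotient.out z) hg hz (f + f'),
    homFiberEquiv_change ρ g (Quotient.out z) hg hz f,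
    homFiberEquiv_change ρ g (Quotient.out z) hg hz f', Equiv.add_def]
  simp

theorem homFiberEquiv_smul (ρ : GB →* (H →L[ℂ] H)) {z : G ⧸ GB} (g : G) (hg : (g : G ⧸ GB) = z)
    (c : ℂ) (f : H) :
    homFiberEquiv ρ g hg (c • f) = c • homFiberEquiv ρ g hg f := by
  have hz := QuotientGroup.out_eq' z
  rw [homFiberEquiv_change ρ g (Quotient.out z) hg hz (c • f),
    homFiberEquiv_change ρ g (Quotient.out z) hg hz f, Equiv.smul_def]
  simp

variable [TopologicalSpace G]

/-- `D` carries the quotient topology. -/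
instance (ρ : GB →* (H →L[ℂ] H)) : TopologicalSpace (HomProd ρ) :=
  inferInstanceAs (TopologicalSpace (Quotient (homSetoid ρ)))

/-- The topology of the total space is the one of `D`, i.e. the quotient topology. -/
instance (ρ : GB →* (H →L[ℂ] H)) : TopologicalSpace (TotalSpace H (HomFiber ρ)) :=
  TopologicalSpace.induced (fun x => x.2.1) inferInstance

/-- The fibres carry the topology induced by `D`. -/
instance (ρ : GB →* (H →L[ℂ] H)) (z : G ⧸ GB) : TopologicalSpace (HomFiber ρ z) :=
  inferInstanceAs (TopologicalSpace {d : HomProd ρ // d.proj = z})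

theorem isQuotientMap_homMk (ρ : GB →* (H →L[ℂ] H)) : Topology.IsQuotientMap (homMk ρ) := by
  let e : TotalSpace H (HomFiber ρ) ≃ HomProd ρ :=
    { toFun := fun x => x.2.1
      invFun := fun d => ⟨d.proj, ⟨d, rfl⟩⟩
      left_inv := by rintro ⟨z, ⟨d, rfl⟩⟩; rfl
      right_inv := fun _ => rfl }
  let e' : TotalSpace H (HomFiber ρ) ≃ₜ HomProd ρ :=
    e.toHomeomorphOfIsInducing ⟨rfl⟩
  have h : Topology.IsQuotientMap (Quotient.mk (homSetoid ρ)) := isQuotientMap_quot_mk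
  exact e'.symm.isQuotientMap.comp h

end HomogeneousBundle

/-! ### Connections on smooth bundles -/

section Connections

variable {FM : Type*} [NormedAddCommGroup FM] [NormedSpace ℝ FM]
  {HM : Type*} [TopologicalSpace HM] {IM : ModelWithCorners ℝ FM HM}
  {D : Type*} [TopologicalSpace D] [ChartedSpace HM D]
  {FZ : Type*} [NormedAddCommGroup FZ] [NormedSpace ℝ FZ]
  {HZ : Type*} [TopologicalSpace HZ] {IZ : ModelWithCorners ℝ FZ HZ}
  {Z : Type*} [TopologicalSpace Z] [ChartedSpace HZ Z]

/-- The map `TD → TD` over the identity of `D` given by continuous linear endomorphisms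
`Φ x` of the tangent spaces `T_x D`. -/
def tangentEndo (Φ : ∀ x : D, TangentSpace IM x →L[ℝ] TangentSpace IM x)
    (v : TangentBundle IM D) : TangentBundle IM D :=
  ⟨v.proj, Φ v.proj v.2⟩

/-- A connection on a smooth fibre bundle `φ : D → Z`: a smooth map `TD → TD` which is an
endomorphism of the vector bundle `TD → D` (over the identity of `D`), is idempotent, and whose
restriction to each `T_x D` has as range the vertical space `Ker (T_x φ)`. -/
structure IsBundleConnection (IZ : ModelWithCorners ℝ FZ HZ) [IsManifold IM 1 D] (φ : D → Z)
    (Φ : ∀ x : D, TangentSpace IM x →L[ℝ] TangentSpace IM x) : Prop where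
  smooth : ContMDiff IM.tangent IM.tangent ∞ (tangentEndo Φ)
  idem : ∀ v, tangentEndo Φ (tangentEndo Φ v) = tangentEndo Φ v
  range_eq : ∀ x, (Φ x).range = (mfderiv IM IZ φ x).ker

variable {F : Type*} [NormedAddCommGroup F] [NormedSpace ℂ F]
  {V : Z → Type*} [∀ z, AddCommGroup (V z)] [∀ z, Module ℂ (V z)]
  [TopologicalSpace (TotalSpace F V)] [∀ z, TopologicalSpace (V z)] [FiberBundle F V]

variable (IZ) in
/-- The vector bundle structure of `TΠ : TD → TZ` for a vector bundle `Π : D → Z`, in a local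
trivialization `D|_U ≃ U × F`: a tangent vector `v ∈ T_x D`, with `Π x = z`, is determined by `x`,
by `TΠ v ∈ T_z Z` and by the derivative along `v` of the `F`-component of the trivialization,
which is this map. -/
def fiberDeriv (z : Z) (a : V z)
    (v : TangentSpace (IZ.prod 𝓘(ℝ, F)) (⟨z, a⟩ : TotalSpace F V)) : F :=
  mfderiv (IZ.prod 𝓘(ℝ, F)) 𝓘(ℝ, F) (fun y => (trivializationAt F V z y).2)
    (⟨z, a⟩ : TotalSpace F V) v

variable (IZ) in
/-- The differential `T_x Π : T_x D → T_z Z` at `x = (z, a)`. -/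
def projDeriv (z : Z) (a : V z)
    (v : TangentSpace (IZ.prod 𝓘(ℝ, F)) (⟨z, a⟩ : TotalSpace F V)) : TangentSpace IZ z :=
  mfderiv (IZ.prod 𝓘(ℝ, F)) IZ (π F V) (⟨z, a⟩ : TotalSpace F V) v

variable (IZ) in
/-- `u ∈ T_{a+b} D` is the sum of `v ∈ T_a D` and `w ∈ T_b D` in a fibre of `TΠ : TD → TZ`. -/
def IsTangentSum {z : Z} {a b : V z}
    (v : TangentSpace (IZ.prod 𝓘(ℝ, F)) (⟨z, a⟩ : TotalSpace F V))
    (w : TangentSpace (IZ.prod 𝓘(ℝ, F)) (⟨z, b⟩ : TotalSpace F V))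
    (u : TangentSpace (IZ.prod 𝓘(ℝ, F)) (⟨z, a + b⟩ : TotalSpace F V)) : Prop :=
  projDeriv IZ z a v = projDeriv IZ z (a + b) u ∧ projDeriv IZ z b w = projDeriv IZ z (a + b) u ∧
    fiberDeriv IZ z (a + b) u = fiberDeriv IZ z a v + fiberDeriv IZ z b w

variable (IZ) in
/-- `u ∈ T_{c a} D` is the multiple by `c` of `v ∈ T_a D` in a fibre of `TΠ : TD → TZ`. -/
def IsTangentSMul (c : ℂ) {z : Z} {a : V z}
    (v : TangentSpace (IZ.prod 𝓘(ℝ, F)) (⟨z, a⟩ : TotalSpace F V))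
    (u : TangentSpace (IZ.prod 𝓘(ℝ, F)) (⟨z, c • a⟩ : TotalSpace F V)) : Prop :=
  projDeriv IZ z a v = projDeriv IZ z (c • a) u ∧
    fiberDeriv IZ z (c • a) u = c • fiberDeriv IZ z a v

/-- A linear connection on a smooth vector bundle `Π : D → Z`: a connection `Φ : TD → TD` which is
linear on the fibres of the vector bundle `TΠ : TD → TZ`. -/
structure IsLinearConnection (IZ : ModelWithCorners ℝ FZ HZ)
    [IsManifold (IZ.prod 𝓘(ℝ, F)) 1 (TotalSpace F V)]
    (Φ : ∀ x : TotalSpace F V,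
      TangentSpace (IZ.prod 𝓘(ℝ, F)) x →L[ℝ] TangentSpace (IZ.prod 𝓘(ℝ, F)) x) : Prop where
  isConnection : IsBundleConnection IZ (π F V) Φ
  map_add : ∀ (z : Z) (a b : V z)
    (v : TangentSpace (IZ.prod 𝓘(ℝ, F)) (⟨z, a⟩ : TotalSpace F V))
    (w : TangentSpace (IZ.prod 𝓘(ℝ, F)) (⟨z, b⟩ : TotalSpace F V))
    (u : TangentSpace (IZ.prod 𝓘(ℝ, F)) (⟨z, a + b⟩ : TotalSpace F V)),
    IsTangentSum IZ v w u → IsTangentSum IZ (Φ _ v) (Φ _ w) (Φ _ u)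
  map_smul : ∀ (c : ℂ) (z : Z) (a : V z)
    (v : TangentSpace (IZ.prod 𝓘(ℝ, F)) (⟨z, a⟩ : TotalSpace F V))
    (u : TangentSpace (IZ.prod 𝓘(ℝ, F)) (⟨z, c • a⟩ : TotalSpace F V)),
    IsTangentSMul IZ c v u → IsTangentSMul IZ c (Φ _ v) (Φ _ u)

end Connections

/-! ### Tangent vectors of the homogeneous bundle -/

section TangentClasses

variable {FA : Type*} [NormedAddCommGroup FA] [NormedSpace ℝ FA]
  {G : Type*} [TopologicalSpace G] [ChartedSpace FA G] [Group G]
  {FB : Type*} [NormedAddCommGroup FB] [NormedSpace ℝ FB]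
  {GB : Subgroup G} [ChartedSpace FB GB]
  {H : Type*} [NormedAddCommGroup H] [InnerProductSpace ℂ H]

/-- The derived representation `dρ : 𝔤_B → B(H)`, the differential of `ρ` at `1`. -/
def derivedRep (ρ : GB →* (H →L[ℂ] H)) :
    GroupLieAlgebra 𝓘(ℝ, FB) GB →L[ℝ] (H →L[ℂ] H) :=
  mfderiv 𝓘(ℝ, FB) 𝓘(ℝ, H →L[ℂ] H) (fun w : GB => ρ w) (1 : GB)

variable (M : Type*) [NormedAddCommGroup M] [NormedSpace ℝ M] [ChartedSpace M (G ⧸ GB)]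

/-- The tangent vector `[((g, X), (f, h))] ∈ TD`: the image, under the tangent map of
`G_A × H_B → D`, of the vector at `(g, f)` whose first component is the left translate of
`X ∈ 𝔤_A` to `T_g G_A` and whose second component is `h`. -/
def tangentClass (ρ : GB →* (H →L[ℂ] H)) [FiberBundle H (HomFiber ρ)]
    (g : G) (X : GroupLieAlgebra 𝓘(ℝ, FA) G) (f h : H) :
    TangentBundle (𝓘(ℝ, M).prod 𝓘(ℝ, H)) (TotalSpace H (HomFiber ρ)) :=
  ⟨homMk ρ (g, f),
    mfderiv (𝓘(ℝ, FA).prod 𝓘(ℝ, H)) (𝓘(ℝ, M).prod 𝓘(ℝ, H)) (homMk ρ) (g, f)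
      (show TangentSpace (𝓘(ℝ, FA).prod 𝓘(ℝ, H)) (g, f) from
        ((mulInvariantVectorField X g : TangentSpace 𝓘(ℝ, FA) g), h))⟩

/-- The equivalence relation which defines the associated bundle
`(G_A ⋉ 𝔤_A) ×_{G_B ⋉ 𝔤_B} (H_B ⊕ H_B)`: for some `(u, Y) ∈ G_B ⋉ 𝔤_B`,
`(g', X') = (g, X)(u, Y) = (g u, Ad(u⁻¹) X + Y)` and `(f', h') = Tρ(u, Y)⁻¹ (f, h)`, where
`Tρ(u, Y)(f', h') = (ρ(u) f', ρ(u) dρ(Y) f' + ρ(u) h')`. -/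
def TangentEquiv (ρ : GB →* (H →L[ℂ] H))
    (g : G) (X : GroupLieAlgebra 𝓘(ℝ, FA) G) (f h : H)
    (g' : G) (X' : GroupLieAlgebra 𝓘(ℝ, FA) G) (f' h' : H) : Prop :=
  ∃ (u : GB) (Y : GroupLieAlgebra 𝓘(ℝ, FB) GB),
    g' = g * u ∧ X' = LieAd (u⁻¹ : G) X + lieIncl GB Y ∧
    f = ρ u f' ∧ h = ρ u (derivedRep ρ Y f') + ρ u h'

end TangentClasses

end

/-! In left-translated coordinates the connection lifts to `G_A × H_B` as `(X, h) ↦ (E X, h)`. Two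
such vectors have the same image in `TD` exactly when some `(u, Y)` in `G_B ⋉ 𝔤_B` relates them
(`tangentClass_eq_iff`). Since `E` commutes with `Ad(u⁻¹)` and, being idempotent with range `𝔤_B`,
fixes `𝔤_B`, it respects this relation (`IsReductive.tangentClass_congr`) and descends to `TD`. The
classes exhaust `TD`, so the formula leaves no freedom: this is uniqueness.

The descended map is smooth because `Q` has smooth local sections `s`, and locally it equals `TQ ∘
(E × id) ∘ Ts`. Its range is the vertical space because the kernel of the differential of `G_A →
G_A/G_B` at `g` is the left translate of `𝔤_B = Ran E`. It is linear on the fibres of `TΠ` because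
the horizontal part `v - Φ v` is the image of `(η, 0)`, where `η ∈ T_g G_A` depends only on `g` and
`TΠ v` (`IsReductive.exists_homConnection_eq_sub`), while the fibre coordinate of `[(x, f)]` is
linear in `f` for all `x` near `g`.

Two analytic inputs precede this. First, a norm-continuous `ρ` is smooth
(`contMDiff_of_continuous`): a doubling argument gives `ρ - 1 = O(‖x‖)` in a chart, a Hyers-Ulam
argument then gives differentiability at `1`, and the identity `ρ(y) = ρ(x) ρ(x⁻¹y)` propagates it
and bootstraps to all orders. Second, a complement of `𝔤_B` yields a slice, that is, coordinates
`(m, u) ↦ s m * u` on a right `G_B`-invariant open set (`exists_lieSlice`). The slice supplies the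
charts of `G_A/G_B`, the trivializations of `D` and the proof that both projections are submersions.
The connection itself is built for any structure in which these projections are submersions; there
the slice serves only to compute the kernel of the differential of `G_A → G_A/G_B`. -/

noncomputable section

/-! ### Continuous local homomorphisms into Banach algebras are smooth -/

section LocalHom

open Filter Topology Metric

variable {V : Type*} [NormedAddCommGroup V] [NormedSpace ℝ V]

/-- A local form of the Hyers-Ulam theorem, with a quadratic error. -/
theorem exists_clm_of_quadratic_defect {A : Type*} [NormedAddCommGroup A] [NormedSpace ℝ A]
    [CompleteSpace A] {φ : V → A} {B C r : ℝ} (hr : 0 < r)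
    (hadd : ∀ x y, ‖x‖ ≤ r → ‖y‖ ≤ r → ‖φ (x + y) - φ x - φ y‖ ≤ B * (‖x‖ * ‖y‖))
    (hbd : ∀ x, ‖x‖ ≤ r → ‖φ x‖ ≤ C * ‖x‖) :
    ∃ L : V →L[ℝ] A, ∀ x, ‖x‖ ≤ r → ‖φ x - L x‖ ≤ B * ‖x‖ ^ 2 := by
  -- Hyers' construction: `L x` is the limit of `2 ^ k • φ (2 ^ (-k) • x)`.
  set ψ : ℕ → V → A := fun k x => (2 : ℝ) ^ k • φ ((2⁻¹ : ℝ) ^ k • x) with hψ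
  have hn : ∀ (k : ℕ) (x : V), ‖((2⁻¹ : ℝ) ^ k • x)‖ = 2⁻¹ ^ k * ‖x‖ := by
    intro k x
    rw [norm_smul, Real.norm_of_nonneg (by positivity)]
  have h2 : ∀ k : ℕ, (2 : ℝ) ^ k * 2⁻¹ ^ k = 1 := fun k => by
    rw [← mul_pow]; norm_num
  have hsmall : ∀ x : V, ∀ᶠ k : ℕ in atTop, ‖((2⁻¹ : ℝ) ^ k • x)‖ ≤ r := by
    intro x
    have : Tendsto (fun k : ℕ => (2⁻¹ : ℝ) ^ k * ‖x‖) atTop (𝓝 (0 * ‖x‖)) :=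
      (tendsto_pow_atTop_nhds_zero_of_lt_one (by norm_num) (by norm_num)).mul_const _
    rw [zero_mul] at this
    filter_upwards [this.eventually (ge_mem_nhds hr)] with k hk
    rw [hn]; exact hk
  -- Consecutive terms differ by `2 ^ k` times the defect of `φ` at a pair of equal vectors of norm
  -- `2 ^ (-k-1) * ‖x‖`. The defect is quadratic, so the differences decay geometrically.
  have hstep : ∀ (k : ℕ) (x : V), ‖((2⁻¹ : ℝ) ^ k • x)‖ ≤ r →
      ‖ψ (k + 1) x - ψ k x‖ ≤ B * ‖x‖ ^ 2 / 4 * 2⁻¹ ^ k := by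
    intro k x hk
    set y := ((2⁻¹ : ℝ) ^ (k + 1) • x) with hy
    have hyy : ((2⁻¹ : ℝ) ^ k • x) = y + y := by
      rw [hy, ← add_smul, pow_succ]; congr 1; ring
    have hyr : ‖y‖ ≤ r := by
      refine le_trans ?_ hk
      rw [hy, hn, hn, pow_succ]
      have : 0 ≤ (2⁻¹ : ℝ) ^ k * ‖x‖ := by positivity
      nlinarith
    have e : ψ (k + 1) x - ψ k x = -((2 : ℝ) ^ k • (φ (y + y) - φ y - φ y)) := by
      simp only [hψ, ← hyy]
      rw [← hy, pow_succ, mul_smul, two_smul, smul_sub, smul_sub, smul_add]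
      abel
    rw [e, norm_neg, norm_smul, Real.norm_of_nonneg (by positivity)]
    calc (2 : ℝ) ^ k * ‖φ (y + y) - φ y - φ y‖ ≤ 2 ^ k * (B * (‖y‖ * ‖y‖)) := by
          gcongr; exact hadd y y hyr hyr
      _ = B * ‖x‖ ^ 2 / 4 * 2⁻¹ ^ k := by
          rw [hy, hn, pow_succ]
          linear_combination (B * ‖x‖ ^ 2 / 4 * 2⁻¹ ^ k) * h2 k
  have hcauchy : ∀ x, CauchySeq (fun k => ψ k x) := by
    intro x
    obtain ⟨N, hN⟩ := eventually_atTop.1 (hsmall x)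
    refine (cauchySeq_shift N).1 (cauchySeq_of_le_geometric (2⁻¹ : ℝ) (B * ‖x‖ ^ 2 / 4 * 2⁻¹ ^ N)
      (by norm_num) fun k => ?_)
    rw [dist_comm, dist_eq_norm]
    have := hstep (k + N) x (hN _ (by lia))
    rw [show k + 1 + N = k + N + 1 by ring]
    refine this.trans_eq ?_
    rw [pow_add]; ring
  choose L hL using fun x => cauchySeq_tendsto_of_complete (hcauchy x)
  have hLbd : ∀ x, ‖L x‖ ≤ C * ‖x‖ := by
    intro x
    refine le_of_tendsto (hL x).norm ?_
    filter_upwards [hsmall x] with k hk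
    simp only [hψ]
    rw [norm_smul, Real.norm_of_nonneg (by positivity)]
    calc (2 : ℝ) ^ k * ‖φ ((2⁻¹ : ℝ) ^ k • x)‖ ≤ 2 ^ k * (C * ‖(2⁻¹ : ℝ) ^ k • x‖) := by
          gcongr; exact hbd _ hk
      _ = C * ‖x‖ := by rw [hn]; linear_combination (C * ‖x‖) * h2 k
  have hLadd : ∀ x y, L (x + y) = L x + L y := by
    intro x y
    have h1 : Tendsto (fun k => ψ k (x + y) - ψ k x - ψ k y) atTop (𝓝 (L (x + y) - L x - L y)) :=
      ((hL _).sub (hL _)).sub (hL _)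
    -- The defect of `ψ k` is at most `2 ^ k * 4 ^ (-k) * B * ‖x‖ * ‖y‖`, so the limit is exactly
    -- additive.
    have h0 : Tendsto (fun k => ψ k (x + y) - ψ k x - ψ k y) atTop (𝓝 0) := by
      have hz : Tendsto (fun k : ℕ => B * (‖x‖ * ‖y‖) * (2⁻¹ : ℝ) ^ k) atTop (𝓝 0) := by
        simpa using (tendsto_pow_atTop_nhds_zero_of_lt_one (r := (2⁻¹ : ℝ))
          (by norm_num) (by norm_num)).const_mul (B * (‖x‖ * ‖y‖))
      refine squeeze_zero_norm' ?_ hz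
      filter_upwards [hsmall x, hsmall y] with k hx hy
      have e : ψ k (x + y) - ψ k x - ψ k y = (2 : ℝ) ^ k • (φ ((2⁻¹ : ℝ) ^ k • x + (2⁻¹ : ℝ) ^ k • y)
          - φ ((2⁻¹ : ℝ) ^ k • x) - φ ((2⁻¹ : ℝ) ^ k • y)) := by
        simp only [hψ, smul_sub, smul_add]
      rw [e, norm_smul, Real.norm_of_nonneg (by positivity)]
      calc _ ≤ (2 : ℝ) ^ k * (B * (‖(2⁻¹ : ℝ) ^ k • x‖ * ‖(2⁻¹ : ℝ) ^ k • y‖)) := by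
            gcongr; exact hadd _ _ hx hy
        _ = _ := by rw [hn, hn]; linear_combination (B * (‖x‖ * ‖y‖) * 2⁻¹ ^ k) * h2 k
    have := tendsto_nhds_unique h1 h0
    rw [sub_sub, sub_eq_zero] at this
    exact this
  let L0 : V →+ A := AddMonoidHom.mk' L hLadd
  have hcont : Continuous L0 := AddMonoidHomClass.continuous_of_bound L0 C hLbd
  refine ⟨L0.toRealLinearMap hcont, fun x hx => ?_⟩
  have hxk : ∀ k : ℕ, ‖((2⁻¹ : ℝ) ^ k • x)‖ ≤ r := fun k => by
    rw [hn]
    refine le_trans ?_ hx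
    exact mul_le_of_le_one_left (norm_nonneg _) (pow_le_one₀ (by norm_num) (by norm_num))
  -- For `‖x‖ ≤ r` the estimate holds from `k = 0` on, and summing the geometric series bounds the
  -- distance from `ψ 0 x = φ x` to the limit.
  have h := dist_le_of_le_geometric_of_tendsto₀ (2⁻¹ : ℝ) (B * ‖x‖ ^ 2 / 4) (by norm_num)
    (fun k => by rw [dist_comm, dist_eq_norm]; exact hstep k x (hxk k)) (hL x)
  have hB : 0 ≤ B * ‖x‖ ^ 2 := by
    have := (norm_nonneg _).trans (hadd x x hx hx)
    nlinarith
  rw [dist_eq_norm] at h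
  simp only [hψ, pow_zero, one_smul] at h
  refine h.trans ?_
  have : B * ‖x‖ ^ 2 / 4 / (1 - 2⁻¹) = B * ‖x‖ ^ 2 / 2 := by ring
  rw [this]; linarith

/-- The doubling argument: a bounded function with `w x ≤ w (d x) / 2`, where `d x` is close to
`2 x`, is `O(‖x‖)` at the origin. -/
theorem exists_linear_bound_of_doubling {V : Type*} [NormedAddCommGroup V] {w : V → ℝ}
    {d : V → V} {K r : ℝ} (hr : 0 < r) (hK : 0 < K)
    (hw1 : ∀ x, ‖x‖ ≤ r → w x ≤ 1)
    (hw : ∀ x, ‖x‖ ≤ r → w x ≤ w (d x) / 2)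
    (hd : ∀ x, ‖x‖ ≤ r → ‖d x‖ ≤ 2 * ‖x‖ + K * ‖x‖ ^ 2) :
    ∃ C r', 0 < C ∧ 0 < r' ∧ ∀ x, ‖x‖ ≤ r' → w x ≤ C * ‖x‖ := by
  -- On `[0, r₁]` the function `h t = t - K / 2 * t ^ 2` is at least `t / 2`, and `h (2 * t + K * t
  -- ^ 2) ≤ 2 * h t`: the subtracted term pays for the quadratic excess of `d x` over `2 x`.
  set r₁ := min r (1 / K) with hr₁
  have hr₁0 : 0 < r₁ := by positivity
  have hr₁K : K * r₁ ≤ 1 := by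
    have : r₁ ≤ 1 / K := min_le_right _ _
    calc K * r₁ ≤ K * (1 / K) := by gcongr
      _ = 1 := by field_simp
  -- Chosen so that `C * h ‖x‖ ≥ 1 ≥ w x` as soon as `‖x‖ ≥ r₁ / 3`; below that radius `d x` stays
  -- in the ball of radius `r₁`.
  set C := 6 / r₁ with hC
  have hC0 : 0 < C := by positivity
  have hCr : C * r₁ = 6 := by rw [hC]; field_simp
  -- Each doubling halves the additive error, which starts at the trivial bound `1`.
  have key : ∀ (n : ℕ) (x : V), ‖x‖ ≤ r₁ →
      w x ≤ C * (‖x‖ - K / 2 * ‖x‖ ^ 2) + 2⁻¹ ^ n := by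
    intro n
    induction n with
    | zero =>
      intro x hx
      have hx0 := norm_nonneg x
      have : 0 ≤ ‖x‖ - K / 2 * ‖x‖ ^ 2 := by nlinarith
      have h1 := hw1 x (hx.trans (min_le_left _ _))
      have := mul_nonneg hC0.le this
      simpa using by linarith
    | succ n ih =>
      intro x hx
      have hx0 := norm_nonneg x
      have hp : (0 : ℝ) < 2⁻¹ ^ (n + 1) := by positivity
      rcases le_or_gt ‖x‖ (r₁ / 3) with h3 | h3
      · have hdx := hd x (hx.trans (min_le_left _ _))
        have hKx : K * ‖x‖ ≤ 1 / 3 := by nlinarith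
        have hd1 : ‖d x‖ ≤ r₁ := by nlinarith
        have h := ih (d x) hd1
        have h' := hw x (hx.trans (min_le_left _ _))
        set t := ‖x‖
        set s := ‖d x‖
        have hs0 : 0 ≤ s := norm_nonneg _
        have hmono : s - K / 2 * s ^ 2 ≤ (2 * t + K * t ^ 2) - K / 2 * (2 * t + K * t ^ 2) ^ 2 := by
          have h1 : K * (s + (2 * t + K * t ^ 2)) ≤ 2 := by nlinarith
          nlinarith [mul_nonneg (sub_nonneg.2 hdx) (sub_nonneg.2 h1)]
        have h4 : (2 * t + K * t ^ 2) - K / 2 * (2 * t + K * t ^ 2) ^ 2 ≤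
            2 * (t - K / 2 * t ^ 2) := by
          have : 4 * t ^ 2 ≤ (2 * t + K * t ^ 2) ^ 2 := by
            have : 0 ≤ K * t ^ 2 := by positivity
            nlinarith
          nlinarith
        have h5 := mul_le_mul_of_nonneg_left (hmono.trans h4) hC0.le
        rw [pow_succ (2⁻¹ : ℝ) n]
        linarith
      · have h1 := hw1 x (hx.trans (min_le_left _ _))
        have : ‖x‖ / 2 ≤ ‖x‖ - K / 2 * ‖x‖ ^ 2 := by
          have : K * ‖x‖ ≤ 1 := by nlinarith
          nlinarith
        have := mul_le_mul_of_nonneg_left this hC0.le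
        have : C * (r₁ / 3) ≤ C * ‖x‖ := by gcongr
        linarith
  refine ⟨C, r₁, hC0, hr₁0, fun x hx => ?_⟩
  have hlim : Tendsto (fun n : ℕ => C * (‖x‖ - K / 2 * ‖x‖ ^ 2) + (2⁻¹ : ℝ) ^ n) atTop
      (𝓝 (C * (‖x‖ - K / 2 * ‖x‖ ^ 2) + 0)) :=
    (tendsto_pow_atTop_nhds_zero_of_lt_one (by norm_num) (by norm_num)).const_add _
  have := ge_of_tendsto' hlim fun n => key n x hx
  have h0 : 0 ≤ C * (K / 2 * ‖x‖ ^ 2) := by positivity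
  linarith

/-- A local multiplication with unit `0` differs from the addition by a bilinear error. -/
theorem exists_bilinear_bound {m : V × V → V} (hm : ContDiffAt ℝ 2 m (0, 0))
    (h1 : ∀ᶠ x in 𝓝 (0 : V), m (x, 0) = x) (h2 : ∀ᶠ y in 𝓝 (0 : V), m (0, y) = y) :
    ∃ K r, 0 < K ∧ 0 < r ∧ ∀ x y, ‖x‖ ≤ r → ‖y‖ ≤ r → ‖m (x, y) - x - y‖ ≤ K * (‖x‖ * ‖y‖) := by
  have hd : ContDiffAt ℝ 1 (fderiv ℝ m) (0, 0) := hm.fderiv_right (by norm_num)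
  obtain ⟨K, s, hs, hlip⟩ := hd.exists_lipschitzOnWith
  have hdiff : ∀ᶠ p in 𝓝 ((0, 0) : V × V), DifferentiableAt ℝ m p :=
    (hm.eventually (by simp)).mono fun p hp => hp.differentiableAt (by norm_num)
  obtain ⟨r, hr, hball⟩ := Metric.eventually_nhds_iff_ball.1 (hdiff.and hs)
  obtain ⟨r1, hr1, hball1⟩ := Metric.eventually_nhds_iff_ball.1 h1
  obtain ⟨r2, hr2, hball2⟩ := Metric.eventually_nhds_iff_ball.1 h2
  set R := min r (min r1 r2) / 2 with hR
  have hR0 : 0 < R := by positivity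
  have hRr : R < r := by
    have : min r (min r1 r2) ≤ r := min_le_left _ _
    linarith [show 0 < min r (min r1 r2) by positivity]
  have hRr1 : R < r1 := by
    have : min r (min r1 r2) ≤ r1 := (min_le_right _ _).trans (min_le_left _ _)
    linarith [show 0 < min r (min r1 r2) by positivity]
  have hRr2 : R < r2 := by
    have : min r (min r1 r2) ≤ r2 := (min_le_right _ _).trans (min_le_right _ _)
    linarith [show 0 < min r (min r1 r2) by positivity]
  have hmem : ∀ x y : V, ‖x‖ ≤ R → ‖y‖ ≤ R → (x, y) ∈ ball ((0, 0) : V × V) r := by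
    intro x y hx hy
    rw [← Prod.zero_eq_mk, mem_ball_zero_iff, Prod.norm_def]
    exact (max_le hx hy).trans_lt hRr
  refine ⟨K + 1, R, by positivity, hR0, fun x y hx hy => ?_⟩
  -- The derivative of `g` is the difference of the partial derivatives of `m` at `(x, z)` and `(0,
  -- z)`, hence `O(‖x‖)` because `fderiv ℝ m` is Lipschitz. The mean value inequality in `z` adds
  -- the factor `‖y‖`.
  let g : V → V := fun z => m (x, z) - m (0, z)
  have hg : ∀ z ∈ closedBall (0 : V) R, HasFDerivWithinAt g
      ((fderiv ℝ m (x, z) - fderiv ℝ m (0, z)).comp (ContinuousLinearMap.inr ℝ V V))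
      (closedBall 0 R) z := by
    intro z hz
    rw [mem_closedBall_zero_iff] at hz
    have e1 := (hball _ (hmem x z hx hz)).1.hasFDerivAt.comp z (hasFDerivAt_prodMk_right x z)
    have e2 := (hball _ (hmem 0 z (by simpa using hR0.le) hz)).1.hasFDerivAt.comp z
      (hasFDerivAt_prodMk_right 0 z)
    exact (e1.sub e2).hasFDerivWithinAt
  have hbound : ∀ z ∈ closedBall (0 : V) R,
      ‖(fderiv ℝ m (x, z) - fderiv ℝ m (0, z)).comp (ContinuousLinearMap.inr ℝ V V)‖ ≤
        K * ‖x‖ := by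
    intro z hz
    rw [mem_closedBall_zero_iff] at hz
    have h := hlip.norm_sub_le (hball _ (hmem x z hx hz)).2
      (hball _ (hmem 0 z (by simpa using hR0.le) hz)).2
    have e : ‖((x, z) : V × V) - (0, z)‖ = ‖x‖ := by simp [Prod.norm_def]
    rw [e] at h
    refine (ContinuousLinearMap.opNorm_comp_le _ _).trans ?_
    calc _ ≤ (K * ‖x‖) * 1 := by
          gcongr
          exact ContinuousLinearMap.norm_inr_le_one ℝ V V
      _ = _ := mul_one _
  have h := (convex_closedBall (0 : V) R).norm_image_sub_le_of_norm_hasFDerivWithin_le hg hbound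
    (mem_closedBall_self hR0.le) (mem_closedBall_zero_iff.2 hy)
  have e0 : g y - g 0 = m (x, y) - x - y := by
    have a1 := hball1 x (mem_ball_zero_iff.2 (hx.trans_lt hRr1))
    have a2 := hball2 y (mem_ball_zero_iff.2 (hy.trans_lt hRr2))
    have a3 := hball2 0 (mem_ball_self hr2)
    simp only [g, a1, a2, a3]
    abel
  rw [e0, sub_zero] at h
  refine h.trans ?_
  have : 0 ≤ ‖x‖ * ‖y‖ := by positivity
  nlinarith

variable {A : Type*} [NormedRing A] [NormedAlgebra ℝ A]

/-- A continuous local homomorphism into a normed ring is `O(‖x‖)`-close to `1`. -/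
theorem exists_linear_bound_of_localHom {f : V → A} {m : V × V → V}
    (hm : ContDiffAt ℝ 2 m (0, 0))
    (h1 : ∀ᶠ x in 𝓝 (0 : V), m (x, 0) = x) (h2 : ∀ᶠ y in 𝓝 (0 : V), m (0, y) = y)
    (hf0 : f 0 = 1) (hf : ContinuousAt f 0) (hfm : ∀ᶠ x in 𝓝 (0 : V), f (m (x, x)) = f x * f x) :
    ∃ C r, 0 < C ∧ 0 < r ∧ ∀ x, ‖x‖ ≤ r → ‖f x - 1‖ ≤ C * ‖x‖ := by
  obtain ⟨K, r, hK, hr, hbil⟩ := exists_bilinear_bound hm h1 h2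
  have hsm : ∀ᶠ x in 𝓝 (0 : V), ‖f x - 1‖ ≤ 1 / 4 := by
    have : Tendsto (fun x => ‖f x - 1‖) (𝓝 0) (𝓝 0) := by
      have := (hf.sub_const 1).norm
      simpa [ContinuousAt, hf0] using this
    exact this.eventually (ge_mem_nhds (by norm_num))
  obtain ⟨s, hs, hs'⟩ := Metric.eventually_nhds_iff_ball.1 (hsm.and hfm)
  set R := min r (s / 2) with hR
  have hR0 : 0 < R := by positivity
  have hRs : ∀ x : V, ‖x‖ ≤ R → ‖f x - 1‖ ≤ 1 / 4 ∧ f (m (x, x)) = f x * f x := fun x hx =>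
    hs' x (mem_ball_zero_iff.2 (by linarith [min_le_right r (s / 2)]))
  -- With `q = ‖f x - 1‖` and `p = ‖f (m (x, x)) - 1‖`, squaring gives only `2 * q - q ^ 2 ≤ p`.
  -- Adding `q ^ 2` to the gauge absorbs the loss: `2 * (q + q ^ 2) ≤ p + p ^ 2` when `q ≤ 1 / 4`.
  let w : V → ℝ := fun x => ‖f x - 1‖ + ‖f x - 1‖ ^ 2
  obtain ⟨C, r', hC, hr', hw⟩ := exists_linear_bound_of_doubling (w := w)
    (d := fun x => m (x, x)) hR0 hK
    (fun x hx => by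
      have := (hRs x hx).1
      have h0 := norm_nonneg (f x - 1)
      simp only [w]
      nlinarith)
    (fun x hx => by
      obtain ⟨h3, h4⟩ := hRs x hx
      have h0 := norm_nonneg (f x - 1)
      have e : f (m (x, x)) - 1 = (f x - 1) + (f x - 1) + (f x - 1) * (f x - 1) := by
        rw [h4]; noncomm_ring
      have h5 : 2 * ‖f x - 1‖ - ‖f x - 1‖ ^ 2 ≤ ‖f (m (x, x)) - 1‖ := by
        have a1 : ‖(f x - 1) + (f x - 1)‖ = 2 * ‖f x - 1‖ := by
          rw [← two_smul ℝ (f x - 1), norm_smul]; norm_num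
        have a2 : ‖(f x - 1) * (f x - 1)‖ ≤ ‖f x - 1‖ ^ 2 := by
          rw [sq]; exact norm_mul_le _ _
        have a3 := norm_sub_le (f (m (x, x)) - 1) ((f x - 1) * (f x - 1))
        rw [e, add_sub_cancel_right, a1] at a3
        rw [e]; linarith
      simp only [w]
      set q := ‖f x - 1‖
      set p := ‖f (m (x, x)) - 1‖
      have h6 : 0 ≤ 2 * q - q ^ 2 := by nlinarith
      have h7 : (2 * q - q ^ 2) ^ 2 ≤ p ^ 2 := pow_le_pow_left₀ h6 h5 2
      have h8 : 2 * (q + q ^ 2) ≤ (2 * q - q ^ 2) + (2 * q - q ^ 2) ^ 2 := by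
        have : 0 ≤ q ^ 2 * (1 - 4 * q + q ^ 2) := by
          apply mul_nonneg (sq_nonneg _); nlinarith
        nlinarith
      linarith)
    (fun x hx => by
      have h3 := hbil x x (hx.trans (min_le_left _ _)) (hx.trans (min_le_left _ _))
      have h4 := norm_add_le (m (x, x) - x - x) (x + x)
      have h5 := norm_add_le x x
      rw [show m (x, x) - x - x + (x + x) = m (x, x) by abel] at h4
      nlinarith)
  refine ⟨C, r', hC, hr', fun x hx => (le_trans ?_ (hw x hx))⟩
  simp only [w]
  nlinarith [sq_nonneg ‖f x - 1‖]

/-- A continuous local homomorphism from a local group into a Banach algebra is differentiable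
at the unit. -/
theorem differentiableAt_of_localHom [CompleteSpace A] {f : V → A} {m n : V × V → V}
    (hm : ContDiffAt ℝ 2 m (0, 0)) (hn : ContDiffAt ℝ 1 n (0, 0))
    (h1 : ∀ᶠ x in 𝓝 (0 : V), m (x, 0) = x) (h2 : ∀ᶠ y in 𝓝 (0 : V), m (0, y) = y)
    (h3 : ∀ᶠ x in 𝓝 (0 : V), n (x, x) = 0)
    (hf0 : f 0 = 1) (hf : ContinuousAt f 0)
    (hfm : ∀ᶠ p in 𝓝 ((0, 0) : V × V), f (m p) = f p.1 * f p.2)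
    (hfn : ∀ᶠ p in 𝓝 ((0, 0) : V × V), f p.2 = f p.1 * f (n p)) :
    DifferentiableAt ℝ f 0 := by
  have hdiag : Tendsto (fun x : V => (x, x)) (𝓝 0) (𝓝 (0, 0)) :=
    (continuous_id.prodMk continuous_id).tendsto' _ _ rfl
  obtain ⟨C, r₀, hC, hr₀, hlin⟩ := exists_linear_bound_of_localHom hm h1 h2 hf0 hf
    (hdiag.eventually hfm)
  obtain ⟨K, r₁, hK, hr₁, hbil⟩ := exists_bilinear_bound hm h1 h2
  obtain ⟨K', s, hs, hlip⟩ := hn.exists_lipschitzOnWith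
  have hm0 : Tendsto m (𝓝 (0, 0)) (𝓝 0) := by
    have := hm.continuousAt.tendsto
    rwa [h1.self_of_nhds] at this
  have hn0 : Tendsto n (𝓝 (0, 0)) (𝓝 0) := by
    have := hn.continuousAt.tendsto
    rwa [h3.self_of_nhds] at this
  have hb : ∀ᶠ x in 𝓝 (0 : V), ‖f x‖ ≤ ‖(1 : A)‖ + 1 := by
    have h := hf.norm.tendsto
    rw [hf0] at h
    exact h.eventually (ge_mem_nhds (by linarith))
  have hfst : Tendsto (Prod.fst : V × V → V) (𝓝 (0, 0)) (𝓝 0) := continuous_fst.tendsto _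
  -- near the origin, `f` is Lipschitz
  obtain ⟨K₂, hK₂, hlipf⟩ : ∃ K₂ : ℝ, 0 ≤ K₂ ∧
      ∀ᶠ p in 𝓝 ((0, 0) : V × V), ‖f p.2 - f p.1‖ ≤ K₂ * ‖p.2 - p.1‖ := by
    refine ⟨(‖(1 : A)‖ + 1) * (C * K'), by positivity, ?_⟩
    have hmid : Tendsto (fun p : V × V => (p.1, p.1)) (𝓝 (0, 0)) (𝓝 (0, 0)) :=
      (continuous_fst.prodMk continuous_fst).tendsto' _ _ rfl
    have hnr : ∀ᶠ p in 𝓝 ((0, 0) : V × V), ‖n p‖ ≤ r₀ := by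
      have h := hn0.norm
      rw [norm_zero] at h
      exact h.eventually (ge_mem_nhds hr₀)
    filter_upwards [hfn, hs, hmid.eventually hs, hnr, hfst.eventually hb,
      hfst.eventually h3] with p hp hps hps' hpr hpb hp3
    -- In the model, `n (x, y)` is `x⁻¹ y`: it vanishes on the diagonal and is Lipschitz, so the
    -- linear bound at the unit moves to every nearby point.
    have e : f p.2 - f p.1 = f p.1 * (f (n p) - 1) := by rw [hp]; noncomm_ring
    have h4 := hlip.norm_sub_le hps hps'
    rw [hp3, sub_zero] at h4
    have h5 : ‖p - (p.1, p.1)‖ = ‖p.2 - p.1‖ := by simp [Prod.norm_def]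
    rw [h5] at h4
    rw [e]
    calc _ ≤ ‖f p.1‖ * ‖f (n p) - 1‖ := norm_mul_le _ _
      _ ≤ (‖(1 : A)‖ + 1) * (C * ‖n p‖) := by gcongr; exact hlin _ hpr
      _ ≤ (‖(1 : A)‖ + 1) * (C * (K' * ‖p.2 - p.1‖)) := by gcongr
      _ = _ := by ring
  have hpair : Tendsto (fun p : V × V => (m p, p.1 + p.2)) (𝓝 (0, 0)) (𝓝 (0, 0)) := by
    refine hm0.prodMk_nhds ?_
    exact (continuous_fst.add continuous_snd).tendsto' _ _ (by simp)
  obtain ⟨r₂, hr₂, hball⟩ := Metric.eventually_nhds_iff_ball.1 ((hpair.eventually hlipf).and hfm)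
  set R := min (min r₀ r₁) (r₂ / 2) with hR
  have hR0 : 0 < R := by positivity
  have hRr₀ : R ≤ r₀ := (min_le_left _ _).trans (min_le_left _ _)
  have hRr₁ : R ≤ r₁ := (min_le_left _ _).trans (min_le_right _ _)
  have hRr₂ : R < r₂ := by linarith [min_le_right (min r₀ r₁) (r₂ / 2)]
  obtain ⟨L, hL⟩ := exists_clm_of_quadratic_defect (φ := fun x => f x - 1)
    (B := K₂ * K + C ^ 2) (C := C) hR0
    (fun x y hx hy => by
      have hxy : (x, y) ∈ ball ((0, 0) : V × V) r₂ := by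
        rw [← Prod.zero_eq_mk, mem_ball_zero_iff, Prod.norm_def]
        exact (max_le hx hy).trans_lt hRr₂
      obtain ⟨h4, h5⟩ := hball _ hxy
      simp only at h4 h5
      -- Both terms are `O(‖x‖ * ‖y‖)`: the first by the Lipschitz bound and the bilinear estimate
      -- for `m`, the second by the linear bound on `f - 1`.
      have e : f (x + y) - 1 - (f x - 1) - (f y - 1) =
          (f (x + y) - f (m (x, y))) + (f x - 1) * (f y - 1) := by
        rw [h5]; noncomm_ring
      have h6 := hbil x y (hx.trans hRr₁) (hy.trans hRr₁)
      have h7 : ‖x + y - m (x, y)‖ ≤ K * (‖x‖ * ‖y‖) := by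
        rw [← norm_neg, show -(x + y - m (x, y)) = m (x, y) - x - y by abel]
        exact h6
      rw [e]
      calc _ ≤ ‖f (x + y) - f (m (x, y))‖ + ‖(f x - 1) * (f y - 1)‖ := norm_add_le _ _
        _ ≤ K₂ * (K * (‖x‖ * ‖y‖)) + (C * ‖x‖) * (C * ‖y‖) := by
          gcongr
          · exact h4.trans (by gcongr)
          · refine (norm_mul_le _ _).trans ?_
            gcongr
            · exact hlin _ (hx.trans hRr₀)
            · exact hlin _ (hy.trans hRr₀)
        _ = _ := by ring)
    (fun x hx => hlin x (hx.trans hRr₀))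
  have hd : HasFDerivAt f L 0 := by
    refine HasFDerivAt.of_isLittleO ?_
    have hO : (fun x : V => f x - f 0 - L (x - 0)) =O[𝓝 0] fun x => ‖x‖ ^ 2 := by
      refine Asymptotics.IsBigO.of_bound (K₂ * K + C ^ 2) ?_
      filter_upwards [Metric.closedBall_mem_nhds (0 : V) hR0] with x hx
      have := hL x (mem_closedBall_zero_iff.1 hx)
      simpa [hf0] using this
    refine hO.trans_isLittleO ?_
    simpa using (Asymptotics.isLittleO_norm_pow_id (E' := V) (n := 2) (by norm_num))
  exact hd.differentiableAt

/-- A continuous local homomorphism from a smooth local group into a Banach algebra is smooth. -/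
theorem contDiffOn_of_localHom [CompleteSpace A] {f : V → A} {m n : V × V → V} {O : Set V}
    (hO : IsOpen O) (h0 : (0 : V) ∈ O)
    (hm : ContDiffAt ℝ 2 m (0, 0)) (hn : ContDiffOn ℝ ∞ n (O ×ˢ O))
    (h1 : ∀ x ∈ O, m (x, 0) = x) (h2 : ∀ y ∈ O, m (0, y) = y)
    (h3 : ∀ x ∈ O, n (x, x) = 0)
    (hf0 : f 0 = 1) (hf : ContinuousAt f 0)
    (hfm : ∀ x ∈ O, ∀ y ∈ O, f (m (x, y)) = f x * f y)
    (hfn : ∀ x ∈ O, ∀ y ∈ O, f y = f x * f (n (x, y))) :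
    ContDiffOn ℝ ∞ f O := by
  have hO0 := hO.mem_nhds h0
  have hOO : ∀ {x y : V}, x ∈ O → y ∈ O → O ×ˢ O ∈ 𝓝 (x, y) := fun hx hy =>
    prod_mem_nhds (hO.mem_nhds hx) (hO.mem_nhds hy)
  have hd0 : DifferentiableAt ℝ f 0 := by
    refine differentiableAt_of_localHom hm ((hn.contDiffAt (hOO h0 h0)).of_le (by simp))
      (Filter.mem_of_superset hO0 h1) (Filter.mem_of_superset hO0 h2)
      (Filter.mem_of_superset hO0 h3) hf0 hf ?_ ?_
    · filter_upwards [hOO h0 h0] with p hp using hfm _ hp.1 _ hp.2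
    · filter_upwards [hOO h0 h0] with p hp using hfn _ hp.1 _ hp.2
  set L := fderiv ℝ f 0
  let N : V → V →L[ℝ] V := fun x => (fderiv ℝ n (x, x)).comp (ContinuousLinearMap.inr ℝ V V)
  -- Differentiating `f y = f x * f (n (x, y))` in `y` at `y = x` gives `f' x = f x * L (N x ·)`,
  -- where `L` is the derivative at the unit.
  let T : V → V →L[ℝ] A := fun x =>
    (ContinuousLinearMap.mul ℝ A (f x)).comp (L.comp (N x))
  have hderiv : ∀ x ∈ O, HasFDerivAt f (T x) x := by
    intro x hx
    have e1 : HasFDerivAt (fun y => n (x, y)) (N x) x :=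
      ((hn.contDiffAt (hOO hx hx)).differentiableAt (by simp)).hasFDerivAt.comp x
        (hasFDerivAt_prodMk_right x x)
    have e2 : HasFDerivAt f L (n (x, x)) := by rw [h3 x hx]; exact hd0.hasFDerivAt
    have e3 := ((ContinuousLinearMap.mul ℝ A (f x)).hasFDerivAt (x := f (n (x, x)))).comp x
      (e2.comp x e1)
    refine e3.congr_of_eventuallyEq ?_
    filter_upwards [hO.mem_nhds hx] with y hy
    simpa using hfn x hx y hy
  have hN : ContDiffOn ℝ ∞ N O := by
    have e1 : ContDiffOn ℝ ∞ (fderiv ℝ n) (O ×ˢ O) :=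
      hn.fderiv_of_isOpen (hO.prod hO) (by simp)
    have e2 : ContDiffOn ℝ ∞ (fun x => fderiv ℝ n (x, x)) O :=
      e1.comp (contDiff_id.prodMk contDiff_id).contDiffOn (fun x hx => ⟨hx, hx⟩)
    exact e2.clm_comp contDiffOn_const
  -- Bootstrap: `T` involves `f` itself and the smooth `N`, so `f` of class `C^k` has a derivative
  -- of class `C^k`.
  have hkey : ∀ k : ℕ, ContDiffOn ℝ k f O := by
    intro k
    induction k with
    | zero =>
      rw [Nat.cast_zero, contDiffOn_zero]
      exact fun x hx => (hderiv x hx).continuousAt.continuousWithinAt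
    | succ k ih =>
      rw [Nat.cast_succ, contDiffOn_succ_iff_fderiv_of_isOpen hO]
      refine ⟨fun x hx => (hderiv x hx).differentiableAt.differentiableWithinAt, by simp, ?_⟩
      have hT : ContDiffOn ℝ k T O := by
        have a : ContDiffOn ℝ k (fun x => ContinuousLinearMap.mul ℝ A (f x)) O :=
          (ContinuousLinearMap.mul ℝ A).contDiff.comp_contDiffOn ih
        exact a.clm_comp (contDiffOn_const.clm_comp (hN.of_le (by exact_mod_cast le_top)))
      exact hT.congr fun x hx => (hderiv x hx).fderiv
  exact contDiffOn_infty.2 hkey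

end LocalHom

/-! ### Smoothness of norm-continuous representations -/

section SmoothRepresentation

open Filter Topology

variable {F : Type*} [NormedAddCommGroup F] [NormedSpace ℝ F]
  {G : Type*} [TopologicalSpace G] [ChartedSpace F G] [Group G] [LieGroup 𝓘(ℝ, F) ∞ G]
  {A : Type*} [NormedRing A] [NormedAlgebra ℝ A] [CompleteSpace A]

/-- A norm-continuous homomorphism from a Banach-Lie group into a Banach algebra is smooth
at `1`. -/
theorem contMDiffAt_one_of_continuous (ρ : G →* A) (hρ : Continuous ρ) :
    ContMDiffAt 𝓘(ℝ, F) 𝓘(ℝ, A) ∞ (fun g => ρ g) 1 := by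
  have : IsTopologicalGroup G := topologicalGroup_of_lieGroup 𝓘(ℝ, F) ∞
  set e := chartAt F (1 : G) with he
  set a := e 1 with ha
  have h1e : (1 : G) ∈ e.source := mem_chart_source F 1
  have haT : a ∈ e.target := e.map_source h1e
  have hea : e.symm a = 1 := e.left_inv h1e
  let ψ : F → G := fun x => e.symm (a + x)
  have hψ0 : ψ 0 = 1 := by simp [ψ, hea]
  let U : Set F := (fun x => a + x) ⁻¹' e.target
  have hU : IsOpen U := e.open_target.preimage (by fun_prop)
  have h0U : (0 : F) ∈ U := by simpa [U] using haT
  have hψsm : ContMDiffOn 𝓘(ℝ, F) 𝓘(ℝ, F) ∞ ψ U :=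
    (contMDiffOn_chart_symm (I := 𝓘(ℝ, F)) (n := ∞) (x := (1 : G))).comp
      ((contDiff_const.add contDiff_id).contMDiff.contMDiffOn) (fun x hx => hx)
  have hψs : ∀ x ∈ U, ψ x ∈ e.source := fun x hx => e.map_target hx
  have heψ : ∀ x ∈ U, e (ψ x) = a + x := fun x hx => e.right_inv hx
  -- Read in the chart centred at `1`, `M` and `D` become the local product `m` and the local
  -- division `n`.
  let M : F × F → G := fun p => ψ p.1 * ψ p.2
  let D : F × F → G := fun p => (ψ p.1)⁻¹ * ψ p.2
  have hψ1 : ContMDiffOn 𝓘(ℝ, F × F) 𝓘(ℝ, F) ∞ (fun p : F × F => ψ p.1) (U ×ˢ U) :=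
    hψsm.comp contDiff_fst.contMDiff.contMDiffOn (fun p hp => hp.1)
  have hψ2 : ContMDiffOn 𝓘(ℝ, F × F) 𝓘(ℝ, F) ∞ (fun p : F × F => ψ p.2) (U ×ˢ U) :=
    hψsm.comp contDiff_snd.contMDiff.contMDiffOn (fun p hp => hp.2)
  have hMsm : ContMDiffOn 𝓘(ℝ, F × F) 𝓘(ℝ, F) ∞ M (U ×ˢ U) := hψ1.mul hψ2
  have hDsm : ContMDiffOn 𝓘(ℝ, F × F) 𝓘(ℝ, F) ∞ D (U ×ˢ U) := hψ1.inv.mul hψ2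
  have hUU : U ×ˢ U ∈ 𝓝 ((0, 0) : F × F) := prod_mem_nhds (hU.mem_nhds h0U) (hU.mem_nhds h0U)
  have hM0 : M (0, 0) = 1 := by simp [M, hψ0]
  have hD0 : D (0, 0) = 1 := by simp [D]
  have hMe : ∀ᶠ p in 𝓝 ((0, 0) : F × F), M p ∈ e.source :=
    (hMsm.contMDiffAt hUU).continuousAt.preimage_mem_nhds
      (by rw [hM0]; exact e.open_source.mem_nhds h1e)
  have hDe : ∀ᶠ p in 𝓝 ((0, 0) : F × F), D p ∈ e.source :=
    (hDsm.contMDiffAt hUU).continuousAt.preimage_mem_nhds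
      (by rw [hD0]; exact e.open_source.mem_nhds h1e)
  have hall : {p : F × F | p ∈ U ×ˢ U ∧ M p ∈ e.source ∧ D p ∈ e.source} ∈ 𝓝 ((0, 0) : F × F) := by
    filter_upwards [hUU, hMe, hDe] with p h h' h'' using ⟨h, h', h''⟩
  rw [nhds_prod_eq, mem_prod_same_iff] at hall
  obtain ⟨t, ht, htt⟩ := hall
  obtain ⟨O, hOt, hO, h0O⟩ := mem_nhds_iff.1 ht
  have hOO : ∀ p ∈ O ×ˢ O, p ∈ U ×ˢ U ∧ M p ∈ e.source ∧ D p ∈ e.source := fun p hp =>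
    htt ⟨hOt hp.1, hOt hp.2⟩
  let m : F × F → F := fun p => e (M p) - a
  let n : F × F → F := fun p => e (D p) - a
  have hchart : ContMDiffOn 𝓘(ℝ, F) 𝓘(ℝ, F) ∞ e e.source := contMDiffOn_chart
  have hmsm : ContDiffOn ℝ ∞ m (O ×ˢ O) := by
    have : ContMDiffOn 𝓘(ℝ, F × F) 𝓘(ℝ, F) ∞ (fun p => e (M p)) (O ×ˢ O) :=
      hchart.comp (hMsm.mono fun p hp => (hOO p hp).1) fun p hp => (hOO p hp).2.1
    exact this.contDiffOn.sub contDiffOn_const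
  have hnsm : ContDiffOn ℝ ∞ n (O ×ˢ O) := by
    have : ContMDiffOn 𝓘(ℝ, F × F) 𝓘(ℝ, F) ∞ (fun p => e (D p)) (O ×ˢ O) :=
      hchart.comp (hDsm.mono fun p hp => (hOO p hp).1) fun p hp => (hOO p hp).2.2
    exact this.contDiffOn.sub contDiffOn_const
  have hψm : ∀ p ∈ O ×ˢ O, ψ (m p) = M p := fun p hp => by
    simp only [ψ, m, add_sub_cancel]
    exact e.left_inv (hOO p hp).2.1
  have hψn : ∀ p ∈ O ×ˢ O, ψ (n p) = D p := fun p hp => by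
    simp only [ψ, n, add_sub_cancel]
    exact e.left_inv (hOO p hp).2.2
  have hOU : ∀ x ∈ O, x ∈ U := fun x hx => (hOO (x, x) ⟨hx, hx⟩).1.1
  have hf := contDiffOn_of_localHom (f := fun x => ρ (ψ x)) (m := m) (n := n) hO h0O
    (contDiffAt_infty.1 (hmsm.contDiffAt (prod_mem_nhds (hO.mem_nhds h0O) (hO.mem_nhds h0O))) 2)
    hnsm
    (fun x hx => by simp [m, M, hψ0, heψ x (hOU x hx)])
    (fun x hx => by simp [m, M, hψ0, heψ x (hOU x hx)])
    (fun x hx => by simp [n, D, a])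
    (by simp [hψ0])
    (hρ.continuousAt.comp (hψsm.contMDiffAt (hU.mem_nhds h0U)).continuousAt)
    (fun x hx y hy => by rw [hψm (x, y) ⟨hx, hy⟩, map_mul])
    (fun x hx y hy => by
      rw [hψn (x, y) ⟨hx, hy⟩, ← map_mul]
      simp [D])
  have hfa : ContMDiffAt 𝓘(ℝ, F) 𝓘(ℝ, A) ∞ (fun x => ρ (ψ x)) ((fun g => e g - a) 1) := by
    simp only [ha, sub_self]
    exact (hf.contDiffAt (hO.mem_nhds h0O)).contMDiffAt
  have hec : ContMDiffAt 𝓘(ℝ, F) 𝓘(ℝ, F) ∞ (fun g => e g - a) 1 :=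
    (hchart.contMDiffAt (e.open_source.mem_nhds h1e)).sub contMDiffAt_const
  refine (hfa.comp 1 hec).congr_of_eventuallyEq ?_
  filter_upwards [e.open_source.mem_nhds h1e] with g hg
  simp [ψ, e.left_inv hg]

/-- A norm-continuous homomorphism from a Banach-Lie group into a Banach algebra is smooth. -/
theorem contMDiff_of_continuous (ρ : G →* A) (hρ : Continuous ρ) :
    ContMDiff 𝓘(ℝ, F) 𝓘(ℝ, A) ∞ (fun g => ρ g) := by
  intro g
  have h1 : ContMDiffAt 𝓘(ℝ, F) 𝓘(ℝ, F) ∞ (fun x => g⁻¹ * x) g :=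
    contMDiff_mul_left.contMDiffAt
  have h2 : ContMDiffAt 𝓘(ℝ, F) 𝓘(ℝ, A) ∞ (fun x => ρ (g⁻¹ * x)) g := by
    refine ContMDiffAt.comp g ?_ h1
    rw [inv_mul_cancel]
    exact contMDiffAt_one_of_continuous ρ hρ
  have h3 : ContMDiffAt 𝓘(ℝ, F) 𝓘(ℝ, A) ∞ (fun x => ContinuousLinearMap.mul ℝ A (ρ g)
      (ρ (g⁻¹ * x))) g :=
    (ContinuousLinearMap.mul ℝ A (ρ g)).contDiff.contMDiff.contMDiffAt.comp g h2
  refine h3.congr_of_eventuallyEq (Eventually.of_forall fun x => ?_)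
  simp [← map_mul]

end SmoothRepresentation

/-! ### Inverse functions and complements -/

section InverseFunction

open Filter Topology

/-- The inverse function theorem, with smoothness of the inverse on its whole domain. -/
theorem exists_openPartialHomeomorph_of_contDiffOn {E F : Type*} [NormedAddCommGroup E]
    [NormedSpace ℝ E] [CompleteSpace E] [NormedAddCommGroup F] [NormedSpace ℝ F]
    {f : E → F} {U : Set E} (hU : IsOpen U) (hf : ContDiffOn ℝ ∞ f U) {a : E} (ha : a ∈ U)
    (L : E ≃L[ℝ] F) (hL : HasFDerivAt f (L : E →L[ℝ] F) a) :
    ∃ Φ : OpenPartialHomeomorph E F, (Φ : E → F) = f ∧ a ∈ Φ.source ∧ Φ.source ⊆ U ∧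
      ContDiffOn ℝ ∞ Φ.symm Φ.target := by
  have hfa : ContDiffAt ℝ ∞ f a := hf.contDiffAt (hU.mem_nhds ha)
  have hcont : ContinuousOn (fderiv ℝ f) U := hf.continuousOn_fderiv_of_isOpen hU (by simp)
  -- Invertible operators form an open set. Restricting to points with invertible derivative makes
  -- the inverse smooth on its whole domain and not only at the image of `a`.
  let O : Set E := U ∩ fderiv ℝ f ⁻¹' Set.range ((↑) : (E ≃L[ℝ] F) → (E →L[ℝ] F))
  have hO : IsOpen O := hcont.isOpen_inter_preimage hU ContinuousLinearEquiv.isOpen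
  have haO : a ∈ O := ⟨ha, L, hL.fderiv.symm⟩
  let Φ₀ := hfa.toOpenPartialHomeomorph f hL (by simp)
  refine ⟨Φ₀.restrOpen O hO, rfl, ⟨hfa.mem_toOpenPartialHomeomorph_source hL (by simp), haO⟩,
    fun x hx => hx.2.1, ?_⟩
  intro y hy
  have hx := (Φ₀.restrOpen O hO).map_target hy
  obtain ⟨-, hxU, L', hL'⟩ := hx
  have hxa : ContDiffAt ℝ ∞ f ((Φ₀.restrOpen O hO).symm y) := hf.contDiffAt (hU.mem_nhds hxU)
  refine ((Φ₀.restrOpen O hO).contDiffAt_symm (f₀' := L') hy ?_ hxa).contDiffWithinAt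
  have := (hxa.differentiableAt (by simp)).hasFDerivAt
  rw [← hL'] at this
  exact this

/-- A complement of the range of an injective continuous linear map with closed complemented
range. -/
theorem exists_complement_equiv {E F : Type*} [NormedAddCommGroup E]
    [NormedSpace ℝ E] [CompleteSpace E] [NormedAddCommGroup F] [NormedSpace ℝ F] [CompleteSpace F]
    (j : F →L[ℝ] E) (hj : Function.Injective j) (hr : j.range.ClosedComplemented) :
    ∃ C : Submodule ℝ E, IsClosed (C : Set E) ∧
      ∃ L : (C × F) ≃L[ℝ] E, ∀ p, L p = (p.1 : E) + j p.2 := by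
  obtain ⟨C, hC, hcompl⟩ := hr.exists_isClosed_isCompl
  have := hC.completeSpace_coe
  refine ⟨C, hC, ContinuousLinearEquiv.ofBijective
    (C.subtypeL.coprod j) ?_ ?_, fun p => rfl⟩
  · refine LinearMap.ker_eq_bot'.2 ?_
    rintro ⟨c, y⟩ h
    have h' : (c : E) + j y = 0 := h
    have hc : (c : E) ∈ j.range := by
      rw [eq_neg_of_add_eq_zero_left h', ← map_neg]
      exact ⟨-y, rfl⟩
    have h0 : (c : E) = 0 := Submodule.disjoint_def.1 hcompl.disjoint _ hc c.2
    rw [h0, zero_add] at h'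
    have hy : y = 0 := hj (by rw [h', map_zero])
    exact Prod.ext (Subtype.ext h0) hy
  · refine LinearMap.range_eq_top.2 fun x => ?_
    have hx : x ∈ j.range ⊔ C := by rw [hcompl.sup_eq_top]; trivial
    obtain ⟨_, ⟨y, rfl⟩, c, hc, rfl⟩ := Submodule.mem_sup.1 hx
    exact ⟨(⟨c, hc⟩, y), add_comm _ _⟩

end InverseFunction

/-! ### Slices of a Banach-Lie subgroup -/

section Slice

open Filter Topology

variable {F : Type*} [NormedAddCommGroup F] [NormedSpace ℝ F]
  {G : Type*} [TopologicalSpace G] [ChartedSpace F G] [Group G]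
  {FB : Type*} [NormedAddCommGroup FB] [NormedSpace ℝ FB]

/-- A slice of a subgroup `GB` at `1`: a smooth map `s` such that `(m, u) ↦ s m * u` is a
diffeomorphism from `W × GB` onto an open set `T`, with inverse `x ↦ (mu x, nu x)`. -/
structure LieSlice (F FB : Type*) [NormedAddCommGroup F] [NormedSpace ℝ F]
    [NormedAddCommGroup FB] [NormedSpace ℝ FB] {G : Type*} [TopologicalSpace G]
    [ChartedSpace F G] [Group G] (GB : Subgroup G) [ChartedSpace FB GB]
    (C : Type*) [NormedAddCommGroup C] [NormedSpace ℝ C] where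
  W : Set C
  T : Set G
  s : C → G
  mu : G → C
  nu : G → GB
  isOpen_W : IsOpen W
  isOpen_T : IsOpen T
  zero_mem : (0 : C) ∈ W
  s_zero : s 0 = 1
  contMDiffOn_s : ContMDiffOn 𝓘(ℝ, C) 𝓘(ℝ, F) ∞ s W
  contMDiffOn_mu : ContMDiffOn 𝓘(ℝ, F) 𝓘(ℝ, C) ∞ mu T
  contMDiffOn_nu : ContMDiffOn 𝓘(ℝ, F) 𝓘(ℝ, FB) ∞ nu T
  mul_mem : ∀ m ∈ W, ∀ u : GB, s m * u ∈ T
  mu_mul : ∀ m ∈ W, ∀ u : GB, mu (s m * u) = m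
  nu_mul : ∀ m ∈ W, ∀ u : GB, nu (s m * u) = u
  mu_mem : ∀ x ∈ T, mu x ∈ W
  s_mu_mul_nu : ∀ x ∈ T, s (mu x) * nu x = x

/-- The differential of the inclusion of a subgroup, in the preferred charts at `1`. -/
theorem hasFDerivAt_lieIncl (GB : Subgroup G) [ChartedSpace FB GB]
    (h : ContMDiff 𝓘(ℝ, FB) 𝓘(ℝ, F) ∞ (Subtype.val : GB → G)) :
    HasFDerivAt (fun y : FB => chartAt F (1 : G) ((chartAt FB (1 : GB)).symm y : GB))
      (show FB →L[ℝ] F from lieIncl (F := F) (FB := FB) GB) (chartAt FB (1 : GB) 1) := by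
  have h1 := ((h.mdifferentiable (by simp)) (1 : GB)).hasMFDerivAt.2
  simp only [writtenInExtChartAt, extChartAt, mfld_simps] at h1
  exact hasFDerivWithinAt_univ.1 h1

variable [CompleteSpace F] [CompleteSpace FB] [LieGroup 𝓘(ℝ, F) ∞ G]

/-- Banach-Lie subgroups have slices. -/
theorem exists_lieSlice (GB : Subgroup G) [ChartedSpace FB GB]
    (hGB : IsBanachLieSubgroup (F := F) (FB := FB) GB) :
    ∃ C : Submodule ℝ F, IsClosed (C : Set F) ∧ Nonempty ((C × FB) ≃L[ℝ] F) ∧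
      Nonempty (LieSlice F FB GB C) := by
  have := hGB.lieGroup
  have : IsTopologicalGroup G := topologicalGroup_of_lieGroup 𝓘(ℝ, F) ∞
  let j : FB →L[ℝ] F := lieIncl (F := F) (FB := FB) GB
  obtain ⟨C, hC, L, hL⟩ := exists_complement_equiv j hGB.injective hGB.closedComplemented
  refine ⟨C, hC, ⟨L⟩, ?_⟩
  have := hC.completeSpace_coe
  set e := chartAt F (1 : G) with he
  set e' := chartAt FB (1 : GB) with he'
  set a := e 1 with ha
  set b := e' 1 with hb
  have h1e : (1 : G) ∈ e.source := mem_chart_source F 1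
  have h1e' : (1 : GB) ∈ e'.source := mem_chart_source FB 1
  have haT : a ∈ e.target := e.map_source h1e
  have hbT : b ∈ e'.target := e'.map_source h1e'
  have hchart : ContMDiffOn 𝓘(ℝ, F) 𝓘(ℝ, F) ∞ e e.source := contMDiffOn_chart
  have hchart' : ContMDiffOn 𝓘(ℝ, FB) 𝓘(ℝ, FB) ∞ e' e'.source := contMDiffOn_chart
  have hchartsymm : ContMDiffOn 𝓘(ℝ, F) 𝓘(ℝ, F) ∞ e.symm e.target := contMDiffOn_chart_symm
  have hchartsymm' : ContMDiffOn 𝓘(ℝ, FB) 𝓘(ℝ, FB) ∞ e'.symm e'.target := contMDiffOn_chart_symm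
  let s : C → G := fun m => e.symm (a + m)
  let W₀ : Set C := (fun m : C => a + (m : F)) ⁻¹' e.target
  have hW₀ : IsOpen W₀ := e.open_target.preimage (by fun_prop)
  have h0W₀ : (0 : C) ∈ W₀ := by simpa [W₀] using haT
  have hs0 : s 0 = 1 := by simp [s, ha, e.left_inv h1e]
  have hes : ∀ m ∈ W₀, e (s m) = a + m := fun m hm => e.right_inv hm
  have hssm : ContMDiffOn 𝓘(ℝ, C) 𝓘(ℝ, F) ∞ s W₀ :=
    hchartsymm.comp (contDiff_const.add C.subtypeL.contDiff).contMDiff.contMDiffOn fun m hm => hm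
  -- the product map in the charts
  let P : C × FB → G := fun p => s p.1 * (e'.symm p.2 : GB)
  have hU₁ : IsOpen (W₀ ×ˢ e'.target) := hW₀.prod e'.open_target
  have hPsm : ContMDiffOn 𝓘(ℝ, C × FB) 𝓘(ℝ, F) ∞ P (W₀ ×ˢ e'.target) := by
    refine ContMDiffOn.mul ?_ ?_
    · exact hssm.comp contDiff_fst.contMDiff.contMDiffOn fun p hp => hp.1
    · exact hGB.contMDiff_val.comp_contMDiffOn
        (hchartsymm'.comp contDiff_snd.contMDiff.contMDiffOn fun p hp => hp.2)
  let U : Set (C × FB) := W₀ ×ˢ e'.target ∩ P ⁻¹' e.source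
  have hU : IsOpen U := hPsm.continuousOn.isOpen_inter_preimage hU₁ e.open_source
  have hP0 : P (0, b) = 1 := by simp [P, hs0, hb, e'.left_inv h1e']
  have h0U : ((0, b) : C × FB) ∈ U := ⟨⟨h0W₀, hbT⟩, by simpa [hP0] using h1e⟩
  have hφ : ContDiffOn ℝ ∞ (fun p => e (P p)) U :=
    (hchart.comp (hPsm.mono Set.inter_subset_left) fun p hp => hp.2).contDiffOn
  -- At `(0, b)` the partial derivatives are the inclusion of the complement `C` and the inclusion
  -- `j` of the Lie algebra of the subgroup; together they form `L`.
  have hderiv : HasFDerivAt (fun p => e (P p)) (L : C × FB →L[ℝ] F) (0, b) := by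
    have hD := ((hφ.contDiffAt (hU.mem_nhds h0U)).differentiableAt (by simp)).hasFDerivAt
    set D := fderiv ℝ (fun p => e (P p)) (0, b)
    have h1 : D.comp (ContinuousLinearMap.inl ℝ C FB) = C.subtypeL := by
      have h2 := hD.comp (0 : C) (hasFDerivAt_prodMk_left (𝕜 := ℝ) (0 : C) b)
      refine h2.unique (HasFDerivAt.congr_of_eventuallyEq
        ((C.subtypeL.hasFDerivAt (x := (0 : C))).const_add a) ?_)
      filter_upwards [hW₀.mem_nhds h0W₀] with m hm
      simp [P, hb, e'.left_inv h1e', hes m hm]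
    have h2 : D.comp (ContinuousLinearMap.inr ℝ C FB) = j := by
      have h2 := hD.comp b (hasFDerivAt_prodMk_right (𝕜 := ℝ) (0 : C) b)
      refine h2.unique (HasFDerivAt.congr_of_eventuallyEq
        (hasFDerivAt_lieIncl GB hGB.contMDiff_val) (Eventually.of_forall fun y => ?_))
      simp [P, hs0, he, he']
    have hLD : (L : C × FB →L[ℝ] F) = D := by
      ext p
      · simpa [hL] using (congrArg (fun T : C →L[ℝ] F => T p) h1).symm
      · simpa [hL] using (congrArg (fun T : FB →L[ℝ] F => T p) h2).symm
    rw [hLD]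
    exact hD
  obtain ⟨Φ, hΦ, h0Φ, hΦU, hΦsm⟩ := exists_openPartialHomeomorph_of_contDiffOn hU hφ h0U L hderiv
  have hΦ' : ∀ p, Φ p = e (P p) := fun p => congrFun hΦ p
  -- the local inverse of `(m, u) ↦ s m * u` near `(0, 1)`
  let S : Set G := e.source ∩ e ⁻¹' Φ.target
  have hS : IsOpen S := e.isOpen_inter_preimage Φ.open_target
  let rm : G → C := fun x => (Φ.symm (e x)).1
  let rn : G → GB := fun x => e'.symm (Φ.symm (e x)).2
  have hRsm : ContMDiffOn 𝓘(ℝ, F) 𝓘(ℝ, C × FB) ∞ (fun x => Φ.symm (e x)) S :=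
    hΦsm.contMDiffOn.comp (hchart.mono Set.inter_subset_left) fun x hx => hx.2
  have hRmem : ∀ x ∈ S, Φ.symm (e x) ∈ U := fun x hx => hΦU (Φ.map_target hx.2)
  have hrm : ContMDiffOn 𝓘(ℝ, F) 𝓘(ℝ, C) ∞ rm S :=
    contDiff_fst.contMDiff.comp_contMDiffOn hRsm
  have hrn : ContMDiffOn 𝓘(ℝ, F) 𝓘(ℝ, FB) ∞ rn S :=
    hchartsymm'.comp (contDiff_snd.contMDiff.comp_contMDiffOn hRsm) fun x hx => (hRmem x hx).1.2
  have hinv : ∀ x ∈ S, s (rm x) * rn x = x := by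
    intro x hx
    exact e.injOn (hRmem x hx).2 hx.1 ((hΦ' _).symm.trans (Φ.right_inv hx.2))
  let N : Set (C × GB) := {p | p.2 ∈ e'.source ∧ (p.1, e' p.2) ∈ Φ.source}
  have hN : N ∈ 𝓝 ((0, 1) : C × GB) := by
    have h1 : ∀ᶠ p in 𝓝 ((0, 1) : C × GB), p.2 ∈ e'.source :=
      continuousAt_snd.preimage_mem_nhds (e'.open_source.mem_nhds h1e')
    have h2 : ContinuousAt (fun p : C × GB => (p.1, e' p.2)) (0, 1) :=
      continuousAt_fst.prodMk (ContinuousAt.comp (f := Prod.snd) (x := ((0, 1) : C × GB))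
        (e'.continuousAt h1e') continuousAt_snd)
    filter_upwards [h1, h2.preimage_mem_nhds (Φ.open_source.mem_nhds h0Φ)] with p h h' using ⟨h, h'⟩
  have hNS : ∀ m u, (m, u) ∈ N → s m * u ∈ S ∧ rm (s m * u) = m ∧ rn (s m * u) = u := by
    rintro m u ⟨h1, h2⟩
    have h3 : P (m, e' u) = s m * u := by simp [P, e'.left_inv h1]
    have h4 := hΦU h2
    have h5 : e (s m * u) = Φ (m, e' u) := by rw [hΦ', h3]
    refine ⟨⟨h3 ▸ h4.2, ?_⟩, ?_, ?_⟩
    · change e (s m * u) ∈ Φ.target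
      rw [h5]; exact Φ.map_source h2
    · simp only [rm, h5, Φ.left_inv h2]
    · simp only [rn, h5, Φ.left_inv h2, e'.left_inv h1]
  obtain ⟨W₁, hW₁, V₁, hV₁, hWV⟩ := mem_nhds_prod_iff.1 hN
  -- Here it matters that `GB` has the induced topology: closeness to `1` in `G` implies closeness
  -- to `1` in `GB`.
  rw [nhds_subtype_eq_comap] at hV₁
  obtain ⟨V₂, hV₂, hV₂₁⟩ := hV₁
  -- This is what makes `W` small enough for injectivity on all of `W × GB` and not merely near `(0,
  -- 1)`.
  have hdiv : ∀ᶠ p in 𝓝 ((0, 0) : C × C), (s p.2)⁻¹ * s p.1 ∈ V₂ := by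
    have hsc : ContinuousAt s 0 := (hssm.contMDiffAt (hW₀.mem_nhds h0W₀)).continuousAt
    have h1 : ContinuousAt (fun p : C × C => s p.1) (0, 0) :=
      ContinuousAt.comp (f := Prod.fst) (x := ((0, 0) : C × C)) hsc continuousAt_fst
    have h2 : ContinuousAt (fun p : C × C => s p.2) (0, 0) :=
      ContinuousAt.comp (f := Prod.snd) (x := ((0, 0) : C × C)) hsc continuousAt_snd
    refine (h2.inv.mul h1).preimage_mem_nhds ?_
    simpa [hs0] using hV₂
  rw [nhds_prod_eq, eventually_prod_self_iff'] at hdiv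
  obtain ⟨W₂, hW₂, hdiv⟩ := hdiv
  obtain ⟨W, hWsub, hW, h0W⟩ := mem_nhds_iff.1
    (inter_mem (inter_mem hW₁ hW₂) (hW₀.mem_nhds h0W₀))
  have hN1 : ∀ m ∈ W, (m, (1 : GB)) ∈ N := fun m hm =>
    hWV ⟨(hWsub hm).1.1, hV₂₁ (show ((1 : GB) : G) ∈ V₂ from mem_of_mem_nhds hV₂)⟩
  -- If `s m * u = s m' * u'`, then `u' * u⁻¹ = (s m')⁻¹ * s m` is close to `1`, so both `(m, 1)`
  -- and `(m', u' * u⁻¹)` lie in the region `N` where the local inverse recovers the pair.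
  have hinj : ∀ m ∈ W, ∀ m' ∈ W, ∀ u u' : GB, s m * u = s m' * u' → m = m' ∧ u = u' := by
    intro m hm m' hm' u u' h
    have h1 : (s m')⁻¹ * s m = ((u' * u⁻¹ : GB) : G) := by
      rw [inv_mul_eq_iff_eq_mul, Subgroup.coe_mul, ← mul_assoc, ← h]
      simp
    have h2 : (u' * u⁻¹ : GB) ∈ V₁ := hV₂₁ (by
      rw [Set.mem_preimage, ← h1]
      exact hdiv m (hWsub hm).1.2 m' (hWsub hm').1.2)
    have h3 := hNS m' _ (hWV ⟨(hWsub hm').1.1, h2⟩)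
    have h4 := hNS m 1 (hN1 m hm)
    have h5 : s m' * ((u' * u⁻¹ : GB) : G) = s m * (1 : GB) := by rw [← h1]; simp
    rw [h5] at h3
    exact ⟨h4.2.1.symm.trans h3.2.1, (mul_inv_eq_one.1 (h3.2.2.symm.trans h4.2.2)).symm⟩
  let T : Set G := {x | ∃ p : C × GB, p.1 ∈ W ∧ s p.1 * p.2 = x}
  classical
  -- The value `(0, 1)` outside `T` is never used.
  let q : G → C × GB := fun x => if hx : x ∈ T then hx.choose else (0, 1)
  have hq : ∀ x ∈ T, (q x).1 ∈ W ∧ s (q x).1 * (q x).2 = x := by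
    intro x hx
    simp only [q, dif_pos hx]
    exact hx.choose_spec
  have hqmul : ∀ m ∈ W, ∀ u : GB, q (s m * u) = (m, u) := by
    intro m hm u
    have hx : s m * (u : G) ∈ T := ⟨(m, u), hm, rfl⟩
    obtain ⟨h1, h2⟩ := hinj _ (hq _ hx).1 m hm _ u (hq _ hx).2
    exact Prod.ext h1 h2
  -- Right translation by `u₀⁻¹` brings `s m₀ * u₀` back to `s m₀`, where the smooth local inverse
  -- is available. This gives openness of `T` and smoothness of both coordinates at once.
  have hlocal : ∀ x₀ ∈ T, ∃ (Ω : Set G) (u₀ : GB), IsOpen Ω ∧ x₀ ∈ Ω ∧ ∀ x ∈ Ω, x ∈ T ∧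
      x * (u₀ : G)⁻¹ ∈ S ∧ q x = (rm (x * (u₀ : G)⁻¹), rn (x * (u₀ : G)⁻¹) * u₀) := by
    rintro _ ⟨⟨m₀, u₀⟩, hm₀, rfl⟩
    have hc : Continuous fun x : G => x * (u₀ : G)⁻¹ := continuous_mul_const _
    obtain ⟨h1, h2, -⟩ := hNS m₀ 1 (hN1 m₀ hm₀)
    refine ⟨(fun x => x * (u₀ : G)⁻¹) ⁻¹' (S ∩ rm ⁻¹' W), u₀,
      (hrm.continuousOn.isOpen_inter_preimage hS hW).preimage hc, ?_, ?_⟩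
    · simp only [OneMemClass.coe_one, mul_one] at h1 h2
      simpa [h2] using ⟨h1, hm₀⟩
    · rintro x ⟨h3, h4⟩
      have h5 : s (rm (x * (u₀ : G)⁻¹)) * ((rn (x * (u₀ : G)⁻¹) * u₀ : GB) : G) = x := by
        rw [Subgroup.coe_mul, ← mul_assoc, hinv _ h3]
        simp
      refine ⟨⟨(_, _), h4, h5⟩, h3, ?_⟩
      have := hqmul _ h4 (rn (x * (u₀ : G)⁻¹) * u₀)
      rwa [h5] at this
  have hmulr : ∀ u : GB, ContMDiff 𝓘(ℝ, F) 𝓘(ℝ, F) ∞ (fun x : G => x * (u : G)⁻¹) := fun u =>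
    contMDiff_mul_right
  refine ⟨
    { W := W
      T := T
      s := s
      mu := fun x => (q x).1
      nu := fun x => (q x).2
      isOpen_W := hW
      isOpen_T := isOpen_iff_forall_mem_open.2 fun x hx => by
        obtain ⟨Ω, u₀, hΩ, hxΩ, h⟩ := hlocal x hx
        exact ⟨Ω, fun y hy => (h y hy).1, hΩ, hxΩ⟩
      zero_mem := h0W
      s_zero := hs0
      contMDiffOn_s := hssm.mono fun m hm => (hWsub hm).2
      contMDiffOn_mu := fun x hx => by
        obtain ⟨Ω, u₀, hΩ, hxΩ, h⟩ := hlocal x hx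
        have h1 : ContMDiffOn 𝓘(ℝ, F) 𝓘(ℝ, C) ∞ (fun x => rm (x * (u₀ : G)⁻¹)) Ω :=
          hrm.comp (hmulr u₀).contMDiffOn fun y hy => (h y hy).2.1
        have h2 : ContMDiffOn 𝓘(ℝ, F) 𝓘(ℝ, C) ∞ (fun x => (q x).1) Ω :=
          h1.congr fun y hy => by rw [(h y hy).2.2]
        exact (h2.contMDiffAt (hΩ.mem_nhds hxΩ)).contMDiffWithinAt
      contMDiffOn_nu := fun x hx => by
        obtain ⟨Ω, u₀, hΩ, hxΩ, h⟩ := hlocal x hx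
        have h1 : ContMDiffOn 𝓘(ℝ, F) 𝓘(ℝ, FB) ∞ (fun x => rn (x * (u₀ : G)⁻¹) * u₀) Ω :=
          (contMDiff_mul_right (a := u₀)).comp_contMDiffOn
            (hrn.comp (hmulr u₀).contMDiffOn fun y hy => (h y hy).2.1)
        have h2 : ContMDiffOn 𝓘(ℝ, F) 𝓘(ℝ, FB) ∞ (fun x => (q x).2) Ω :=
          h1.congr fun y hy => by rw [(h y hy).2.2]
        exact (h2.contMDiffAt (hΩ.mem_nhds hxΩ)).contMDiffWithinAt
      mul_mem := fun m hm u => ⟨(m, u), hm, rfl⟩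
      mu_mul := fun m hm u => by rw [hqmul m hm u]
      nu_mul := fun m hm u => by rw [hqmul m hm u]
      mu_mem := fun x hx => (hq x hx).1
      s_mu_mul_nu := fun x hx => (hq x hx).2 }⟩

end Slice

/-! ### The quotient manifold given by a slice -/

namespace LieSlice

open Filter Topology

variable {F : Type*} [NormedAddCommGroup F] [NormedSpace ℝ F]
  {FB : Type*} [NormedAddCommGroup FB] [NormedSpace ℝ FB]
  {G : Type*} [TopologicalSpace G] [ChartedSpace F G] [Group G]
  {GB : Subgroup G} [ChartedSpace FB GB]
  {C : Type*} [NormedAddCommGroup C] [NormedSpace ℝ C]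
  (σ : LieSlice F FB GB C)

include σ

theorem s_mem {m : C} (hm : m ∈ σ.W) : σ.s m ∈ σ.T := by
  simpa using σ.mul_mem m hm 1

theorem mu_s {m : C} (hm : m ∈ σ.W) : σ.mu (σ.s m) = m := by
  simpa using σ.mu_mul m hm 1

theorem nu_s {m : C} (hm : m ∈ σ.W) : σ.nu (σ.s m) = 1 := by
  simpa using σ.nu_mul m hm 1

theorem one_mem : (1 : G) ∈ σ.T := by
  simpa [σ.s_zero] using σ.s_mem σ.zero_mem

theorem coe_mem (u : GB) : (u : G) ∈ σ.T := by
  simpa [σ.s_zero] using σ.mul_mem 0 σ.zero_mem u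

theorem nu_coe (u : GB) : σ.nu (u : G) = u := by
  simpa [σ.s_zero] using σ.nu_mul 0 σ.zero_mem u

theorem mu_coe (u : GB) : σ.mu (u : G) = 0 := by
  simpa [σ.s_zero] using σ.mu_mul 0 σ.zero_mem u

theorem mul_coe_mem {x : G} (hx : x ∈ σ.T) (u : GB) : x * u ∈ σ.T := by
  have := σ.mul_mem _ (σ.mu_mem x hx) (σ.nu x * u)
  rwa [Subgroup.coe_mul, ← mul_assoc, σ.s_mu_mul_nu x hx] at this

theorem mul_coe_mem_iff {x : G} (u : GB) : x * u ∈ σ.T ↔ x ∈ σ.T :=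
  ⟨fun h => by simpa using σ.mul_coe_mem h u⁻¹, fun h => σ.mul_coe_mem h u⟩

theorem mu_mul_coe {x : G} (hx : x ∈ σ.T) (u : GB) : σ.mu (x * u) = σ.mu x := by
  have := σ.mu_mul _ (σ.mu_mem x hx) (σ.nu x * u)
  rwa [Subgroup.coe_mul, ← mul_assoc, σ.s_mu_mul_nu x hx] at this

theorem nu_mul_coe {x : G} (hx : x ∈ σ.T) (u : GB) : σ.nu (x * u) = σ.nu x * u := by
  have := σ.nu_mul _ (σ.mu_mem x hx) (σ.nu x * u)
  rwa [Subgroup.coe_mul, ← mul_assoc, σ.s_mu_mul_nu x hx] at this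

/-- `T` is a union of cosets `x GB` and `mu` is constant on each of them, so membership in `g T` and
the coordinate `mu (g⁻¹ * x)` depend only on the coset. This makes `quotChart` independent of the
representative `z.out`. -/
theorem mem_iff_of_mk_eq (g : G) {x y : G} (h : (x : G ⧸ GB) = y) :
    g⁻¹ * x ∈ σ.T ↔ g⁻¹ * y ∈ σ.T := by
  have := σ.mul_coe_mem_iff (x := g⁻¹ * x) ⟨x⁻¹ * y, QuotientGroup.eq.1 h⟩
  rw [← this]
  simp [mul_assoc]

theorem mu_eq_of_mk_eq (g : G) {x y : G} (h : (x : G ⧸ GB) = y) (hx : g⁻¹ * x ∈ σ.T) :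
    σ.mu (g⁻¹ * x) = σ.mu (g⁻¹ * y) := by
  rw [← σ.mu_mul_coe hx ⟨x⁻¹ * y, QuotientGroup.eq.1 h⟩]
  simp [mul_assoc]

theorem mk_mul_s_mu {g x : G} (hx : g⁻¹ * x ∈ σ.T) :
    ((g * σ.s (σ.mu (g⁻¹ * x)) : G) : G ⧸ GB) = x := by
  refine QuotientGroup.eq.2 ?_
  have h := σ.s_mu_mul_nu _ hx
  have h2 : (g * σ.s (σ.mu (g⁻¹ * x)))⁻¹ * x = σ.nu (g⁻¹ * x) := by
    rw [mul_inv_rev, mul_assoc, inv_mul_eq_iff_eq_mul, h]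
  rw [h2]
  exact (σ.nu _).2

variable [IsTopologicalGroup G]

/-- The chart of `G ⧸ GB` around the class of `g`, given by a slice. -/
def quotChart (g : G) : OpenPartialHomeomorph (G ⧸ GB) C where
  toFun z := σ.mu (g⁻¹ * z.out)
  invFun m := ((g * σ.s m : G) : G ⧸ GB)
  source := {z | g⁻¹ * z.out ∈ σ.T}
  target := σ.W
  map_source' z hz := σ.mu_mem _ hz
  map_target' m hm := by
    rw [Set.mem_ofPred_eq, σ.mem_iff_of_mk_eq g (QuotientGroup.out_eq' _)]
    simpa using σ.s_mem hm
  left_inv' z hz := by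
    rw [σ.mk_mul_s_mu hz]; exact QuotientGroup.out_eq' z
  right_inv' m hm := by
    have h : g⁻¹ * (g * σ.s m) ∈ σ.T := by simpa using σ.s_mem hm
    rw [← σ.mu_eq_of_mk_eq g (QuotientGroup.out_eq' ((g * σ.s m : G) : G ⧸ GB)).symm h]
    simpa using σ.mu_s hm
  open_source := by
    rw [← (QuotientGroup.isQuotientMap_mk GB).isOpen_preimage]
    have : (QuotientGroup.mk : G → G ⧸ GB) ⁻¹' {z | g⁻¹ * z.out ∈ σ.T} =
        (fun x => g⁻¹ * x) ⁻¹' σ.T := by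
      ext x
      exact σ.mem_iff_of_mk_eq g (QuotientGroup.out_eq' _)
    rw [this]
    exact σ.isOpen_T.preimage (continuous_const_mul _)
  open_target := σ.isOpen_W
  continuousOn_toFun := by
    intro z hz
    obtain ⟨x, rfl⟩ := QuotientGroup.mk_surjective z
    have hx : g⁻¹ * x ∈ σ.T := (σ.mem_iff_of_mk_eq g (QuotientGroup.out_eq' _)).1 hz
    refine ContinuousAt.continuousWithinAt ?_
    rw [ContinuousAt, QuotientGroup.nhds_eq, tendsto_map'_iff,
      ← σ.mu_eq_of_mk_eq g (QuotientGroup.out_eq' _).symm hx]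
    have hc : ContinuousAt (fun y => σ.mu (g⁻¹ * y)) x :=
      ContinuousAt.comp (f := fun y => g⁻¹ * y) (x := x)
        (σ.contMDiffOn_mu.continuousOn.continuousAt (σ.isOpen_T.mem_nhds hx))
        (continuous_const_mul _).continuousAt
    refine hc.tendsto.congr' ?_
    filter_upwards [(continuous_const_mul g⁻¹).continuousAt.preimage_mem_nhds
      (σ.isOpen_T.mem_nhds hx)] with y hy
    exact σ.mu_eq_of_mk_eq g (QuotientGroup.out_eq' _).symm hy
  continuousOn_invFun := by
    refine QuotientGroup.continuous_mk.comp_continuousOn ?_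
    exact continuousOn_const.mul σ.contMDiffOn_s.continuousOn

theorem mk_mem_quotChart_source {g x : G} :
    (x : G ⧸ GB) ∈ (σ.quotChart g).source ↔ g⁻¹ * x ∈ σ.T :=
  σ.mem_iff_of_mk_eq g (QuotientGroup.out_eq' _)

theorem quotChart_mk {g x : G} (hx : g⁻¹ * x ∈ σ.T) :
    σ.quotChart g (x : G ⧸ GB) = σ.mu (g⁻¹ * x) :=
  (σ.mu_eq_of_mk_eq g (QuotientGroup.out_eq' _).symm hx).symm

/-- The charted space structure of `G ⧸ GB` given by a slice. -/
abbrev chartedSpaceQuotient : ChartedSpace C (G ⧸ GB) where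
  atlas := Set.range σ.quotChart
  chartAt z := σ.quotChart z.out
  mem_chart_source z := by
    change z.out⁻¹ * z.out ∈ σ.T
    simpa using σ.one_mem
  chart_mem_atlas z := ⟨_, rfl⟩

omit [IsTopologicalGroup G] in
theorem isManifold_quotient [LieGroup 𝓘(ℝ, F) ∞ G] [IsTopologicalGroup G] :
    letI := σ.chartedSpaceQuotient
    IsManifold 𝓘(ℝ, C) ∞ (G ⧸ GB) := by
  let := σ.chartedSpaceQuotient
  refine isManifold_of_contDiffOn 𝓘(ℝ, C) ∞ (G ⧸ GB) ?_
  rintro _ _ ⟨g, rfl⟩ ⟨g', rfl⟩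
  have hset : ∀ m ∈ ((σ.quotChart g).symm ≫ₕ σ.quotChart g').source,
      m ∈ σ.W ∧ g'⁻¹ * (g * σ.s m) ∈ σ.T := by
    rintro m ⟨h1, h2⟩
    exact ⟨h1, σ.mk_mem_quotChart_source.1 h2⟩
  simp only [modelWithCornersSelf_coe, modelWithCornersSelf_coe_symm, Set.range_id,
    -- The transition map is `m ↦ mu (g'⁻¹ * (g * s m))`.
    Set.inter_univ, Set.preimage_id, Function.comp_id, Function.id_comp]
  have h1 : ContMDiffOn 𝓘(ℝ, C) 𝓘(ℝ, F) ∞ (fun m => g'⁻¹ * (g * σ.s m))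
      ((σ.quotChart g).symm ≫ₕ σ.quotChart g').source :=
    contMDiff_mul_left.comp_contMDiffOn (contMDiff_mul_left.comp_contMDiffOn
      (σ.contMDiffOn_s.mono fun m hm => (hset m hm).1))
  have h2 := σ.contMDiffOn_mu.comp h1 fun m hm => (hset m hm).2
  refine h2.contDiffOn.congr fun m hm => ?_
  exact σ.quotChart_mk (hset m hm).2

variable [LieGroup 𝓘(ℝ, F) ∞ G] [ChartedSpace C (G ⧸ GB)]

/-- The chart of `G` around `g * u`, adapted to the cosets of `GB`, given by a slice. -/
def groupChart (L : (C × FB) ≃L[ℝ] F) (g : G) (u : GB) : OpenPartialHomeomorph G F where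
  toFun x := L (σ.mu (g⁻¹ * x), chartAt FB u (σ.nu (g⁻¹ * x)))
  invFun v := g * (σ.s (L.symm v).1 * ((chartAt FB u).symm (L.symm v).2 : GB))
  source := (fun x => g⁻¹ * x) ⁻¹' (σ.T ∩ σ.nu ⁻¹' (chartAt FB u).source)
  target := L.symm ⁻¹' (σ.W ×ˢ (chartAt FB u).target)
  map_source' x hx := by
    simpa using ⟨σ.mu_mem _ hx.1, (chartAt FB u).map_source hx.2⟩
  map_target' v hv := by
    simp only [Set.mem_preimage, inv_mul_cancel_left]
    refine ⟨σ.mul_mem _ hv.1 _, ?_⟩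
    rw [Set.mem_preimage, σ.nu_mul _ hv.1]
    exact (chartAt FB u).map_target hv.2
  left_inv' x hx := by
    simp only [ContinuousLinearEquiv.symm_apply_apply, (chartAt FB u).left_inv hx.2]
    rw [σ.s_mu_mul_nu _ hx.1, mul_inv_cancel_left]
  right_inv' v hv := by
    simp only [inv_mul_cancel_left]
    rw [σ.mu_mul _ hv.1, σ.nu_mul _ hv.1, (chartAt FB u).right_inv hv.2]
    simp
  open_source := (σ.contMDiffOn_nu.continuousOn.isOpen_inter_preimage σ.isOpen_T
    (chartAt FB u).open_source).preimage (continuous_const_mul _)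
  open_target := (σ.isOpen_W.prod (chartAt FB u).open_target).preimage L.symm.continuous
  continuousOn_toFun := by
    refine L.continuous.comp_continuousOn (ContinuousOn.prodMk ?_ ?_)
    · exact σ.contMDiffOn_mu.continuousOn.comp (continuous_const_mul _).continuousOn
        fun x hx => hx.1
    · exact (chartAt FB u).continuousOn.comp (σ.contMDiffOn_nu.continuousOn.comp
        (continuous_const_mul _).continuousOn fun x hx => hx.1) fun x hx => hx.2
  continuousOn_invFun := by
    refine continuousOn_const.mul (ContinuousOn.mul ?_ (continuous_subtype_val.comp_continuousOn ?_))
    · exact σ.contMDiffOn_s.continuousOn.comp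
        (continuous_fst.comp L.symm.continuous).continuousOn fun v hv => hv.1
    · exact (chartAt FB u).continuousOn_symm.comp
        (continuous_snd.comp L.symm.continuous).continuousOn fun v hv => hv.2

omit [ChartedSpace C (G ⧸ GB)] in
theorem groupChart_mem_maximalAtlas [IsManifold 𝓘(ℝ, FB) ∞ GB]
    (hGB : ContMDiff 𝓘(ℝ, FB) 𝓘(ℝ, F) ∞ (Subtype.val : GB → G))
    (L : (C × FB) ≃L[ℝ] F) (g : G) (u : GB) :
    σ.groupChart L g u ∈ IsManifold.maximalAtlas 𝓘(ℝ, F) ∞ G := by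
  refine OpenPartialHomeomorph.mem_maximalAtlas_of_contMDiffOn _ ?_ ?_
  · have h1 : ContMDiffOn 𝓘(ℝ, F) 𝓘(ℝ, C) ∞ (fun x => σ.mu (g⁻¹ * x))
        (σ.groupChart L g u).source :=
      σ.contMDiffOn_mu.comp contMDiff_mul_left.contMDiffOn fun x hx => hx.1
    have h2 : ContMDiffOn 𝓘(ℝ, F) 𝓘(ℝ, FB) ∞ (fun x => chartAt FB u (σ.nu (g⁻¹ * x)))
        (σ.groupChart L g u).source :=
      contMDiffOn_chart.comp (σ.contMDiffOn_nu.comp contMDiff_mul_left.contMDiffOn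
        fun x hx => hx.1) fun x hx => hx.2
    exact L.contDiff.contMDiff.comp_contMDiffOn (h1.prodMk_space h2)
  · have h1 : ContMDiffOn 𝓘(ℝ, F) 𝓘(ℝ, F) ∞ (fun v => σ.s (L.symm v).1)
        (σ.groupChart L g u).target :=
      σ.contMDiffOn_s.comp (contDiff_fst.comp L.symm.contDiff).contMDiff.contMDiffOn
        fun v hv => hv.1
    have h2 : ContMDiffOn 𝓘(ℝ, F) 𝓘(ℝ, F) ∞
        (fun v => (((chartAt FB u).symm (L.symm v).2 : GB) : G)) (σ.groupChart L g u).target :=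
      hGB.comp_contMDiffOn (contMDiffOn_chart_symm.comp
        (contDiff_snd.comp L.symm.contDiff).contMDiff.contMDiffOn fun v hv => hv.2)
    exact contMDiff_mul_left.comp_contMDiffOn (h1.mul h2)

/-- For the manifold structure given by a slice, the projection `G → G ⧸ GB` is a submersion. -/
theorem isSubmersion_mk [IsManifold 𝓘(ℝ, FB) ∞ GB] [IsManifold 𝓘(ℝ, C) ∞ (G ⧸ GB)]
    (hGB : ContMDiff 𝓘(ℝ, FB) 𝓘(ℝ, F) ∞ (Subtype.val : GB → G))
    (hc : ∀ z : G ⧸ GB, chartAt C z = σ.quotChart z.out) (L : (C × FB) ≃L[ℝ] F) :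
    Manifold.IsSubmersion 𝓘(ℝ, F) 𝓘(ℝ, C) ∞ (fun g : G => (g : G ⧸ GB)) := by
  refine Manifold.IsSubmersionOfComplement.isSubmersion (F := FB) fun x => ?_
  set g := (x : G ⧸ GB).out with hg
  have hx : g⁻¹ * x ∈ σ.T := by
    have h : g⁻¹ * x ∈ GB := QuotientGroup.eq.1 (QuotientGroup.out_eq' (x : G ⧸ GB))
    exact σ.coe_mem ⟨_, h⟩
  -- In these charts the projection is `L.symm` followed by the first projection of `C × FB`, so
  -- `FB` is the complement.
  refine Manifold.IsSubmersionAtOfComplement.mk_of_charts L.symm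
    (σ.groupChart L g (σ.nu (g⁻¹ * x))) (chartAt C (x : G ⧸ GB)) ⟨hx, mem_chart_source _ _⟩
    (mem_chart_source _ _) (σ.groupChart_mem_maximalAtlas hGB L g _)
    (IsManifold.chart_mem_maximalAtlas _) ?_ ?_
  · intro y hy
    rw [Set.mem_preimage, hc]
    exact σ.mk_mem_quotChart_source.2 hy.1
  · intro v hv
    simp only [mfld_simps] at hv ⊢
    have hv' : L.symm v ∈ σ.W ×ˢ (chartAt FB (σ.nu (g⁻¹ * x))).target := hv
    rw [hc]
    change σ.quotChart g ((g * (σ.s (L.symm v).1 * _) : G) : G ⧸ GB) = _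
    have h := σ.mul_mem _ hv'.1 ((chartAt FB (σ.nu (g⁻¹ * x))).symm (L.symm v).2)
    rw [σ.quotChart_mk (by simpa using h), inv_mul_cancel_left, σ.mu_mul _ hv'.1]

end LieSlice

/-! ### The homogeneous vector bundle given by a slice -/

section HomogeneousBundleLemmas

open Filter Topology

variable {G : Type*} [Group G] {GB : Subgroup G}
  {H : Type*} [NormedAddCommGroup H] [InnerProductSpace ℂ H]
  (ρ : GB →* (H →L[ℂ] H))

theorem mk_homFiberEquiv {z : G ⧸ GB} (g : G) (hg : (g : G ⧸ GB) = z) (f : H) :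
    (⟨z, homFiberEquiv ρ g hg f⟩ : TotalSpace H (HomFiber ρ)) = homMk ρ (g, f) := by
  subst hg; rfl

theorem homMk_mul (g : G) (u : GB) (f : H) : homMk ρ (g * u, f) = homMk ρ (g, ρ u f) := by
  rw [eq_comm, homMk_eq_iff]
  refine ⟨u, rfl, ?_⟩
  rw [← mul_apply_eq_comp, ← map_mul]
  simp

theorem rho_mul_apply (u w : GB) (f : H) : ρ (u * w) f = ρ u (ρ w f) := by
  rw [map_mul, mul_apply_eq_comp]

variable [TopologicalSpace G]

theorem continuous_homMk : Continuous (homMk ρ) := (isQuotientMap_homMk ρ).continuous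

theorem continuous_proj_homFiber : Continuous (π H (HomFiber ρ)) := by
  rw [(isQuotientMap_homMk ρ).continuous_iff]
  exact QuotientGroup.continuous_mk.comp continuous_fst

end HomogeneousBundleLemmas

section RepresentationSmooth

variable {FB : Type*} [NormedAddCommGroup FB] [NormedSpace ℝ FB]
  {B : Type*} [TopologicalSpace B] [ChartedSpace FB B] [Group B]
  {H : Type*} [NormedAddCommGroup H] [InnerProductSpace ℂ H]
  {EM : Type*} [NormedAddCommGroup EM] [NormedSpace ℝ EM] {HM : Type*} [TopologicalSpace HM]
  {I : ModelWithCorners ℝ EM HM} {M : Type*} [TopologicalSpace M] [ChartedSpace HM M]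

theorem ContMDiffOn.rho_restrictScalars {ρ : B →* (H →L[ℂ] H)}
    (hρ : ContMDiff 𝓘(ℝ, FB) 𝓘(ℝ, H →L[ℂ] H) ∞ (fun w => ρ w)) {u : M → B} {s : Set M}
    (hu : ContMDiffOn I 𝓘(ℝ, FB) ∞ u s) :
    ContMDiffOn I 𝓘(ℝ, H →L[ℝ] H) ∞ (fun x => (ρ (u x)).restrictScalars ℝ) s :=
  (ContinuousLinearMap.restrictScalarsL ℂ H H ℝ ℝ).contDiff.contMDiff.comp_contMDiffOn
    (hρ.comp_contMDiffOn hu)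

theorem ContMDiffOn.rho_apply {ρ : B →* (H →L[ℂ] H)}
    (hρ : ContMDiff 𝓘(ℝ, FB) 𝓘(ℝ, H →L[ℂ] H) ∞ (fun w => ρ w)) {u : M → B} {f : M → H} {s : Set M}
    (hu : ContMDiffOn I 𝓘(ℝ, FB) ∞ u s) (hf : ContMDiffOn I 𝓘(ℝ, H) ∞ f s) :
    ContMDiffOn I 𝓘(ℝ, H) ∞ (fun x => ρ (u x) (f x)) s :=
  (hu.rho_restrictScalars hρ).clm_apply hf

end RepresentationSmooth

namespace LieSlice

open Filter Topology

variable {F : Type*} [NormedAddCommGroup F] [NormedSpace ℝ F]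
  {FB : Type*} [NormedAddCommGroup FB] [NormedSpace ℝ FB]
  {G : Type*} [TopologicalSpace G] [ChartedSpace F G] [Group G]
  {GB : Subgroup G} [ChartedSpace FB GB]
  {C : Type*} [NormedAddCommGroup C] [NormedSpace ℝ C]
  (σ : LieSlice F FB GB C)
  {H : Type*} [NormedAddCommGroup H] [InnerProductSpace ℂ H]
  (ρ : GB →* (H →L[ℂ] H))

include σ

theorem homMk_mul_s_mu {g x : G} (hx : g⁻¹ * x ∈ σ.T) (f : H) :
    homMk ρ (g * σ.s (σ.mu (g⁻¹ * x)), ρ (σ.nu (g⁻¹ * x)) f) = homMk ρ (x, f) := by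
  rw [← homMk_mul, mul_assoc, σ.s_mu_mul_nu _ hx, mul_inv_cancel_left]

/-- Passing from `(x, f)` to `(x * w, ρ w⁻¹ f)` multiplies `nu` by `w` on the right, which cancels
`ρ w⁻¹`. Hence the fibre coordinate used in `triv` does not depend on the chosen representative. -/
theorem rho_nu_apply_eq {g x y : G} {f f' : H} (h : homMk ρ (x, f) = homMk ρ (y, f'))
    (hx : g⁻¹ * x ∈ σ.T) : ρ (σ.nu (g⁻¹ * x)) f = ρ (σ.nu (g⁻¹ * y)) f' := by
  obtain ⟨w, h1, h2⟩ := (homMk_eq_iff ρ _ _).1 h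
  simp only at h1 h2
  rw [h1, h2, ← mul_assoc, σ.nu_mul_coe hx, ← rho_mul_apply, mul_inv_cancel_right]

variable [IsTopologicalGroup G]

/-- The local section `z ↦ g * s (chart z)` of `G → G ⧸ GB`. -/
def sec (g : G) (z : G ⧸ GB) : G := g * σ.s (σ.quotChart g z)

theorem mk_sec {g : G} {z : G ⧸ GB} (hz : z ∈ (σ.quotChart g).source) :
    ((σ.sec g z : G) : G ⧸ GB) = z :=
  (σ.quotChart g).left_inv hz

theorem inv_mul_sec_mem {g : G} {z : G ⧸ GB} (hz : z ∈ (σ.quotChart g).source) :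
    g⁻¹ * σ.sec g z ∈ σ.T := by
  simpa [sec] using σ.s_mem ((σ.quotChart g).map_source hz)

theorem nu_inv_mul_sec {g : G} {z : G ⧸ GB} (hz : z ∈ (σ.quotChart g).source) :
    σ.nu (g⁻¹ * σ.sec g z) = 1 := by
  simpa [sec] using σ.nu_s ((σ.quotChart g).map_source hz)

theorem continuousOn_sec (g : G) : ContinuousOn (σ.sec g) (σ.quotChart g).source :=
  continuousOn_const.mul (σ.contMDiffOn_s.continuousOn.comp (σ.quotChart g).continuousOn
    (σ.quotChart g).mapsTo)

theorem inv_mul_sec_mem_of_mem {g g' : G} {z : G ⧸ GB} (hz : z ∈ (σ.quotChart g).source)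
    (hz' : z ∈ (σ.quotChart g').source) : g'⁻¹ * σ.sec g z ∈ σ.T := by
  rwa [← σ.mk_mem_quotChart_source, σ.mk_sec hz]

/-- The local trivialization `[(x, f)] ↦ (x GB, ρ (nu (g⁻¹ x)) f)` given by a slice. -/
def triv (hρ : Continuous ρ) (g : G) : Trivialization H (π H (HomFiber ρ)) where
  toFun x := (x.proj, ρ (σ.nu (g⁻¹ * (homMk_surjective ρ x).choose.1))
    (homMk_surjective ρ x).choose.2)
  invFun p := homMk ρ (σ.sec g p.1, p.2)
  source := π H (HomFiber ρ) ⁻¹' (σ.quotChart g).source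
  target := (σ.quotChart g).source ×ˢ Set.univ
  baseSet := (σ.quotChart g).source
  map_source' x hx := ⟨hx, trivial⟩
  map_target' p hp := by
    change ((σ.sec g p.1 : G) : G ⧸ GB) ∈ (σ.quotChart g).source
    rw [σ.mk_sec hp.1]; exact hp.1
  left_inv' x hx := by
    obtain ⟨⟨y, f⟩, hy⟩ := id (⟨_, (homMk_surjective ρ x).choose_spec⟩ : ∃ p, homMk ρ p = x)
    set p := (homMk_surjective ρ x).choose
    have hp : homMk ρ p = x := (homMk_surjective ρ x).choose_spec
    have hpx : ((p.1 : G) : G ⧸ GB) = x.proj := congrArg TotalSpace.proj hp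
    have hm : g⁻¹ * p.1 ∈ σ.T := by
      rw [← σ.mk_mem_quotChart_source, hpx]; exact hx
    simp only [sec]
    rw [← hpx, σ.quotChart_mk hm, σ.homMk_mul_s_mu ρ hm]
    exact hp
  right_inv' p hp := by
    set x := homMk ρ (σ.sec g p.1, p.2) with hx
    have h := (homMk_surjective ρ x).choose_spec
    refine Prod.ext (σ.mk_sec hp.1) ?_
    have := σ.rho_nu_apply_eq ρ (g := g) (hx.symm.trans h.symm) (σ.inv_mul_sec_mem hp.1)
    rw [σ.nu_inv_mul_sec hp.1, map_one] at this
    exact this.symm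
  open_source := (σ.quotChart g).open_source.preimage (continuous_proj_homFiber ρ)
  open_target := (σ.quotChart g).open_source.prod isOpen_univ
  open_baseSet := (σ.quotChart g).open_source
  source_eq := rfl
  target_eq := rfl
  proj_toFun x hx := rfl
  continuousOn_toFun := by
    -- Continuity is tested upstairs on `G × H`, where the arbitrary representative can be replaced
    -- by the given one.
    refine ((isQuotientMap_homMk ρ).continuousOn_isOpen_iff
      ((σ.quotChart g).open_source.preimage (continuous_proj_homFiber ρ))).2 ?_
    have hmem : ∀ p ∈ homMk ρ ⁻¹' (π H (HomFiber ρ) ⁻¹' (σ.quotChart g).source),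
        g⁻¹ * p.1 ∈ σ.T := fun p hp => σ.mk_mem_quotChart_source.1 hp
    have h1 : ContinuousOn (fun p : G × H => ρ (σ.nu (g⁻¹ * p.1)))
        (homMk ρ ⁻¹' (π H (HomFiber ρ) ⁻¹' (σ.quotChart g).source)) :=
      hρ.comp_continuousOn (σ.contMDiffOn_nu.continuousOn.comp
        ((continuous_const_mul _).comp continuous_fst).continuousOn hmem)
    refine ContinuousOn.congr (f := fun p : G × H => ((p.1 : G ⧸ GB), ρ (σ.nu (g⁻¹ * p.1)) p.2))
      ((QuotientGroup.continuous_mk.comp continuous_fst).continuousOn.prodMk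
        (h1.clm_apply continuous_snd.continuousOn)) ?_
    intro p hp
    refine Prod.ext rfl ?_
    exact (σ.rho_nu_apply_eq ρ (homMk_surjective ρ (homMk ρ p)).choose_spec.symm
      (hmem p hp)).symm
  continuousOn_invFun := by
    refine (continuous_homMk ρ).comp_continuousOn (ContinuousOn.prodMk ?_ continuousOn_snd)
    exact (σ.continuousOn_sec g).comp continuousOn_fst fun p hp => hp.1

variable (hρ : Continuous ρ)

theorem triv_homMk {g x : G} (hx : g⁻¹ * x ∈ σ.T) (f : H) :
    σ.triv ρ hρ g (homMk ρ (x, f)) = ((x : G ⧸ GB), ρ (σ.nu (g⁻¹ * x)) f) :=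
  Prod.ext rfl (σ.rho_nu_apply_eq ρ (homMk_surjective ρ (homMk ρ (x, f))).choose_spec.symm hx).symm

theorem triv_isLinear_complex (g : G) : (σ.triv ρ hρ g).IsLinear ℂ where
  linear z hz := by
    obtain ⟨x, rfl⟩ := QuotientGroup.mk_surjective z
    have hx : g⁻¹ * x ∈ σ.T := σ.mk_mem_quotChart_source.1 hz
    have key : ∀ f, (σ.triv ρ hρ g ⟨(x : G ⧸ GB), homFiberEquiv ρ x rfl f⟩).2 =
        ρ (σ.nu (g⁻¹ * x)) f := fun f => by
      rw [mk_homFiberEquiv, σ.triv_homMk ρ hρ hx]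
    refine ⟨fun a b => ?_, fun c a => ?_⟩
    · obtain ⟨f, rfl⟩ := (homFiberEquiv ρ x rfl).surjective a
      obtain ⟨f', rfl⟩ := (homFiberEquiv ρ x rfl).surjective b
      rw [← homFiberEquiv_add, key, key, key, map_add]
    · obtain ⟨f, rfl⟩ := (homFiberEquiv ρ x rfl).surjective a
      rw [← homFiberEquiv_smul, key, key, map_smul]

theorem triv_isLinear_real (g : G) : (σ.triv ρ hρ g).IsLinear ℝ where
  linear z hz := by
    have h := (σ.triv_isLinear_complex ρ hρ g).linear z hz
    exact ⟨h.map_add, fun c a => h.map_smul (c : ℂ) a⟩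

theorem triv_symm_apply (g : G) (p : (G ⧸ GB) × H) :
    (σ.triv ρ hρ g).toOpenPartialHomeomorph.symm p = homMk ρ (σ.sec g p.1, p.2) := rfl

/-- The coordinate changes of the bundle are the operators `ρ (nu (g'⁻¹ * sec g z))`; continuity and
smoothness of the bundle reduce to those of `ρ`, `nu` and `sec`. -/
theorem triv_triv_symm {g g' : G} {z : G ⧸ GB} (hz : z ∈ (σ.quotChart g).source)
    (hz' : z ∈ (σ.quotChart g').source) (f : H) :
    (σ.triv ρ hρ g' ((σ.triv ρ hρ g).toOpenPartialHomeomorph.symm (z, f))).2 =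
      ρ (σ.nu (g'⁻¹ * σ.sec g z)) f := by
  rw [triv_symm_apply, σ.triv_homMk ρ hρ (σ.inv_mul_sec_mem_of_mem hz hz')]

/-- The fibre bundle structure of `G ×_{GB} H → G ⧸ GB` given by a slice. -/
abbrev fiberBundle : FiberBundle H (HomFiber ρ) where
  totalSpaceMk_isInducing' z := ⟨(induced_compose (f := TotalSpace.mk z)
    (g := fun x : TotalSpace H (HomFiber ρ) => x.2.1)).symm⟩
  trivializationAtlas' := Set.range fun z : G ⧸ GB => σ.triv ρ hρ z.out
  trivializationAt' z := σ.triv ρ hρ z.out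
  mem_baseSet_trivializationAt' z := by
    change z.out⁻¹ * z.out ∈ σ.T
    simpa using σ.one_mem
  trivialization_mem_atlas' z := ⟨z, rfl⟩

theorem continuousOn_nu_sec (g g' : G) :
    ContinuousOn (fun z => σ.nu (g'⁻¹ * σ.sec g z))
      ((σ.quotChart g).source ∩ (σ.quotChart g').source) :=
  σ.contMDiffOn_nu.continuousOn.comp
    (continuousOn_const.mul ((σ.continuousOn_sec g).mono Set.inter_subset_left))
    fun _ hz => σ.inv_mul_sec_mem_of_mem hz.1 hz.2

theorem vectorBundle_complex :
    letI := σ.fiberBundle ρ hρ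
    VectorBundle ℂ H (HomFiber ρ) := by
  let := σ.fiberBundle ρ hρ
  refine ⟨?_, ?_⟩
  · rintro _ ⟨z, rfl⟩
    exact σ.triv_isLinear_complex ρ hρ _
  · rintro _ _ ⟨z, rfl⟩ ⟨z', rfl⟩
    have := σ.triv_isLinear_complex ρ hρ z.out
    have := σ.triv_isLinear_complex ρ hρ z'.out
    refine (hρ.comp_continuousOn (σ.continuousOn_nu_sec z.out z'.out)).congr fun y hy => ?_
    ext f
    exact (Trivialization.coordChangeL_apply' _ _ hy f).trans
      (σ.triv_triv_symm ρ hρ hy.1 hy.2 f)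

theorem vectorBundle_real :
    letI := σ.fiberBundle ρ hρ
    VectorBundle ℝ H (HomFiber ρ) := by
  let := σ.fiberBundle ρ hρ
  refine ⟨?_, ?_⟩
  · rintro _ ⟨z, rfl⟩
    exact σ.triv_isLinear_real ρ hρ _
  · rintro _ _ ⟨z, rfl⟩ ⟨z', rfl⟩
    have := σ.triv_isLinear_real ρ hρ z.out
    have := σ.triv_isLinear_real ρ hρ z'.out
    refine ((ContinuousLinearMap.restrictScalarsL ℂ H H ℝ ℝ).continuous.comp_continuousOn
      (hρ.comp_continuousOn (σ.continuousOn_nu_sec z.out z'.out))).congr fun y hy => ?_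
    ext f
    exact (Trivialization.coordChangeL_apply' _ _ hy f).trans
      (σ.triv_triv_symm ρ hρ hy.1 hy.2 f)

end LieSlice

/-! ### Smoothness of the bundle and the submersion onto it -/

namespace LieSlice

open Filter Topology

variable {F : Type*} [NormedAddCommGroup F] [NormedSpace ℝ F]
  {FB : Type*} [NormedAddCommGroup FB] [NormedSpace ℝ FB]
  {G : Type*} [TopologicalSpace G] [ChartedSpace F G] [Group G]
  {GB : Subgroup G} [ChartedSpace FB GB]
  {C : Type*} [NormedAddCommGroup C] [NormedSpace ℝ C]
  (σ : LieSlice F FB GB C)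
  {H : Type*} [NormedAddCommGroup H] [InnerProductSpace ℂ H]
  (ρ : GB →* (H →L[ℂ] H)) (hρ : Continuous ρ)
  [IsTopologicalGroup G]

include σ

/-- The local automorphism `(x, f) ↦ (x, ρ (nu (g⁻¹ x)) f)` of `G × H`. -/
def twist (hρ : Continuous ρ) (g : G) : OpenPartialHomeomorph (G × H) (G × H) where
  toFun p := (p.1, ρ (σ.nu (g⁻¹ * p.1)) p.2)
  invFun p := (p.1, ρ (σ.nu (g⁻¹ * p.1))⁻¹ p.2)
  source := ((fun x => g⁻¹ * x) ⁻¹' σ.T) ×ˢ Set.univ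
  target := ((fun x => g⁻¹ * x) ⁻¹' σ.T) ×ˢ Set.univ
  map_source' _ hp := hp
  map_target' _ hp := hp
  left_inv' p _ := by
    refine Prod.ext rfl ?_
    simp only
    rw [← rho_mul_apply]
    simp
  right_inv' p _ := by
    refine Prod.ext rfl ?_
    simp only
    rw [← rho_mul_apply]
    simp
  open_source := (σ.isOpen_T.preimage (continuous_const_mul _)).prod isOpen_univ
  open_target := (σ.isOpen_T.preimage (continuous_const_mul _)).prod isOpen_univ
  continuousOn_toFun := by
    refine continuousOn_fst.prodMk (ContinuousOn.clm_apply (hρ.comp_continuousOn ?_) continuousOn_snd)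
    exact σ.contMDiffOn_nu.continuousOn.comp
        ((continuous_const_mul _).comp continuous_fst).continuousOn fun p hp => hp.1
  continuousOn_invFun := by
    refine continuousOn_fst.prodMk (ContinuousOn.clm_apply (hρ.comp_continuousOn ?_) continuousOn_snd)
    exact (σ.contMDiffOn_nu.continuousOn.comp
        ((continuous_const_mul _).comp continuous_fst).continuousOn fun p hp => hp.1).inv

variable [LieGroup 𝓘(ℝ, F) ∞ G] [LieGroup 𝓘(ℝ, FB) ∞ GB]

/-- The twist replaces `f` by the fibre coordinate of `[(x, f)]` and is a local diffeomorphism. In a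
chart precomposed with it, `homMk` becomes a linear projection. -/
theorem twist_prod_mem_maximalAtlas
    (hρs : ContMDiff 𝓘(ℝ, FB) 𝓘(ℝ, H →L[ℂ] H) ∞ (fun w : GB => ρ w)) (g : G)
    {D : OpenPartialHomeomorph G F} (hD : D ∈ IsManifold.maximalAtlas 𝓘(ℝ, F) ∞ G) :
    σ.twist ρ hρ g ≫ₕ D.prod (OpenPartialHomeomorph.refl H) ∈
      IsManifold.maximalAtlas (𝓘(ℝ, F).prod 𝓘(ℝ, H)) ∞ (G × H) := by
  have h0 : D.prod (OpenPartialHomeomorph.refl H) ∈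
      IsManifold.maximalAtlas (𝓘(ℝ, F).prod 𝓘(ℝ, H)) ∞ (G × H) :=
    IsManifold.mem_maximalAtlas_prod hD
      (IsManifold.subset_maximalAtlas (by simp))
  have hnu : ContMDiffOn (𝓘(ℝ, F).prod 𝓘(ℝ, H)) 𝓘(ℝ, FB) ∞
      (fun p : G × H => σ.nu (g⁻¹ * p.1)) (σ.twist ρ hρ g).source :=
    σ.contMDiffOn_nu.comp (contMDiff_mul_left.comp contMDiff_fst).contMDiffOn fun p hp => hp.1
  refine OpenPartialHomeomorph.mem_maximalAtlas_of_contMDiffOn _ ?_ ?_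
  · refine (contMDiffOn_of_mem_maximalAtlas h0).comp (t := (D.prod (.refl H)).source) ?_
      fun p hp => hp.2
    exact (contMDiffOn_fst.prodMk (hnu.rho_apply hρs contMDiffOn_snd)).mono fun p hp => hp.1
  · have h1 : ContMDiffOn (𝓘(ℝ, F).prod 𝓘(ℝ, H)) (𝓘(ℝ, F).prod 𝓘(ℝ, H)) ∞
        (σ.twist ρ hρ g).symm (σ.twist ρ hρ g).source :=
      contMDiffOn_fst.prodMk (hnu.inv.rho_apply hρs contMDiffOn_snd)
    exact h1.comp ((contMDiffOn_symm_of_mem_maximalAtlas h0).mono fun p hp => hp.1)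
      fun p hp => hp.2

variable [ChartedSpace C (G ⧸ GB)] [IsManifold 𝓘(ℝ, C) ∞ (G ⧸ GB)]
  (hc : ∀ z : G ⧸ GB, chartAt C z = σ.quotChart z.out)

include hc in
omit [LieGroup 𝓘(ℝ, F) ∞ G] [LieGroup 𝓘(ℝ, FB) ∞ GB] in
theorem contMDiffOn_sec [LieGroup 𝓘(ℝ, F) ∞ G] (z : G ⧸ GB) :
    ContMDiffOn 𝓘(ℝ, C) 𝓘(ℝ, F) ∞ (σ.sec z.out) (σ.quotChart z.out).source := by
  have h : ContMDiffOn 𝓘(ℝ, C) 𝓘(ℝ, C) ∞ (σ.quotChart z.out) (σ.quotChart z.out).source := by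
    rw [← hc]; exact contMDiffOn_chart
  exact contMDiff_mul_left.comp_contMDiffOn (σ.contMDiffOn_s.comp h (σ.quotChart z.out).mapsTo)

include hc in
omit [LieGroup 𝓘(ℝ, FB) ∞ GB] in
theorem contMDiffVectorBundle
    (hρs : ContMDiff 𝓘(ℝ, FB) 𝓘(ℝ, H →L[ℂ] H) ∞ (fun w : GB => ρ w)) :
    letI := σ.fiberBundle ρ hρ
    haveI := σ.vectorBundle_real ρ hρ
    ContMDiffVectorBundle ∞ H (HomFiber ρ) 𝓘(ℝ, C) := by
  let := σ.fiberBundle ρ hρ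
  have := σ.vectorBundle_real ρ hρ
  refine ⟨?_⟩
  rintro _ _ ⟨z, rfl⟩ ⟨z', rfl⟩
  have := σ.triv_isLinear_real ρ hρ z.out
  have := σ.triv_isLinear_real ρ hρ z'.out
  have h1 : ContMDiffOn 𝓘(ℝ, C) 𝓘(ℝ, FB) ∞ (fun y => σ.nu (z'.out⁻¹ * σ.sec z.out y))
      ((σ.quotChart z.out).source ∩ (σ.quotChart z'.out).source) :=
    σ.contMDiffOn_nu.comp (contMDiff_mul_left.comp_contMDiffOn
      ((σ.contMDiffOn_sec hc z).mono Set.inter_subset_left))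
      fun y hy => σ.inv_mul_sec_mem_of_mem hy.1 hy.2
  refine (h1.rho_restrictScalars hρs).congr fun y hy => ?_
  ext f
  exact (Trivialization.coordChangeL_apply' _ _ hy f).trans (σ.triv_triv_symm ρ hρ hy.1 hy.2 f)

include hc in
/-- For the structure given by a slice, the projection `G × H → G ×_{GB} H` is a submersion. -/
theorem isSubmersion_homMk
    (hGB : ContMDiff 𝓘(ℝ, FB) 𝓘(ℝ, F) ∞ (Subtype.val : GB → G)) (L : (C × FB) ≃L[ℝ] F)
    (hρs : ContMDiff 𝓘(ℝ, FB) 𝓘(ℝ, H →L[ℂ] H) ∞ (fun w : GB => ρ w)) :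
    letI := σ.fiberBundle ρ hρ
    Manifold.IsSubmersion (𝓘(ℝ, F).prod 𝓘(ℝ, H)) (𝓘(ℝ, C).prod 𝓘(ℝ, H)) ∞ (homMk ρ) := by
  let := σ.fiberBundle ρ hρ
  have := σ.vectorBundle_real ρ hρ
  have := σ.contMDiffVectorBundle ρ hρ hc hρs
  refine Manifold.IsSubmersionOfComplement.isSubmersion (F := FB) fun p => ?_
  obtain ⟨x, f⟩ := p
  set z : G ⧸ GB := (x : G ⧸ GB) with hz
  set g := z.out with hg
  have hx : g⁻¹ * x ∈ σ.T := by
    have h : g⁻¹ * x ∈ GB := QuotientGroup.eq.1 (QuotientGroup.out_eq' (x : G ⧸ GB))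
    exact σ.coe_mem ⟨_, h⟩
  let D := σ.groupChart L g (σ.nu (g⁻¹ * x))
  -- Reorders `(C × FB) × H` as `(C × H) × FB`: the complement of the target model is again `FB`.
  let e : (F × H) ≃L[ℝ] ((C × H) × FB) :=
    (L.symm.prodCongr (ContinuousLinearEquiv.refl ℝ H)).trans
      (((ContinuousLinearEquiv.prodAssoc ℝ C FB H).trans
        ((ContinuousLinearEquiv.refl ℝ C).prodCongr (ContinuousLinearEquiv.prodComm ℝ FB H))).trans
          (ContinuousLinearEquiv.prodAssoc ℝ C H FB).symm)
  have hcod : chartAt (ModelProd C H) (homMk ρ (x, f)) =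
      (σ.triv ρ hρ g).toOpenPartialHomeomorph ≫ₕ
        (σ.quotChart g).prod (OpenPartialHomeomorph.refl H) := by
    rw [FiberBundle.chartedSpace_chartAt, hc]
    rfl
  have htriv : ∀ p : G × H, g⁻¹ * p.1 ∈ σ.T →
      homMk ρ p ∈ (chartAt (ModelProd C H) (homMk ρ (x, f))).source ∧
      chartAt (ModelProd C H) (homMk ρ (x, f)) (homMk ρ p) =
        (σ.mu (g⁻¹ * p.1), ρ (σ.nu (g⁻¹ * p.1)) p.2) := by
    rintro ⟨y, f'⟩ hy
    have h1 : (y : G ⧸ GB) ∈ (σ.quotChart g).source := σ.mk_mem_quotChart_source.2 hy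
    have h2 := σ.triv_homMk ρ hρ hy f'
    rw [hcod]
    refine ⟨⟨h1, ?_⟩, ?_⟩
    · change σ.triv ρ hρ g (homMk ρ (y, f')) ∈ (σ.quotChart g).source ×ˢ Set.univ
      rw [h2]
      exact ⟨h1, trivial⟩
    · change Prod.map (σ.quotChart g) id (σ.triv ρ hρ g (homMk ρ (y, f'))) = _
      rw [h2]
      exact Prod.ext (σ.quotChart_mk hy) rfl
  refine Manifold.IsSubmersionAtOfComplement.mk_of_charts e
    (σ.twist ρ hρ g ≫ₕ D.prod (OpenPartialHomeomorph.refl H))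
    (chartAt (ModelProd C H) (homMk ρ (x, f))) ?_ (mem_chart_source _ _)
    (σ.twist_prod_mem_maximalAtlas ρ hρ hρs g (σ.groupChart_mem_maximalAtlas hGB L g _))
    (IsManifold.chart_mem_maximalAtlas _) ?_ ?_
  · exact ⟨⟨hx, trivial⟩, ⟨hx, mem_chart_source _ _⟩, trivial⟩
  · intro p hp
    exact (htriv p hp.1.1).1
  · rintro ⟨v, f'⟩ hv
    set dom := σ.twist ρ hρ g ≫ₕ D.prod (OpenPartialHomeomorph.refl H) with hdom
    have hv' : ((v, f') : F × H) ∈ dom.target := hv.2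
    have hs := dom.map_target hv'
    have hr : dom (dom.symm (v, f')) = (v, f') := dom.right_inv hv'
    set p := dom.symm (v, f') with hp
    have ht := htriv p hs.1.1
    have hr1 : L (σ.mu (g⁻¹ * p.1), chartAt FB (σ.nu (g⁻¹ * x)) (σ.nu (g⁻¹ * p.1))) = v :=
      congrArg Prod.fst hr
    have hr2 : ρ (σ.nu (g⁻¹ * p.1)) p.2 = f' := congrArg Prod.snd hr
    have hgoal : chartAt (ModelProd C H) (homMk ρ (x, f)) (homMk ρ p) = (e (v, f')).1 := by
      rw [ht.2, hr2, ← hr1]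
      refine Prod.ext ?_ rfl
      change _ = (L.symm (L _)).1
      rw [ContinuousLinearEquiv.symm_apply_apply]
    exact hgoal

end LieSlice

/-! ### Chain rule and local sections of submersions -/

section Calculus

open Filter Topology

variable {E : Type*} [NormedAddCommGroup E] [NormedSpace ℝ E] {HE : Type*} [TopologicalSpace HE]
  {I : ModelWithCorners ℝ E HE} {M : Type*} [TopologicalSpace M] [ChartedSpace HE M]
  {E' : Type*} [NormedAddCommGroup E'] [NormedSpace ℝ E'] {HE' : Type*} [TopologicalSpace HE']
  {I' : ModelWithCorners ℝ E' HE'} {M' : Type*} [TopologicalSpace M'] [ChartedSpace HE' M']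
  {E'' : Type*} [NormedAddCommGroup E''] [NormedSpace ℝ E''] {HE'' : Type*} [TopologicalSpace HE'']
  {I'' : ModelWithCorners ℝ E'' HE''} {M'' : Type*} [TopologicalSpace M''] [ChartedSpace HE'' M'']

/-- The chain rule, with a propositional equality of base points. -/
theorem HasMFDerivAt.comp_of_eq_base {f : M → M'} {g : M' → M''} {x : M} {y : M'}
    {g' : E' →L[ℝ] E''} {f' : E →L[ℝ] E'} (hg : HasMFDerivAt I' I'' g y g')
    (hf : HasMFDerivAt I I' f x f') (hy : f x = y) :
    HasMFDerivAt I I'' (g ∘ f) x (g'.comp f') := by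
  subst hy
  exact hg.comp x hf

theorem HasMFDerivAt.eq_of_eventuallyEq {f g : M → M'} {x : M} {f' g' : E →L[ℝ] E'}
    (hf : HasMFDerivAt I I' f x f') (hg : HasMFDerivAt I I' g x g') (h : f =ᶠ[𝓝 x] g) :
    f' = g' :=
  hasMFDerivAt_unique hf (hg.congr_of_eventuallyEq h)

theorem TangentBundle.mk_eq_mk {x y : M} (h : x = y) (v : E) :
    (⟨x, v⟩ : TangentBundle I M) = ⟨y, v⟩ := by
  subst h; rfl

theorem TangentBundle.snd_eq_of_mk_eq {x : M} {v w : E}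
    (h : (⟨x, v⟩ : TangentBundle I M) = ⟨x, w⟩) : v = w :=
  TotalSpace.mk_injective x h

/-- A submersion has smooth local sections through every point. -/
theorem Manifold.IsSubmersion.exists_local_section [IsManifold I ∞ M] [IsManifold I' ∞ M']
    [I.Boundaryless] {f : M → M'}
    (h : Manifold.IsSubmersion I I' ∞ f) (x : M) :
    ∃ (V : Set M') (s : M' → M), IsOpen V ∧ f x ∈ V ∧ s (f x) = x ∧ (∀ y ∈ V, f (s y) = y) ∧
      ContMDiffOn I' I ∞ s V := by
  have hx := h.isSubmersionAt x
  set φ := hx.domChart with hφ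
  set ψ := hx.codChart with hψ
  set e := hx.equiv
  have hxφ : x ∈ φ.source := hx.mem_domChart_source
  have hxψ : f x ∈ ψ.source := hx.mem_codChart_source
  have hw : ∀ v ∈ (φ.extend I).target, ψ.extend I' (f ((φ.extend I).symm v)) = (e v).1 :=
    fun v hv => hx.writtenInCharts hv
  have hmaps : ∀ y ∈ φ.source, f y ∈ ψ.source := hx.source_subset_preimage_source
  set c := (e (φ.extend I x)).2 with hc
  let k : M' → E := fun y => e.symm (ψ.extend I' y, c)
  have hψsm : ContMDiffOn I' 𝓘(ℝ, E') ∞ (ψ.extend I') ψ.source :=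
    OpenPartialHomeomorph.contMDiffOn_extend hx.codChart_mem_maximalAtlas
  have hksm : ContMDiffOn I' 𝓘(ℝ, E) ∞ k ψ.source :=
    e.symm.contDiff.contMDiff.comp_contMDiffOn (hψsm.prodMk_space contMDiffOn_const)
  have htar : IsOpen (φ.extend I).target := by
    rw [φ.extend_target]
    simpa [I.range_eq_univ] using φ.open_target.preimage I.continuous_symm
  have hkx : k (f x) = φ.extend I x := by
    have h1 := hw (φ.extend I x) ((φ.extend I).map_source (by rwa [φ.extend_source]))
    rw [(φ.extend I).left_inv (by rwa [φ.extend_source])] at h1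
    simp only [k, h1, hc]
    exact e.symm_apply_apply _
  refine ⟨ψ.source ∩ k ⁻¹' (φ.extend I).target, fun y => (φ.extend I).symm (k y),
    hksm.continuousOn.isOpen_inter_preimage ψ.open_source htar, ⟨hxψ, ?_⟩, ?_, ?_, ?_⟩
  · rw [Set.mem_preimage, hkx]
    exact (φ.extend I).map_source (by rwa [φ.extend_source])
  · simp only [hkx]
    exact (φ.extend I).left_inv (by rwa [φ.extend_source])
  · rintro y ⟨hy1, hy2⟩
    have h1 := hw (k y) hy2
    have h2 : (φ.extend I).symm (k y) ∈ φ.source := by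
      rw [← φ.extend_source (I := I)]; exact (φ.extend I).map_target hy2
    refine (ψ.extend I').injOn (by rw [ψ.extend_source]; exact hmaps _ h2)
      (by rwa [ψ.extend_source]) ?_
    rw [h1]
    simp [k]
  · refine (contMDiffOn_extend_symm hx.domChart_mem_maximalAtlas).comp
      (hksm.mono Set.inter_subset_left) ?_
    rintro y ⟨hy1, hy2⟩
    rwa [φ.extend_target'] at hy2

end Calculus

/-! ### Differentials of translations -/

section LeftTranslation

open Filter Topology

variable {F : Type*} [NormedAddCommGroup F] [NormedSpace ℝ F]
  {G : Type*} [TopologicalSpace G] [ChartedSpace F G] [Group G]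

/-- The differential at `1` of the left translation by `g`. -/
def leftD (F : Type*) [NormedAddCommGroup F] [NormedSpace ℝ F]
    {G : Type*} [TopologicalSpace G] [ChartedSpace F G] [Group G] (g : G) : F →L[ℝ] F :=
  mfderiv 𝓘(ℝ, F) 𝓘(ℝ, F) (fun x : G => g * x) 1

/-- The differential at `g` of the left translation by `g⁻¹`. -/
def leftDInv (F : Type*) [NormedAddCommGroup F] [NormedSpace ℝ F]
    {G : Type*} [TopologicalSpace G] [ChartedSpace F G] [Group G] (g : G) : F →L[ℝ] F :=
  mfderiv 𝓘(ℝ, F) 𝓘(ℝ, F) (fun x : G => g⁻¹ * x) g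

variable [LieGroup 𝓘(ℝ, F) ∞ G]

theorem hasMFDerivAt_leftD (g : G) :
    HasMFDerivAt 𝓘(ℝ, F) 𝓘(ℝ, F) (fun x : G => g * x) 1 (leftD F g) :=
  ((contMDiff_mul_left (n := ∞)).mdifferentiable (by simp) _).hasMFDerivAt

theorem hasMFDerivAt_leftDInv (g : G) :
    HasMFDerivAt 𝓘(ℝ, F) 𝓘(ℝ, F) (fun x : G => g⁻¹ * x) g (leftDInv F g) :=
  ((contMDiff_mul_left (n := ∞)).mdifferentiable (by simp) _).hasMFDerivAt

theorem hasMFDerivAt_LieAd (g : G) :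
    HasMFDerivAt 𝓘(ℝ, F) 𝓘(ℝ, F) (fun x : G => g * x * g⁻¹) 1
      (show F →L[ℝ] F from LieAd (F := F) g) :=
  (((contMDiff_mul_right (n := ∞)).comp contMDiff_mul_left).mdifferentiable
    (by simp) _).hasMFDerivAt

theorem hasMFDerivAt_id' {E : Type*} [NormedAddCommGroup E] [NormedSpace ℝ E] {HE : Type*}
    [TopologicalSpace HE] {I : ModelWithCorners ℝ E HE} {M : Type*} [TopologicalSpace M]
    [ChartedSpace HE M] (x : M) :
    HasMFDerivAt I I (fun y : M => y) x (ContinuousLinearMap.id ℝ E) :=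
  hasMFDerivAt_id x

theorem leftDInv_leftD (g : G) (X : F) : leftDInv F g (leftD F g X) = X := by
  have h := ((hasMFDerivAt_leftDInv (F := F) g).comp_of_eq_base
    (hasMFDerivAt_leftD g) (mul_one g)).eq_of_eventuallyEq
    (hasMFDerivAt_id' 1) (Eventually.of_forall fun x => by simp)
  exact congrArg (fun T : F →L[ℝ] F => T X) h

theorem leftD_leftDInv (g : G) (X : F) : leftD F g (leftDInv F g X) = X := by
  have h := ((hasMFDerivAt_leftD (F := F) g).comp_of_eq_base
    (hasMFDerivAt_leftDInv g) (inv_mul_cancel g)).eq_of_eventuallyEq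
    (hasMFDerivAt_id' g) (Eventually.of_forall fun x => by simp)
  exact congrArg (fun T : F →L[ℝ] F => T X) h

/-- The differential at `g` of the right translation by `u`, in left-translated coordinates. -/
theorem hasMFDerivAt_mul_right (g u : G) :
    HasMFDerivAt 𝓘(ℝ, F) 𝓘(ℝ, F) (fun x : G => x * u) g
      ((leftD F (g * u)).comp ((show F →L[ℝ] F from LieAd (F := F) u⁻¹).comp (leftDInv F g))) := by
  -- Chain rule for `x * u = (g * u) * (u⁻¹ * (g⁻¹ * x) * u)`.
  have h := ((hasMFDerivAt_leftD (F := F) (g * u)).comp_of_eq_base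
    (hasMFDerivAt_LieAd (F := F) u⁻¹) (by simp)).comp_of_eq_base
    (hasMFDerivAt_leftDInv (F := F) g) (inv_mul_cancel g)
  refine h.congr_of_eventuallyEq (Eventually.of_forall fun x => ?_)
  simp [mul_assoc]

end LeftTranslation

/-! ### The kernel of the differential of the projection onto the quotient -/

section Subgroup

open Filter Topology

variable {F : Type*} [NormedAddCommGroup F] [NormedSpace ℝ F]
  {FB : Type*} [NormedAddCommGroup FB] [NormedSpace ℝ FB]
  {G : Type*} [TopologicalSpace G] [ChartedSpace F G] [Group G]
  {GB : Subgroup G} [ChartedSpace FB GB]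

theorem hasMFDerivAt_lieIncl (h : ContMDiff 𝓘(ℝ, FB) 𝓘(ℝ, F) ∞ (Subtype.val : GB → G)) :
    HasMFDerivAt 𝓘(ℝ, FB) 𝓘(ℝ, F) (Subtype.val : GB → G) 1
      (show FB →L[ℝ] F from lieIncl (F := F) (FB := FB) GB) :=
  ((h.mdifferentiable (by simp)) (1 : GB)).hasMFDerivAt

variable [LieGroup 𝓘(ℝ, F) ∞ G]

theorem hasMFDerivAt_mul_coe (h : ContMDiff 𝓘(ℝ, FB) 𝓘(ℝ, F) ∞ (Subtype.val : GB → G)) (g : G) :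
    HasMFDerivAt 𝓘(ℝ, FB) 𝓘(ℝ, F) (fun w : GB => g * w) 1
      ((leftD F g).comp (show FB →L[ℝ] F from lieIncl (F := F) (FB := FB) GB)) :=
  (hasMFDerivAt_leftD g).comp_of_eq_base (hasMFDerivAt_lieIncl h) rfl

/-- A vector killed by the differential of the slice coordinate is tangent to the subgroup. -/
theorem LieSlice.exists_lieIncl_eq {C : Type*} [NormedAddCommGroup C] [NormedSpace ℝ C]
    (σ : LieSlice F FB GB C) (h : ContMDiff 𝓘(ℝ, FB) 𝓘(ℝ, F) ∞ (Subtype.val : GB → G))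
    {D : F →L[ℝ] C} (hD : HasMFDerivAt 𝓘(ℝ, F) 𝓘(ℝ, C) σ.mu 1 D) {X : F} (hX : D X = 0) :
    ∃ Y : FB, (show FB →L[ℝ] F from lieIncl (F := F) (FB := FB) GB) Y = X := by
  have h1T : σ.T ∈ 𝓝 (1 : G) := σ.isOpen_T.mem_nhds σ.one_mem
  have hmu1 : σ.mu 1 = 0 := by simpa using σ.mu_coe 1
  have hnu1 : σ.nu 1 = 1 := by simpa using σ.nu_coe 1
  let k : C × GB → G := fun p => σ.s p.1 * p.2
  have hk : MDifferentiableAt (𝓘(ℝ, C).prod 𝓘(ℝ, FB)) 𝓘(ℝ, F) k (0, 1) := by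
    have hs : ContMDiffAt 𝓘(ℝ, C) 𝓘(ℝ, F) ∞ σ.s 0 :=
      σ.contMDiffOn_s.contMDiffAt (σ.isOpen_W.mem_nhds σ.zero_mem)
    have h1 : ContMDiffAt (𝓘(ℝ, C).prod 𝓘(ℝ, FB)) 𝓘(ℝ, F) ∞ (fun p : C × GB => σ.s p.1) (0, 1) :=
      ContMDiffAt.comp (f := Prod.fst) ((0, 1) : C × GB) hs contMDiffAt_fst
    exact (h1.mul (h.comp contMDiff_snd).contMDiffAt).mdifferentiableAt (by simp)
  obtain ⟨K, hK⟩ : ∃ K : (C × FB) →L[ℝ] F,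
      HasMFDerivAt (𝓘(ℝ, C).prod 𝓘(ℝ, FB)) 𝓘(ℝ, F) k (0, 1) K := ⟨_, hk.hasMFDerivAt⟩
  obtain ⟨N, hN⟩ : ∃ N : F →L[ℝ] FB, HasMFDerivAt 𝓘(ℝ, F) 𝓘(ℝ, FB) σ.nu 1 N :=
    ⟨_, ((σ.contMDiffOn_nu.contMDiffAt h1T).mdifferentiableAt (by simp)).hasMFDerivAt⟩
  have h2 : HasMFDerivAt 𝓘(ℝ, F) (𝓘(ℝ, C).prod 𝓘(ℝ, FB)) (fun x => (σ.mu x, σ.nu x)) 1 (D.prod N) :=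
    hD.prodMk hN
  -- Differentiating `s (mu x) * nu x = x` at `1` gives `K (D X, N X) = X`; on vectors `(0, Y)`, `K`
  -- is the inclusion of the Lie algebra.
  have h3 := (hK.comp_of_eq_base h2 (by rw [hmu1, hnu1])).eq_of_eventuallyEq
    (hasMFDerivAt_id' 1) (by
      filter_upwards [h1T] with x hx using σ.s_mu_mul_nu x hx)
  have h4 : HasMFDerivAt 𝓘(ℝ, FB) (𝓘(ℝ, C).prod 𝓘(ℝ, FB)) (fun w : GB => ((0 : C), w)) 1
      ((0 : FB →L[ℝ] C).prod (ContinuousLinearMap.id ℝ FB)) :=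
    (hasMFDerivAt_const (0 : C) (1 : GB)).prodMk (hasMFDerivAt_id 1)
  have h5 := (hK.comp_of_eq_base h4 rfl).eq_of_eventuallyEq (hasMFDerivAt_lieIncl h)
    (Eventually.of_forall fun w => by simp [k, σ.s_zero])
  refine ⟨N X, ?_⟩
  rw [← h5]
  have h6 := congrArg (fun T : F →L[ℝ] F => T X) h3
  change K (D X, N X) = X at h6
  rw [hX] at h6
  exact h6

end Subgroup

section QuotientDifferential

open Filter Topology

variable {FA : Type*} [NormedAddCommGroup FA] [NormedSpace ℝ FA]
  {GA : Type*} [TopologicalSpace GA] [ChartedSpace FA GA] [Group GA] [LieGroup 𝓘(ℝ, FA) ∞ GA]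
  {FB : Type*} [NormedAddCommGroup FB] [NormedSpace ℝ FB]
  {GB : Subgroup GA} [ChartedSpace FB GB]
  {M : Type*} [NormedAddCommGroup M] [NormedSpace ℝ M]
  [ChartedSpace M (GA ⧸ GB)]

/-- The differential at `g` of the projection `G → G ⧸ GB`. -/
def quotD (FA M : Type*) [NormedAddCommGroup FA] [NormedSpace ℝ FA] [NormedAddCommGroup M]
    [NormedSpace ℝ M] {GA : Type*} [TopologicalSpace GA] [ChartedSpace FA GA] [Group GA]
    (GB : Subgroup GA) [ChartedSpace M (GA ⧸ GB)] (g : GA) : FA →L[ℝ] M :=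
  mfderiv 𝓘(ℝ, FA) 𝓘(ℝ, M) (fun x : GA => (x : GA ⧸ GB)) g

variable (hπ : Manifold.IsSubmersion 𝓘(ℝ, FA) 𝓘(ℝ, M) ∞ (fun g : GA => (g : GA ⧸ GB)))

include hπ

omit [LieGroup 𝓘(ℝ, FA) ∞ GA] in
theorem hasMFDerivAt_quotD (g : GA) :
    HasMFDerivAt 𝓘(ℝ, FA) 𝓘(ℝ, M) (fun x : GA => (x : GA ⧸ GB)) g (quotD FA M GB g) :=
  (hπ.contMDiff.mdifferentiable (by simp) g).hasMFDerivAt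

/-- The kernel of the differential of `G → G ⧸ GB` is the translated Lie algebra of `GB`. -/
theorem quotD_leftD_eq_zero_iff [IsManifold 𝓘(ℝ, M) ∞ (GA ⧸ GB)] {C : Type*}
    [NormedAddCommGroup C] [NormedSpace ℝ C] (σ : LieSlice FA FB GB C)
    (hval : ContMDiff 𝓘(ℝ, FB) 𝓘(ℝ, FA) ∞ (Subtype.val : GB → GA)) (g : GA) (X : FA) :
    quotD FA M GB g (leftD FA g X) = 0 ↔
      ∃ Y : FB, (show FB →L[ℝ] FA from lieIncl (F := FA) (FB := FB) GB) Y = X := by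
  constructor
  · intro hX
    obtain ⟨V, s, hV, hgV, hsg, hs, hssm⟩ := hπ.exists_local_section g
    have hmu : ContMDiffAt 𝓘(ℝ, FA) 𝓘(ℝ, C) ∞ (fun x => σ.mu (g⁻¹ * x)) g := by
      refine ContMDiffAt.comp g ?_ (contMDiff_mul_left (a := g⁻¹)).contMDiffAt
      rw [inv_mul_cancel]
      exact σ.contMDiffOn_mu.contMDiffAt (σ.isOpen_T.mem_nhds σ.one_mem)
    obtain ⟨D, hD⟩ : ∃ D : FA →L[ℝ] C,
        HasMFDerivAt 𝓘(ℝ, FA) 𝓘(ℝ, C) (fun x => σ.mu (g⁻¹ * x)) g D :=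
      ⟨_, (hmu.mdifferentiableAt (by simp)).hasMFDerivAt⟩
    obtain ⟨S, hS⟩ : ∃ S : M →L[ℝ] FA, HasMFDerivAt 𝓘(ℝ, M) 𝓘(ℝ, FA) s (g : GA ⧸ GB) S :=
      ⟨_, ((hssm.contMDiffAt (hV.mem_nhds hgV)).mdifferentiableAt (by simp)).hasMFDerivAt⟩
    -- Near `g`, `mu (g⁻¹ * x)` depends only on the coset of `x`, so it is unchanged when `x` is
    -- replaced by `s` of its coset. Its differential therefore factors through that of the
    -- projection.
    have h1 := (hD.comp_of_eq_base (hS.comp_of_eq_base (hasMFDerivAt_quotD hπ g) rfl)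
      hsg).eq_of_eventuallyEq hD (by
        have hT : ∀ᶠ x in 𝓝 g, g⁻¹ * x ∈ σ.T :=
          (contMDiff_mul_left (I := 𝓘(ℝ, FA)) (n := ∞)
            (a := g⁻¹)).continuous.continuousAt.preimage_mem_nhds
            (by rw [inv_mul_cancel]; exact σ.isOpen_T.mem_nhds σ.one_mem)
        filter_upwards [hT, hπ.contMDiff.continuous.continuousAt.preimage_mem_nhds
          (hV.mem_nhds hgV)] with x hx hxV
        exact (σ.mu_eq_of_mk_eq g (hs _ hxV).symm hx).symm)
    have h2 : HasMFDerivAt 𝓘(ℝ, FA) 𝓘(ℝ, C) σ.mu 1 (D.comp (leftD FA g)) := by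
      refine (hD.comp_of_eq_base (hasMFDerivAt_leftD g) (mul_one g)).congr_of_eventuallyEq
        (Eventually.of_forall fun x => ?_)
      simp
    refine σ.exists_lieIncl_eq hval h2 ?_
    have h3 := congrArg (fun T : FA →L[ℝ] C => T (leftD FA g X)) h1
    change D (S (quotD FA M GB g (leftD FA g X))) = D (leftD FA g X) at h3
    rw [hX, map_zero, map_zero] at h3
    exact h3.symm
  · rintro ⟨Y, rfl⟩
    -- The curve `w ↦ g * w` stays in one coset.
    have h1 := ((hasMFDerivAt_quotD hπ g).comp_of_eq_base (hasMFDerivAt_mul_coe hval g)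
      (by simp)).eq_of_eventuallyEq (g := fun _ => (g : GA ⧸ GB)) (g' := (0 : FB →L[ℝ] M))
      (hasMFDerivAt_const _ _)
      (Eventually.of_forall fun w => QuotientGroup.mk_mul_of_mem g w.2)
    exact congrArg (fun T : FB →L[ℝ] M => T Y) h1

end QuotientDifferential

/-! ### The differential of the projection onto the bundle -/

section HomDifferential

open Filter Topology

variable {FA : Type*} [NormedAddCommGroup FA] [NormedSpace ℝ FA]
  {GA : Type*} [TopologicalSpace GA] [ChartedSpace FA GA] [Group GA]
  {FB : Type*} [NormedAddCommGroup FB] [NormedSpace ℝ FB]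
  {GB : Subgroup GA} [ChartedSpace FB GB]
  {H : Type*} [NormedAddCommGroup H] [InnerProductSpace ℂ H]
  {ρ : GB →* (H →L[ℂ] H)}
  {M : Type*} [NormedAddCommGroup M] [NormedSpace ℝ M]
  [ChartedSpace M (GA ⧸ GB)] [FiberBundle H (HomFiber ρ)]

/-- The differential at `p` of the projection `G × H → G ×_{GB} H`. -/
def homD (FA M : Type*) [NormedAddCommGroup FA] [NormedSpace ℝ FA] [NormedAddCommGroup M]
    [NormedSpace ℝ M] {GA : Type*} [TopologicalSpace GA] [ChartedSpace FA GA] [Group GA]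
    {GB : Subgroup GA} [ChartedSpace M (GA ⧸ GB)] {H : Type*} [NormedAddCommGroup H]
    [InnerProductSpace ℂ H] (ρ : GB →* (H →L[ℂ] H)) [FiberBundle H (HomFiber ρ)]
    (p : GA × H) : (FA × H) →L[ℝ] (M × H) :=
  mfderiv (𝓘(ℝ, FA).prod 𝓘(ℝ, H)) (𝓘(ℝ, M).prod 𝓘(ℝ, H)) (homMk ρ) p

/-- The differential at `x` of the fibre coordinate of the trivialization at `z`. -/
def fiberD (M : Type*) [NormedAddCommGroup M]
    [NormedSpace ℝ M] {GA : Type*} [TopologicalSpace GA] [Group GA]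
    {GB : Subgroup GA} [ChartedSpace M (GA ⧸ GB)] {H : Type*} [NormedAddCommGroup H]
    [InnerProductSpace ℂ H] (ρ : GB →* (H →L[ℂ] H)) [FiberBundle H (HomFiber ρ)]
    (z : GA ⧸ GB) (x : TotalSpace H (HomFiber ρ)) : (M × H) →L[ℝ] H :=
  mfderiv (𝓘(ℝ, M).prod 𝓘(ℝ, H)) 𝓘(ℝ, H)
    (fun y => (trivializationAt H (HomFiber ρ) z y).2) x

/-- The differential at `x` of the bundle projection. -/
def projD (M : Type*) [NormedAddCommGroup M]
    [NormedSpace ℝ M] {GA : Type*} [TopologicalSpace GA] [Group GA]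
    {GB : Subgroup GA} [ChartedSpace M (GA ⧸ GB)] {H : Type*} [NormedAddCommGroup H]
    [InnerProductSpace ℂ H] (ρ : GB →* (H →L[ℂ] H)) [FiberBundle H (HomFiber ρ)]
    (x : TotalSpace H (HomFiber ρ)) : (M × H) →L[ℝ] M :=
  mfderiv (𝓘(ℝ, M).prod 𝓘(ℝ, H)) 𝓘(ℝ, M) (π H (HomFiber ρ)) x

variable (hQ : Manifold.IsSubmersion (𝓘(ℝ, FA).prod 𝓘(ℝ, H)) (𝓘(ℝ, M).prod 𝓘(ℝ, H)) ∞ (homMk ρ))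

include hQ in
theorem hasMFDerivAt_homD (p : GA × H) :
    HasMFDerivAt (𝓘(ℝ, FA).prod 𝓘(ℝ, H)) (𝓘(ℝ, M).prod 𝓘(ℝ, H)) (homMk ρ) p
      (homD FA M ρ p) :=
  (hQ.contMDiff.mdifferentiable (by simp) p).hasMFDerivAt

include hQ in
/-- Vectors along the orbits of `GB`, i.e. `[((g, Y), (f, 0))] = [((g, 0), (f, dρ(Y) f))]`. -/
theorem homD_leftD_lieIncl [LieGroup 𝓘(ℝ, FA) ∞ GA]
    (hval : ContMDiff 𝓘(ℝ, FB) 𝓘(ℝ, FA) ∞ (Subtype.val : GB → GA))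
    (hρs : ContMDiff 𝓘(ℝ, FB) 𝓘(ℝ, H →L[ℂ] H) ∞ (fun w : GB => ρ w)) (g : GA) (f : H) (Y : FB) :
    homD FA M ρ (g, f)
        (leftD FA g ((show FB →L[ℝ] FA from lieIncl (F := FA) (FB := FB) GB) Y), 0) =
      homD FA M ρ (g, f) (0, (show FB →L[ℝ] (H →L[ℂ] H) from derivedRep ρ) Y f) := by
  have h1 : HasMFDerivAt 𝓘(ℝ, FB) (𝓘(ℝ, FA).prod 𝓘(ℝ, H)) (fun w : GB => (g * (w : GA), f)) 1
      (((leftD FA g).comp (show FB →L[ℝ] FA from lieIncl (F := FA) (FB := FB) GB)).prod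
        (0 : FB →L[ℝ] H)) :=
    (hasMFDerivAt_mul_coe hval g).prodMk (hasMFDerivAt_const f (1 : GB))
  have hρ1 : HasMFDerivAt 𝓘(ℝ, FB) 𝓘(ℝ, H →L[ℂ] H) (fun w : GB => ρ w) 1
      (show FB →L[ℝ] (H →L[ℂ] H) from derivedRep ρ) :=
    (hρs.mdifferentiable (by simp) 1).hasMFDerivAt
  have hev : HasMFDerivAt 𝓘(ℝ, H →L[ℂ] H) 𝓘(ℝ, H) (fun T : H →L[ℂ] H => T f) (ρ 1)
      ((ContinuousLinearMap.apply ℂ H f).restrictScalars ℝ) :=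
    ((ContinuousLinearMap.apply ℂ H f).restrictScalars ℝ).hasMFDerivAt
  have h2 : HasMFDerivAt 𝓘(ℝ, FB) (𝓘(ℝ, FA).prod 𝓘(ℝ, H)) (fun w : GB => (g, ρ w f)) 1
      ((0 : FB →L[ℝ] FA).prod (((ContinuousLinearMap.apply ℂ H f).restrictScalars ℝ).comp
        (show FB →L[ℝ] (H →L[ℂ] H) from derivedRep ρ))) :=
    (hasMFDerivAt_const g (1 : GB)).prodMk (hev.comp_of_eq_base hρ1 rfl)
  -- Both sides are the derivative at `w = 1` of `[(g * w, f)] = [(g, ρ w f)]`.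
  have h3 := ((hasMFDerivAt_homD hQ (g, f)).comp_of_eq_base h1 (by simp)).eq_of_eventuallyEq
    ((hasMFDerivAt_homD hQ (g, f)).comp_of_eq_base h2 (by simp))
    (Eventually.of_forall fun w => homMk_mul ρ g w f)
  exact congrArg (fun T : FB →L[ℝ] M × H => T Y) h3

-- Differentiates the invariance of `homMk` under `(x, k) ↦ (x * u, ρ u⁻¹ k)`; `Ad(u⁻¹)` is right
-- translation by `u` in left-translated coordinates.
include hQ in
theorem homD_mul_apply [LieGroup 𝓘(ℝ, FA) ∞ GA] (g : GA) (u : GB) (X : FA) (f h : H) :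
    homD FA M ρ (g * u, ρ u⁻¹ f)
        (leftD FA (g * u) ((show FA →L[ℝ] FA from LieAd (F := FA) (u : GA)⁻¹) X), ρ u⁻¹ h) =
      homD FA M ρ (g, f) (leftD FA g X, h) := by
  have h1 : HasMFDerivAt (𝓘(ℝ, FA).prod 𝓘(ℝ, H)) 𝓘(ℝ, FA) (fun p : GA × H => p.1 * (u : GA)) (g, f)
      (((leftD FA (g * u)).comp ((show FA →L[ℝ] FA from LieAd (F := FA) (u : GA)⁻¹).comp
        (leftDInv FA g))).comp (ContinuousLinearMap.fst ℝ FA H)) :=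
    (hasMFDerivAt_mul_right g (u : GA)).comp_of_eq_base (hasMFDerivAt_fst (g, f)) rfl
  have h2 : HasMFDerivAt (𝓘(ℝ, FA).prod 𝓘(ℝ, H)) 𝓘(ℝ, H) (fun p : GA × H => ρ u⁻¹ p.2) (g, f)
      (((ρ u⁻¹).restrictScalars ℝ).comp (ContinuousLinearMap.snd ℝ FA H)) :=
    HasMFDerivAt.comp_of_eq_base (y := f) ((ρ u⁻¹).restrictScalars ℝ).hasMFDerivAt
      (hasMFDerivAt_snd (g, f)) rfl
  have h12 : HasMFDerivAt (𝓘(ℝ, FA).prod 𝓘(ℝ, H)) (𝓘(ℝ, FA).prod 𝓘(ℝ, H))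
      (fun p : GA × H => (p.1 * (u : GA), ρ u⁻¹ p.2)) (g, f) (ContinuousLinearMap.prod _ _) :=
    h1.prodMk h2
  have h3 := ((hasMFDerivAt_homD hQ (g * u, ρ u⁻¹ f)).comp_of_eq_base h12
    rfl).eq_of_eventuallyEq (hasMFDerivAt_homD hQ (g, f))
    (Eventually.of_forall fun p => ((homMk_eq_iff ρ _ _).2 ⟨u, rfl, rfl⟩).symm)
  have h4 := congrArg (fun T : FA × H →L[ℝ] M × H => T (leftD FA g X, h)) h3
  change homD FA M ρ (g * u, ρ u⁻¹ f) (leftD FA (g * u)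
    ((show FA →L[ℝ] FA from LieAd (F := FA) (u : GA)⁻¹) (leftDInv FA g (leftD FA g X))),
      ρ u⁻¹ h) = _ at h4
  rwa [leftDInv_leftD] at h4

include hQ in
theorem tangentClass_mul [LieGroup 𝓘(ℝ, FA) ∞ GA] (g : GA) (u : GB)
    (X : GroupLieAlgebra 𝓘(ℝ, FA) GA) (f h : H) :
    tangentClass (FA := FA) M ρ (g * u) (LieAd (F := FA) (u : GA)⁻¹ X) (ρ u⁻¹ f) (ρ u⁻¹ h) =
      tangentClass (FA := FA) M ρ g X f h := by
  refine Eq.trans ?_ (TangentBundle.mk_eq_mk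
    ((homMk_eq_iff ρ (g, f) (g * u, ρ u⁻¹ f)).2 ⟨u, rfl, rfl⟩).symm _)
  exact congrArg (fun v => (⟨homMk ρ (g * u, ρ u⁻¹ f), v⟩ :
    TangentBundle (𝓘(ℝ, M).prod 𝓘(ℝ, H)) (TotalSpace H (HomFiber ρ)))) (homD_mul_apply hQ g u X f h)

variable [VectorBundle ℂ H (HomFiber ρ)]

omit [ChartedSpace FA GA] [ChartedSpace FB GB] [ChartedSpace M (GA ⧸ GB)] in
theorem fiberCoord_add {z : GA ⧸ GB} {g : GA}
    (hg : (g : GA ⧸ GB) ∈ (trivializationAt H (HomFiber ρ) z).baseSet) (f f' : H) :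
    (trivializationAt H (HomFiber ρ) z (homMk ρ (g, f + f'))).2 =
      (trivializationAt H (HomFiber ρ) z (homMk ρ (g, f))).2 +
        (trivializationAt H (HomFiber ρ) z (homMk ρ (g, f'))).2 := by
  have := ((trivializationAt H (HomFiber ρ) z).linear ℂ hg).map_add
    (homFiberEquiv ρ g rfl f) (homFiberEquiv ρ g rfl f')
  rwa [← homFiberEquiv_add] at this

omit [ChartedSpace FA GA] [ChartedSpace FB GB] [ChartedSpace M (GA ⧸ GB)] in
theorem fiberCoord_smul {z : GA ⧸ GB} {g : GA}
    (hg : (g : GA ⧸ GB) ∈ (trivializationAt H (HomFiber ρ) z).baseSet) (c : ℂ) (f : H) :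
    (trivializationAt H (HomFiber ρ) z (homMk ρ (g, c • f))).2 =
      c • (trivializationAt H (HomFiber ρ) z (homMk ρ (g, f))).2 := by
  have := ((trivializationAt H (HomFiber ρ) z).linear ℂ hg).map_smul c
    (homFiberEquiv ρ g rfl f)
  rwa [← homFiberEquiv_smul] at this

omit [ChartedSpace FA GA] [ChartedSpace FB GB] [ChartedSpace M (GA ⧸ GB)]
  [VectorBundle ℂ H (HomFiber ρ)] in
theorem fiberCoord_injective {z : GA ⧸ GB} {g : GA}
    (hg : (g : GA ⧸ GB) ∈ (trivializationAt H (HomFiber ρ) z).baseSet) :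
    Function.Injective fun f => (trivializationAt H (HomFiber ρ) z (homMk ρ (g, f))).2 := by
  intro f f' h
  have h1 : homMk ρ (g, f) = homMk ρ (g, f') := by
    refine (trivializationAt H (HomFiber ρ) z).injOn ?_ ?_ (Prod.ext ?_ h)
    · exact (Trivialization.mem_source _).2 hg
    · exact (Trivialization.mem_source _).2 hg
    · exact (Trivialization.coe_fst' _ (x := homMk ρ (g, f)) hg).trans
        (Trivialization.coe_fst' _ (x := homMk ρ (g, f')) hg).symm
  have h2 : (⟨g, homFiberEquiv ρ g rfl f⟩ : TotalSpace H (HomFiber ρ)) =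
      ⟨g, homFiberEquiv ρ g rfl f'⟩ := h1
  exact (homFiberEquiv ρ g rfl).injective (TotalSpace.mk_injective _ h2)

variable [VectorBundle ℝ H (HomFiber ρ)]
  [ContMDiffVectorBundle ∞ H (HomFiber ρ) 𝓘(ℝ, M)]

omit [ChartedSpace FA GA] [ChartedSpace FB GB] [VectorBundle ℂ H (HomFiber ρ)] in
theorem hasMFDerivAt_fiberD (z : GA ⧸ GB) (x : TotalSpace H (HomFiber ρ)) (hx : x.proj = z) :
    HasMFDerivAt (𝓘(ℝ, M).prod 𝓘(ℝ, H)) 𝓘(ℝ, H)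
      (fun y => (trivializationAt H (HomFiber ρ) z y).2) x (fiberD M ρ z x) := by
  have hs : x ∈ (trivializationAt H (HomFiber ρ) z).source := by
    rw [Trivialization.mem_source, hx]
    exact FiberBundle.mem_baseSet_trivializationAt' z
  have h := ((trivializationAt H (HomFiber ρ) z).contMDiffOn (n := ∞) (IB := 𝓘(ℝ, M))).contMDiffAt
    ((trivializationAt H (HomFiber ρ) z).open_source.mem_nhds hs)
  exact ((contMDiffAt_snd.comp x h).mdifferentiableAt (by simp)).hasMFDerivAt

omit [ChartedSpace FA GA] [ChartedSpace FB GB] [VectorBundle ℂ H (HomFiber ρ)]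
  [VectorBundle ℝ H (HomFiber ρ)] [ContMDiffVectorBundle ∞ H (HomFiber ρ) 𝓘(ℝ, M)] in
theorem hasMFDerivAt_projD (x : TotalSpace H (HomFiber ρ)) :
    HasMFDerivAt (𝓘(ℝ, M).prod 𝓘(ℝ, H)) 𝓘(ℝ, M) (π H (HomFiber ρ)) x (projD M ρ x) :=
  ((contMDiff_proj (n := ∞) (HomFiber ρ)).mdifferentiable (by simp) x).hasMFDerivAt

omit [ChartedSpace FB GB] [VectorBundle ℂ H (HomFiber ρ)]
  [VectorBundle ℝ H (HomFiber ρ)] [ContMDiffVectorBundle ∞ H (HomFiber ρ) 𝓘(ℝ, M)] in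
include hQ in
theorem projD_homD
    (hπ : Manifold.IsSubmersion 𝓘(ℝ, FA) 𝓘(ℝ, M) ∞ (fun g : GA => (g : GA ⧸ GB)))
    (p : GA × H) (ξ : FA) (h : H) :
    projD M ρ (homMk ρ p) (homD FA M ρ p (ξ, h)) = quotD FA M GB p.1 ξ := by
  have h1 := ((hasMFDerivAt_projD (M := M) (homMk ρ p)).comp_of_eq_base
    (hasMFDerivAt_homD hQ p) rfl).eq_of_eventuallyEq
    ((hasMFDerivAt_quotD hπ p.1).comp_of_eq_base (hasMFDerivAt_fst p) rfl)
    (Eventually.of_forall fun _ => rfl)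
  exact congrArg (fun T : FA × H →L[ℝ] M => T (ξ, h)) h1

omit [ChartedSpace FB GB] [VectorBundle ℂ H (HomFiber ρ)] in
include hQ in
/-- The differential of the fibre coordinate along the sections `x ↦ [(x, f)]`. -/
theorem hasMFDerivAt_fiberCoord_left (g : GA) (f : H) :
    HasMFDerivAt 𝓘(ℝ, FA) 𝓘(ℝ, H)
      (fun x => (trivializationAt H (HomFiber ρ) (g : GA ⧸ GB) (homMk ρ (x, f))).2) g
      (((fiberD M ρ (g : GA ⧸ GB) (homMk ρ (g, f))).comp (homD FA M ρ (g, f))).comp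
        (ContinuousLinearMap.inl ℝ FA H)) := by
  have h1 : HasMFDerivAt 𝓘(ℝ, FA) (𝓘(ℝ, FA).prod 𝓘(ℝ, H)) (fun x : GA => (x, f)) g
      (ContinuousLinearMap.inl ℝ FA H) :=
    (hasMFDerivAt_id g).prodMk (hasMFDerivAt_const f g)
  exact ((hasMFDerivAt_fiberD (M := M) (g : GA ⧸ GB) (homMk ρ (g, f)) rfl).comp_of_eq_base
    (hasMFDerivAt_homD hQ (g, f)) rfl).comp_of_eq_base h1 rfl

omit [ChartedSpace FB GB] [VectorBundle ℂ H (HomFiber ρ)] in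
include hQ in
theorem hasMFDerivAt_fiberCoord_right (g : GA) (f : H) :
    HasFDerivAt (𝕜 := ℝ)
      (fun k => (trivializationAt H (HomFiber ρ) (g : GA ⧸ GB) (homMk ρ (g, k))).2)
      (((fiberD M ρ (g : GA ⧸ GB) (homMk ρ (g, f))).comp (homD FA M ρ (g, f))).comp
        (ContinuousLinearMap.inr ℝ FA H)) f := by
  have h1 : HasMFDerivAt 𝓘(ℝ, H) (𝓘(ℝ, FA).prod 𝓘(ℝ, H)) (fun k : H => (g, k)) f
      (ContinuousLinearMap.inr ℝ FA H) :=
    (hasMFDerivAt_const g f).prodMk (hasMFDerivAt_id f)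
  exact (((hasMFDerivAt_fiberD (M := M) (g : GA ⧸ GB) (homMk ρ (g, f)) rfl).comp_of_eq_base
    (hasMFDerivAt_homD hQ (g, f)) rfl).comp_of_eq_base h1 rfl).hasFDerivAt

-- For fixed `g` the fibre coordinate of `[(g, k)]` is linear and continuous in `k`, so it is its
-- own derivative.
omit [ChartedSpace FB GB] in
include hQ in
theorem fiberD_homD_inr (g : GA) (f k : H) :
    fiberD M ρ (g : GA ⧸ GB) (homMk ρ (g, f)) (homD FA M ρ (g, f) (0, k)) =
      (trivializationAt H (HomFiber ρ) (g : GA ⧸ GB) (homMk ρ (g, k))).2 := by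
  have hg : (g : GA ⧸ GB) ∈ (trivializationAt H (HomFiber ρ) (g : GA ⧸ GB)).baseSet :=
    FiberBundle.mem_baseSet_trivializationAt' _
  let L : H →L[ℝ] H :=
    { toFun := fun k => (trivializationAt H (HomFiber ρ) (g : GA ⧸ GB) (homMk ρ (g, k))).2
      map_add' := fiberCoord_add hg
      map_smul' := fun c k => fiberCoord_smul hg (c : ℂ) k
      cont := continuous_iff_continuousAt.2 fun k =>
        (hasMFDerivAt_fiberCoord_right hQ g k).continuousAt }
  have h := (hasMFDerivAt_fiberCoord_right hQ g f).unique L.hasFDerivAt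
  exact congrArg (fun T : H →L[ℝ] H => T k) h

omit [ChartedSpace FB GB] in
include hQ in
/-- The projection `G × H → G ×_{GB} H` is an immersion along `H`. -/
theorem homD_inr_eq_zero {g : GA} {f k : H} (h : homD FA M ρ (g, f) (0, k) = 0) : k = 0 := by
  have h1 := fiberD_homD_inr hQ g f k
  have h0 := fiberD_homD_inr hQ g f 0
  rw [h, map_zero] at h1
  rw [Prod.mk_zero_zero, map_zero, map_zero] at h0
  exact fiberCoord_injective (FiberBundle.mem_baseSet_trivializationAt' (g : GA ⧸ GB))
    (h1.symm.trans h0)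

-- The fibre coordinate of `[(x, f)]` is additive in `f` for every `x` near `g`; differentiating
-- this identity in `x` keeps the additivity.
omit [ChartedSpace FB GB] in
include hQ in
theorem fiberD_homD_inl_add (g : GA) (f f' : H) (ξ : FA) :
    fiberD M ρ (g : GA ⧸ GB) (homMk ρ (g, f + f')) (homD FA M ρ (g, f + f') (ξ, 0)) =
      fiberD M ρ (g : GA ⧸ GB) (homMk ρ (g, f)) (homD FA M ρ (g, f) (ξ, 0)) +
      fiberD M ρ (g : GA ⧸ GB) (homMk ρ (g, f')) (homD FA M ρ (g, f') (ξ, 0)) := by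
  have h := (hasMFDerivAt_fiberCoord_left hQ g (f + f')).eq_of_eventuallyEq
    ((hasMFDerivAt_fiberCoord_left hQ g f).add (hasMFDerivAt_fiberCoord_left hQ g f')) ?_
  · exact congrArg (fun T : FA →L[ℝ] H => T ξ) h
  · filter_upwards [QuotientGroup.continuous_mk.continuousAt.preimage_mem_nhds
      ((trivializationAt H (HomFiber ρ) (g : GA ⧸ GB)).open_baseSet.mem_nhds
        (FiberBundle.mem_baseSet_trivializationAt' _))] with x hx using fiberCoord_add hx f f'

omit [ChartedSpace FB GB] in
include hQ in
theorem fiberD_homD_inl_smul (g : GA) (c : ℂ) (f : H) (ξ : FA) :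
    fiberD M ρ (g : GA ⧸ GB) (homMk ρ (g, c • f)) (homD FA M ρ (g, c • f) (ξ, 0)) =
      c • fiberD M ρ (g : GA ⧸ GB) (homMk ρ (g, f)) (homD FA M ρ (g, f) (ξ, 0)) := by
  have h := (hasMFDerivAt_fiberCoord_left hQ g (c • f)).eq_of_eventuallyEq
    (HasMFDerivAt.comp_of_eq_base (I' := 𝓘(ℝ, H)) (I'' := 𝓘(ℝ, H)) (g := fun k : H => c • k)
      (g' := (c • ContinuousLinearMap.id ℂ H).restrictScalars ℝ)
      ((c • ContinuousLinearMap.id ℂ H).restrictScalars ℝ).hasMFDerivAt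
      (hasMFDerivAt_fiberCoord_left hQ g f) rfl) ?_
  · exact congrArg (fun T : FA →L[ℝ] H => T ξ) h
  · filter_upwards [QuotientGroup.continuous_mk.continuousAt.preimage_mem_nhds
      ((trivializationAt H (HomFiber ρ) (g : GA ⧸ GB)).open_baseSet.mem_nhds
        (FiberBundle.mem_baseSet_trivializationAt' _))] with x hx using fiberCoord_smul hx c f

end HomDifferential

/-! ### Smoothness of left-invariant endomorphism fields -/

section TranslatedEndomorphism

variable {F : Type*} [NormedAddCommGroup F] [NormedSpace ℝ F]
  {G : Type*} [TopologicalSpace G] [ChartedSpace F G] [Group G] [LieGroup 𝓘(ℝ, F) ∞ G]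

/-- The value of the tangent map of the multiplication at `(0_a, η)`. -/
theorem tangentMap_mul_zero {a b : G} {L : F →L[ℝ] F}
    (hL : HasMFDerivAt 𝓘(ℝ, F) 𝓘(ℝ, F) (fun x => a * x) b L) (η : F) :
    tangentMap (𝓘(ℝ, F).prod 𝓘(ℝ, F)) 𝓘(ℝ, F) (fun p : G × G => p.1 * p.2)
      ((equivTangentBundleProd 𝓘(ℝ, F) G 𝓘(ℝ, F) G).symm (⟨a, (0 : F)⟩, ⟨b, η⟩)) =
      ⟨a * b, L η⟩ := by
  obtain ⟨T, hT⟩ : ∃ T : F × F →L[ℝ] F,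
      HasMFDerivAt (𝓘(ℝ, F).prod 𝓘(ℝ, F)) 𝓘(ℝ, F) (fun p : G × G => p.1 * p.2) (a, b) T :=
    ⟨_, ((contMDiff_mul 𝓘(ℝ, F) ∞).mdifferentiable (by simp) _).hasMFDerivAt⟩
  have h1 : HasMFDerivAt 𝓘(ℝ, F) (𝓘(ℝ, F).prod 𝓘(ℝ, F)) (fun x : G => (a, x)) b
      (ContinuousLinearMap.inr ℝ F F) :=
    (hasMFDerivAt_const a b).prodMk (hasMFDerivAt_id b)
  have h2 : T.comp (ContinuousLinearMap.inr ℝ F F) = L :=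
    hasMFDerivAt_unique (hT.comp_of_eq_base h1 rfl) hL
  have h3 : (mfderiv (𝓘(ℝ, F).prod 𝓘(ℝ, F)) 𝓘(ℝ, F) (fun p : G × G => p.1 * p.2) (a, b) :
      F × F →L[ℝ] F) = T := hT.mfderiv
  exact congrArg (fun v : F => (⟨a * b, v⟩ : TangentBundle 𝓘(ℝ, F) G))
    ((congrArg (fun S : F × F →L[ℝ] F => S (0, η)) h3).trans
      (congrArg (fun S : F →L[ℝ] F => S η) h2))

-- The tangent map of the multiplication, restricted to the zero section in the first variable, is
-- left translation of tangent vectors. This gives joint smoothness in the group element and the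
-- vector, which smoothness of each single translation does not.
variable (F) in
theorem contMDiff_tangentMap_mul_zero :
    ContMDiff (𝓘(ℝ, F).prod 𝓘(ℝ, F).tangent) 𝓘(ℝ, F).tangent ∞
      (fun p : G × TangentBundle 𝓘(ℝ, F) G =>
        tangentMap (𝓘(ℝ, F).prod 𝓘(ℝ, F)) 𝓘(ℝ, F) (fun p : G × G => p.1 * p.2)
          ((equivTangentBundleProd 𝓘(ℝ, F) G 𝓘(ℝ, F) G).symm (⟨p.1, (0 : F)⟩, p.2))) := by
  have h0 : ContMDiff 𝓘(ℝ, F) 𝓘(ℝ, F).tangent ∞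
      (fun g : G => (⟨g, (0 : F)⟩ : TangentBundle 𝓘(ℝ, F) G)) := contMDiff_zeroSection ℝ _
  exact (((contMDiff_mul 𝓘(ℝ, F) ∞).contMDiff_tangentMap (m := ∞) (by simp)).comp
    contMDiff_equivTangentBundleProd_symm).comp
      ((h0.comp contMDiff_fst).prodMk contMDiff_snd)

/-- The left logarithmic form `⟨g, ξ⟩ ↦ g⁻¹ ξ ∈ T₁ G` is smooth. -/
theorem contMDiff_leftDInv :
    ContMDiff 𝓘(ℝ, F).tangent 𝓘(ℝ, F) ∞
      (fun v : TangentBundle 𝓘(ℝ, F) G => leftDInv F v.1 v.2) := by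
  let k : TangentBundle 𝓘(ℝ, F) G → TangentBundle 𝓘(ℝ, F) G :=
    fun v => ⟨1, leftDInv F v.1 v.2⟩
  have hk : ContMDiff 𝓘(ℝ, F).tangent 𝓘(ℝ, F).tangent ∞ k := by
    have hp : ContMDiff 𝓘(ℝ, F).tangent 𝓘(ℝ, F) ∞
        (fun v : TangentBundle 𝓘(ℝ, F) G => v.1⁻¹) :=
      (contMDiff_inv 𝓘(ℝ, F) ∞).comp (contMDiff_proj (TangentSpace 𝓘(ℝ, F)))
    refine ((contMDiff_tangentMap_mul_zero F).comp (hp.prodMk contMDiff_id)).congr fun v => ?_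
    refine Eq.trans ?_ (tangentMap_mul_zero (F := F) (hasMFDerivAt_leftDInv v.1) v.2).symm
    exact TangentBundle.mk_eq_mk (inv_mul_cancel v.1).symm _
  intro v
  -- All values of `k` lie over `1`, where the trivialization at `1` is the identity of `T₁ G`.
  refine ((contMDiffAt_totalSpace.1 (hk v)).2).congr_of_eventuallyEq
    (Filter.Eventually.of_forall fun w => ?_)
  exact ((tangentBundleCore 𝓘(ℝ, F) G).coordChange_self (achart F (1 : G)) 1
    (mem_achart_source F 1) (leftDInv F w.1 w.2)).symm

theorem contMDiff_leftD :
    ContMDiff (𝓘(ℝ, F).prod 𝓘(ℝ, F)) 𝓘(ℝ, F).tangent ∞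
      (fun p : G × F => (⟨p.1, leftD F p.1 p.2⟩ : TangentBundle 𝓘(ℝ, F) G)) := by
  have h1 : ContMDiff 𝓘(ℝ, F) 𝓘(ℝ, F).tangent ∞
      (fun X : F => (⟨1, X⟩ : TangentBundle 𝓘(ℝ, F) G)) := by
    intro X
    refine contMDiffAt_totalSpace.2 ⟨contMDiffAt_const, ?_⟩
    refine contMDiffAt_id.congr_of_eventuallyEq (Filter.Eventually.of_forall fun w => ?_)
    exact (tangentBundleCore 𝓘(ℝ, F) G).coordChange_self (achart F (1 : G)) 1
      (mem_achart_source F 1) w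
  refine ((contMDiff_tangentMap_mul_zero F).comp
    (contMDiff_fst.prodMk (h1.comp contMDiff_snd))).congr fun p => ?_
  refine Eq.trans ?_ (tangentMap_mul_zero (F := F) (hasMFDerivAt_leftD p.1) p.2).symm
  exact TangentBundle.mk_eq_mk (mul_one p.1).symm _

/-- The left-invariant extension of an endomorphism `E` of `T₁ G` to `T_g G`. -/
def leftEndo (E : F →L[ℝ] F) (g : G) : F →L[ℝ] F :=
  (leftD F g).comp (E.comp (leftDInv F g))

theorem contMDiff_leftEndo (E : F →L[ℝ] F) :
    ContMDiff 𝓘(ℝ, F).tangent 𝓘(ℝ, F).tangent ∞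
      (fun v : TangentBundle 𝓘(ℝ, F) G =>
        (⟨v.1, leftEndo E v.1 v.2⟩ : TangentBundle 𝓘(ℝ, F) G)) :=
  contMDiff_leftD.comp ((contMDiff_proj (TangentSpace 𝓘(ℝ, F))).prodMk
    (E.contDiff.contMDiff.comp contMDiff_leftDInv))

theorem contMDiff_leftEndo_prodMap {H : Type*} [NormedAddCommGroup H] [NormedSpace ℝ H]
    (E : F →L[ℝ] F) :
    ContMDiff (𝓘(ℝ, F).prod 𝓘(ℝ, H)).tangent (𝓘(ℝ, F).prod 𝓘(ℝ, H)).tangent ∞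
      (fun v : TangentBundle (𝓘(ℝ, F).prod 𝓘(ℝ, H)) (G × H) =>
        (⟨v.1, (leftEndo E v.1.1).prodMap (ContinuousLinearMap.id ℝ H) v.2⟩ :
          TangentBundle (𝓘(ℝ, F).prod 𝓘(ℝ, H)) (G × H))) := by
  exact contMDiff_equivTangentBundleProd_symm.comp
    (((contMDiff_leftEndo E).prodMap contMDiff_id).comp contMDiff_equivTangentBundleProd)

end TranslatedEndomorphism

/-! ### The tangent bundle as an associated bundle -/

section TangentClasses

open Filter Topology

variable {FA : Type*} [NormedAddCommGroup FA] [NormedSpace ℝ FA]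
  {GA : Type*} [TopologicalSpace GA] [ChartedSpace FA GA] [Group GA] [LieGroup 𝓘(ℝ, FA) ∞ GA]
  {FB : Type*} [NormedAddCommGroup FB] [NormedSpace ℝ FB]
  {GB : Subgroup GA} [ChartedSpace FB GB]
  {H : Type*} [NormedAddCommGroup H] [InnerProductSpace ℂ H]
  {ρ : GB →* (H →L[ℂ] H)}
  {M : Type*} [NormedAddCommGroup M] [NormedSpace ℝ M]
  [ChartedSpace M (GA ⧸ GB)] [FiberBundle H (HomFiber ρ)]

theorem quotD_leftD_eq_zero_iff_of_isBanachLieSubgroup [CompleteSpace FA] [CompleteSpace FB]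
    [IsManifold 𝓘(ℝ, M) ∞ (GA ⧸ GB)] (hGB : IsBanachLieSubgroup (F := FA) (FB := FB) GB)
    (hπ : Manifold.IsSubmersion 𝓘(ℝ, FA) 𝓘(ℝ, M) ∞ (fun g : GA => (g : GA ⧸ GB)))
    (g : GA) (X : FA) :
    quotD FA M GB g (leftD FA g X) = 0 ↔
      ∃ Y : FB, (show FB →L[ℝ] FA from lieIncl (F := FA) (FB := FB) GB) Y = X := by
  obtain ⟨C, -, -, ⟨σ⟩⟩ := exists_lieSlice GB hGB
  exact quotD_leftD_eq_zero_iff hπ σ hGB.contMDiff_val g X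

variable (hQ : Manifold.IsSubmersion (𝓘(ℝ, FA).prod 𝓘(ℝ, H)) (𝓘(ℝ, M).prod 𝓘(ℝ, H)) ∞ (homMk ρ))

include hQ in
theorem homD_leftD_add_lieIncl
    (hval : ContMDiff 𝓘(ℝ, FB) 𝓘(ℝ, FA) ∞ (Subtype.val : GB → GA))
    (hρs : ContMDiff 𝓘(ℝ, FB) 𝓘(ℝ, H →L[ℂ] H) ∞ (fun w : GB => ρ w)) (g : GA) (X : FA) (Y : FB)
    (f h : H) :
    homD FA M ρ (g, f)
        (leftD FA g (X + (show FB →L[ℝ] FA from lieIncl (F := FA) (FB := FB) GB) Y), h) =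
      homD FA M ρ (g, f)
        (leftD FA g X, (show FB →L[ℝ] (H →L[ℂ] H) from derivedRep ρ) Y f + h) := by
  have h1 := homD_leftD_lieIncl hQ hval hρs g f Y
  have h2 : (leftD FA g (X + (show FB →L[ℝ] FA from lieIncl (F := FA) (FB := FB) GB) Y), h) =
      (leftD FA g X, h) +
        (leftD FA g ((show FB →L[ℝ] FA from lieIncl (F := FA) (FB := FB) GB) Y), 0) := by
    rw [map_add, Prod.mk_add_mk, add_zero]
  rw [h2, map_add, h1, ← map_add, Prod.mk_add_mk, add_zero, add_comm h]

include hQ in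
theorem tangentClass_add_lieIncl
    (hval : ContMDiff 𝓘(ℝ, FB) 𝓘(ℝ, FA) ∞ (Subtype.val : GB → GA))
    (hρs : ContMDiff 𝓘(ℝ, FB) 𝓘(ℝ, H →L[ℂ] H) ∞ (fun w : GB => ρ w)) (g : GA)
    (X : GroupLieAlgebra 𝓘(ℝ, FA) GA) (Y : GroupLieAlgebra 𝓘(ℝ, FB) GB) (f h : H) :
    tangentClass (FA := FA) M ρ g (X + lieIncl GB Y) f h =
      tangentClass (FA := FA) M ρ g X f (derivedRep ρ Y f + h) :=
  congrArg (fun v => (⟨homMk ρ (g, f), v⟩ :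
    TangentBundle (𝓘(ℝ, M).prod 𝓘(ℝ, H)) (TotalSpace H (HomFiber ρ))))
    (homD_leftD_add_lieIncl hQ hval hρs g X Y f h)

variable [VectorBundle ℂ H (HomFiber ρ)] [VectorBundle ℝ H (HomFiber ρ)]
  [IsManifold 𝓘(ℝ, M) ∞ (GA ⧸ GB)]
  [ContMDiffVectorBundle ∞ H (HomFiber ρ) 𝓘(ℝ, M)]
  [CompleteSpace FA] [CompleteSpace FB]
  (hπ : Manifold.IsSubmersion 𝓘(ℝ, FA) 𝓘(ℝ, M) ∞ (fun g : GA => (g : GA ⧸ GB)))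
  (hGB : IsBanachLieSubgroup (F := FA) (FB := FB) GB)
  (hρs : ContMDiff 𝓘(ℝ, FB) 𝓘(ℝ, H →L[ℂ] H) ∞ (fun w : GB => ρ w))

-- Projecting to the quotient shows that `X' - X` lies in the Lie algebra of `GB`. Moving this
-- difference `Y` into the fibre direction leaves two vectors that differ only along `H`, where the
-- differential is injective.
include hQ hπ hGB hρs in
theorem exists_lieIncl_of_homD_leftD_eq {g : GA} {f : H} {X X' : FA} {h h' : H}
    (h1 : homD FA M ρ (g, f) (leftD FA g X, h) = homD FA M ρ (g, f) (leftD FA g X', h')) :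
    ∃ Y : FB, X' = X + (show FB →L[ℝ] FA from lieIncl (F := FA) (FB := FB) GB) Y ∧
      h = (show FB →L[ℝ] (H →L[ℂ] H) from derivedRep ρ) Y f + h' := by
  have h2 := congrArg (projD M ρ (homMk ρ (g, f))) h1
  rw [projD_homD hQ hπ, projD_homD hQ hπ] at h2
  have h3 : quotD FA M GB g (leftD FA g (X' - X)) = 0 := by
    rw [map_sub, map_sub]
    exact sub_eq_zero.2 h2.symm
  obtain ⟨Y, hY⟩ := (quotD_leftD_eq_zero_iff_of_isBanachLieSubgroup hGB hπ g _).1 h3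
  have hX : X' = X + (show FB →L[ℝ] FA from lieIncl (F := FA) (FB := FB) GB) Y := by
    rw [hY]; abel
  refine ⟨Y, hX, ?_⟩
  have h4 := homD_leftD_add_lieIncl hQ hGB.contMDiff_val hρs g X Y f h'
  rw [← hX] at h4
  have h5 : homD FA M ρ (g, f)
      (0, h - ((show FB →L[ℝ] (H →L[ℂ] H) from derivedRep ρ) Y f + h')) = 0 := by
    have h6 := sub_eq_zero.2 (h1.trans h4)
    rwa [← map_sub, Prod.mk_sub_mk, sub_self] at h6
  exact sub_eq_zero.1 (homD_inr_eq_zero hQ h5)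

include hQ hπ hGB hρs in
/-- `TD` is the associated bundle `(G_A ⋉ 𝔤_A) ×_{G_B ⋉ 𝔤_B} (H ⊕ H)`. -/
theorem tangentClass_eq_iff (g : GA) (X : GroupLieAlgebra 𝓘(ℝ, FA) GA) (f h : H)
    (g' : GA) (X' : GroupLieAlgebra 𝓘(ℝ, FA) GA) (f' h' : H) :
    tangentClass (FA := FA) M ρ g X f h = tangentClass (FA := FA) M ρ g' X' f' h' ↔
      TangentEquiv (FB := FB) ρ g X f h g' X' f' h' := by
  have hinv : ∀ (u : GB) (k : H), ρ u⁻¹ (ρ u k) = k := fun u k => by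
    rw [← rho_mul_apply, inv_mul_cancel, map_one, one_apply_eq_self]
  have hinv' : ∀ (u : GB) (k : H), ρ u (ρ u⁻¹ k) = k := fun u k => by
    rw [← rho_mul_apply, mul_inv_cancel, map_one, one_apply_eq_self]
  constructor
  · intro hc
    obtain ⟨u, hu1, hu2⟩ := (homMk_eq_iff ρ _ _).1
      (congrArg (fun v : TangentBundle (𝓘(ℝ, M).prod 𝓘(ℝ, H)) (TotalSpace H (HomFiber ρ)) => v.1)
        hc)
    simp only at hu1 hu2
    subst hu1 hu2
    -- Equality of base points provides `u`; acting by `u` reduces the claim to two vectors at the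
    -- same point of `G × H`.
    rw [← tangentClass_mul hQ g u X f h] at hc
    obtain ⟨Y, hY1, hY2⟩ := exists_lieIncl_of_homD_leftD_eq hQ hπ hGB hρs
      (TangentBundle.snd_eq_of_mk_eq hc)
    refine ⟨u, Y, rfl, hY1, (hinv' u f).symm, ?_⟩
    refine Eq.trans ?_ (map_add (ρ u) _ _)
    exact (hinv' u h).symm.trans (congrArg (ρ u) hY2)
  · rintro ⟨u, Y, rfl, rfl, rfl, rfl⟩
    rw [tangentClass_add_lieIncl hQ hGB.contMDiff_val hρs, ← tangentClass_mul hQ g u X, ← map_add,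
      hinv, hinv]

-- The right inverse is the differential of a local section through `p`.
omit [VectorBundle ℂ H (HomFiber ρ)] [CompleteSpace FA] in
include hQ in
theorem exists_homD_rightInverse (p : GA × H) :
    ∃ R : M × H →L[ℝ] FA × H, ∀ v, homD FA M ρ p (R v) = v := by
  obtain ⟨V, s, hV, hpV, hsp, hs, hsm⟩ := hQ.exists_local_section p
  obtain ⟨R, hR⟩ : ∃ R : M × H →L[ℝ] FA × H,
      HasMFDerivAt (𝓘(ℝ, M).prod 𝓘(ℝ, H)) (𝓘(ℝ, FA).prod 𝓘(ℝ, H)) s (homMk ρ p) R :=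
    ⟨_, ((hsm.contMDiffAt (hV.mem_nhds hpV)).mdifferentiableAt (by simp)).hasMFDerivAt⟩
  have h := ((hasMFDerivAt_homD hQ p).comp_of_eq_base hR hsp).eq_of_eventuallyEq
    (hasMFDerivAt_id' (homMk ρ p)) (by filter_upwards [hV.mem_nhds hpV] with y hy using hs y hy)
  exact ⟨R, fun v => congrArg (fun T : M × H →L[ℝ] M × H => T v) h⟩

omit [VectorBundle ℂ H (HomFiber ρ)] [CompleteSpace FA] in
include hQ in
theorem homD_surjective (p : GA × H) : Function.Surjective (homD FA M ρ p) := by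
  obtain ⟨R, hR⟩ := exists_homD_rightInverse hQ p
  exact fun v => ⟨R v, hR v⟩

omit [VectorBundle ℂ H (HomFiber ρ)] [CompleteSpace FA] in
include hQ in
theorem exists_tangentClass_eq
    (v : TangentBundle (𝓘(ℝ, M).prod 𝓘(ℝ, H)) (TotalSpace H (HomFiber ρ))) :
    ∃ g X f h, tangentClass (FA := FA) M ρ g X f h = v := by
  obtain ⟨x, v⟩ := v
  obtain ⟨⟨g, f⟩, rfl⟩ := homMk_surjective ρ x
  obtain ⟨R, hR⟩ := exists_homD_rightInverse hQ (g, f)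
  refine ⟨g, leftDInv FA g (R v).1, f, (R v).2, congrArg (fun w => (⟨homMk ρ (g, f), w⟩ :
    TangentBundle (𝓘(ℝ, M).prod 𝓘(ℝ, H)) (TotalSpace H (HomFiber ρ)))) ?_⟩
  refine Eq.trans ?_ (hR v)
  exact congrArg (fun ξ => homD FA M ρ (g, f) (ξ, (R v).2)) (leftD_leftDInv g _)

end TangentClasses

/-! ### The induced connection and its smoothness -/

section Connection

open Filter Topology

variable {FA : Type*} [NormedAddCommGroup FA] [NormedSpace ℝ FA]
  {GA : Type*} [TopologicalSpace GA] [ChartedSpace FA GA] [Group GA]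
  {FB : Type*} [NormedAddCommGroup FB] [NormedSpace ℝ FB]
  {GB : Subgroup GA} [ChartedSpace FB GB]

theorem IsReductive.apply_lieIncl
    {E : GroupLieAlgebra 𝓘(ℝ, FA) GA →L[ℝ] GroupLieAlgebra 𝓘(ℝ, FA) GA}
    (hE : IsReductive (F := FA) (FB := FB) GB E) (Y : GroupLieAlgebra 𝓘(ℝ, FB) GB) :
    E (lieIncl GB Y) = lieIncl GB Y := by
  have h : lieIncl (F := FA) (FB := FB) GB Y ∈ E.range := by
    rw [hE.range_eq]
    exact ⟨Y, rfl⟩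
  obtain ⟨X, hX⟩ := h
  have hX' : E X = lieIncl GB Y := hX
  rw [← hX', hE.idem]

theorem IsReductive.exists_lieIncl_eq
    {E : GroupLieAlgebra 𝓘(ℝ, FA) GA →L[ℝ] GroupLieAlgebra 𝓘(ℝ, FA) GA}
    (hE : IsReductive (F := FA) (FB := FB) GB E) (X : GroupLieAlgebra 𝓘(ℝ, FA) GA) :
    ∃ Y : GroupLieAlgebra 𝓘(ℝ, FB) GB, lieIncl GB Y = E X := by
  have h : E X ∈ (lieIncl (F := FA) (FB := FB) GB).range := by
    rw [← hE.range_eq]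
    exact ⟨X, rfl⟩
  exact h

variable [LieGroup 𝓘(ℝ, FA) ∞ GA]
  {H : Type*} [NormedAddCommGroup H] [InnerProductSpace ℂ H]
  {ρ : GB →* (H →L[ℂ] H)}
  {M : Type*} [NormedAddCommGroup M] [NormedSpace ℝ M]
  [ChartedSpace M (GA ⧸ GB)] [FiberBundle H (HomFiber ρ)]
  [IsManifold 𝓘(ℝ, M) ∞ (GA ⧸ GB)]
  [VectorBundle ℂ H (HomFiber ρ)] [VectorBundle ℝ H (HomFiber ρ)]
  [ContMDiffVectorBundle ∞ H (HomFiber ρ) 𝓘(ℝ, M)]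
  [CompleteSpace FA] [CompleteSpace FB]
  (hπ : Manifold.IsSubmersion 𝓘(ℝ, FA) 𝓘(ℝ, M) ∞ (fun g : GA => (g : GA ⧸ GB)))
  (hQ : Manifold.IsSubmersion (𝓘(ℝ, FA).prod 𝓘(ℝ, H)) (𝓘(ℝ, M).prod 𝓘(ℝ, H)) ∞ (homMk ρ))
  (hGB : IsBanachLieSubgroup (F := FA) (FB := FB) GB)
  (hρs : ContMDiff 𝓘(ℝ, FB) 𝓘(ℝ, H →L[ℂ] H) ∞ (fun w : GB => ρ w))

-- The heart of the construction: applying `E` to `X' = Ad(u⁻¹) X + Y` gives `Ad(u⁻¹) (E X) + Y`, so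
-- the same `(u, Y)` relates the new representatives.
include hQ hπ hGB hρs in
theorem IsReductive.tangentClass_congr
    {E : GroupLieAlgebra 𝓘(ℝ, FA) GA →L[ℝ] GroupLieAlgebra 𝓘(ℝ, FA) GA}
    (hE : IsReductive (F := FA) (FB := FB) GB E)
    {g g' : GA} {X X' : GroupLieAlgebra 𝓘(ℝ, FA) GA} {f h f' h' : H}
    (hc : tangentClass (FA := FA) M ρ g X f h = tangentClass (FA := FA) M ρ g' X' f' h') :
    tangentClass (FA := FA) M ρ g (E X) f h = tangentClass (FA := FA) M ρ g' (E X') f' h' := by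
  rw [tangentClass_eq_iff hQ hπ hGB hρs] at hc ⊢
  obtain ⟨u, Y, h1, rfl, h3, h4⟩ := hc
  refine ⟨u, Y, h1, ?_, h3, h4⟩
  rw [map_add, hE.apply_lieIncl, hE.ad_comm _ (GB.inv_mem u.2)]

/-- The endomorphism of `T_x D` induced by an `Ad`-equivariant projection `E`. -/
def homConnection (E : FA →L[ℝ] FA) (x : TotalSpace H (HomFiber ρ)) :
    M × H →L[ℝ] M × H :=
  -- The definition lifts `v` to a chosen representative by a chosen right inverse;
  -- `tangentEndo_homConnection` shows that neither choice matters.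
  (homD FA M ρ (homMk_surjective ρ x).choose).comp
    (((leftEndo E (homMk_surjective ρ x).choose.1).prodMap (ContinuousLinearMap.id ℝ H)).comp
      (exists_homD_rightInverse hQ (homMk_surjective ρ x).choose).choose)

include hπ hGB hρs in
theorem IsReductive.tangentEndo_homConnection
    {E : GroupLieAlgebra 𝓘(ℝ, FA) GA →L[ℝ] GroupLieAlgebra 𝓘(ℝ, FA) GA}
    (hE : IsReductive (F := FA) (FB := FB) GB E)
    (g : GA) (X : GroupLieAlgebra 𝓘(ℝ, FA) GA) (f h : H) :
    tangentEndo (IM := 𝓘(ℝ, M).prod 𝓘(ℝ, H)) (homConnection hQ E)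
        (tangentClass (FA := FA) M ρ g X f h) =
      tangentClass (FA := FA) M ρ g (E X) f h := by
  set x := homMk ρ (g, f) with hx
  have hp : homMk ρ (homMk_surjective ρ x).choose = x := (homMk_surjective ρ x).choose_spec
  have hR := (exists_homD_rightInverse (M := M) hQ (homMk_surjective ρ x).choose).choose_spec
  have hdef : homConnection hQ (show FA →L[ℝ] FA from E) x =
    (homD FA M ρ (homMk_surjective ρ x).choose).comp
    (((leftEndo (show FA →L[ℝ] FA from E) (homMk_surjective ρ x).choose.1).prodMap
      (ContinuousLinearMap.id ℝ H)).comp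
      (exists_homD_rightInverse hQ (homMk_surjective ρ x).choose).choose) := rfl
  generalize (exists_homD_rightInverse hQ (homMk_surjective ρ x).choose).choose = R at hR hdef
  generalize (homMk_surjective ρ x).choose = p at hp hR hdef
  obtain ⟨g₀, f₀⟩ := p
  set v := homD FA M ρ (g, f) (leftD FA g X, h) with hv
  have h1 : tangentClass (FA := FA) M ρ g₀ (leftDInv FA g₀ (R v).1) f₀ (R v).2 =
      tangentClass (FA := FA) M ρ g X f h := by
    have h2 : homD FA M ρ (g₀, f₀) (leftD FA g₀ (leftDInv FA g₀ (R v).1), (R v).2) = v := by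
      rw [leftD_leftDInv]
      exact hR v
    exact (congrArg (fun w => (⟨homMk ρ (g₀, f₀), w⟩ :
      TangentBundle (𝓘(ℝ, M).prod 𝓘(ℝ, H)) (TotalSpace H (HomFiber ρ)))) h2).trans
        (TangentBundle.mk_eq_mk hp v)
  rw [← hE.tangentClass_congr hπ hQ hGB hρs h1]
  refine Eq.trans ?_ (TangentBundle.mk_eq_mk hp _).symm
  exact congrArg (fun w => (⟨x, w⟩ :
    TangentBundle (𝓘(ℝ, M).prod 𝓘(ℝ, H)) (TotalSpace H (HomFiber ρ))))
      (congrArg (fun T : M × H →L[ℝ] M × H => T v) hdef)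

-- The same formula for an arbitrary tangent vector of `G × H`: the connection is intertwined by
-- `homD` with `leftEndo E × id`.
include hπ hGB hρs in
theorem IsReductive.homConnection_homD
    {E : GroupLieAlgebra 𝓘(ℝ, FA) GA →L[ℝ] GroupLieAlgebra 𝓘(ℝ, FA) GA}
    (hE : IsReductive (F := FA) (FB := FB) GB E) (p : GA × H) (v : FA × H) :
    homConnection hQ E (homMk ρ p) (homD FA M ρ p v) =
      homD FA M ρ p ((leftEndo (show FA →L[ℝ] FA from E) p.1).prodMap
        (ContinuousLinearMap.id ℝ H) v) := by
  obtain ⟨g, f⟩ := p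
  obtain ⟨ξ, h⟩ := v
  have h1 : homConnection hQ E (homMk ρ (g, f))
        (homD FA M ρ (g, f) (leftD FA g (leftDInv FA g ξ), h)) = _ :=
    TangentBundle.snd_eq_of_mk_eq
      (hE.tangentEndo_homConnection hπ hQ hGB hρs g (leftDInv FA g ξ) f h)
  rw [leftD_leftDInv] at h1
  exact h1

-- The arbitrary choices in the definition need not be smooth. By `homConnection_homD` they can be
-- replaced near a point by a smooth local section, which exhibits the map as a composition of
-- smooth maps.
include hπ hGB hρs in
theorem IsReductive.contMDiff_homConnection
    {E : GroupLieAlgebra 𝓘(ℝ, FA) GA →L[ℝ] GroupLieAlgebra 𝓘(ℝ, FA) GA}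
    (hE : IsReductive (F := FA) (FB := FB) GB E) :
    ContMDiff (𝓘(ℝ, M).prod 𝓘(ℝ, H)).tangent (𝓘(ℝ, M).prod 𝓘(ℝ, H)).tangent ∞
      (tangentEndo (IM := 𝓘(ℝ, M).prod 𝓘(ℝ, H)) (D := TotalSpace H (HomFiber ρ))
        (homConnection hQ E)) := by
  intro v₀
  obtain ⟨p₀, hp₀⟩ := homMk_surjective ρ v₀.1
  obtain ⟨V, s, hV, hpV, hsp, hs, hsm⟩ := hQ.exists_local_section p₀
  rw [hp₀] at hpV
  have h1 := (hQ.contMDiff.contMDiff_tangentMap (m := ∞) (by simp)).comp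
    (contMDiff_leftEndo_prodMap (G := GA) (H := H) (show FA →L[ℝ] FA from E))
  have h2 := h1.comp_contMDiffOn
    (hsm.contMDiffOn_tangentMapWithin (m := ∞) (by simp) hV.uniqueMDiffOn)
  have hVo : IsOpen (π (M × H) (TangentSpace (𝓘(ℝ, M).prod 𝓘(ℝ, H))
      (M := TotalSpace H (HomFiber ρ))) ⁻¹' V) := hV.preimage (FiberBundle.continuous_proj _ _)
  refine (h2.contMDiffAt (hVo.mem_nhds hpV)).congr_of_eventuallyEq ?_
  filter_upwards [hVo.mem_nhds hpV] with v hv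
  obtain ⟨x, v⟩ := v
  have hx : x ∈ V := hv
  obtain ⟨S, hS⟩ : ∃ S : M × H →L[ℝ] FA × H,
      HasMFDerivAt (𝓘(ℝ, M).prod 𝓘(ℝ, H)) (𝓘(ℝ, FA).prod 𝓘(ℝ, H)) s x S :=
    ⟨_, ((hsm.contMDiffAt (hV.mem_nhds hx)).mdifferentiableAt (by simp)).hasMFDerivAt⟩
  have h3 : (homD FA M ρ (s x)).comp S = ContinuousLinearMap.id ℝ (M × H) :=
    ((hasMFDerivAt_homD hQ (s x)).comp_of_eq_base hS rfl).eq_of_eventuallyEq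
      (hasMFDerivAt_id' x) (by filter_upwards [hV.mem_nhds hx] with y hy using hs y hy)
  have h4 : tangentMapWithin (𝓘(ℝ, M).prod 𝓘(ℝ, H)) (𝓘(ℝ, FA).prod 𝓘(ℝ, H)) s V ⟨x, v⟩ =
      ⟨s x, S v⟩ := by
    have h5 : mfderivWithin (𝓘(ℝ, M).prod 𝓘(ℝ, H)) (𝓘(ℝ, FA).prod 𝓘(ℝ, H)) s V x = S :=
      hS.hasMFDerivWithinAt.mfderivWithin (hV.uniqueMDiffWithinAt hx)
    exact congrArg (fun T : M × H →L[ℝ] FA × H => (⟨s x, T v⟩ :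
      TangentBundle (𝓘(ℝ, FA).prod 𝓘(ℝ, H)) (GA × H))) h5
  have h6 := hE.homConnection_homD hπ hQ hGB hρs (s x) (S v)
  rw [show homD FA M ρ (s x) (S v) = v from
    congrArg (fun T : M × H →L[ℝ] M × H => T v) h3, hs x hx] at h6
  rw [Function.comp_apply, h4]
  exact (TangentBundle.mk_eq_mk (hs x hx).symm _).trans (congrArg (fun w =>
    (⟨homMk ρ (s x), w⟩ :
      TangentBundle (𝓘(ℝ, M).prod 𝓘(ℝ, H)) (TotalSpace H (HomFiber ρ)))) h6)

end Connection

/-! ### Verticality and linearity on the fibres of the tangent projection -/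

section LinearConnection

open Filter Topology

variable {FA : Type*} [NormedAddCommGroup FA] [NormedSpace ℝ FA]
  {GA : Type*} [TopologicalSpace GA] [ChartedSpace FA GA] [Group GA] [LieGroup 𝓘(ℝ, FA) ∞ GA]
  {FB : Type*} [NormedAddCommGroup FB] [NormedSpace ℝ FB]
  {GB : Subgroup GA} [ChartedSpace FB GB]
  {H : Type*} [NormedAddCommGroup H] [InnerProductSpace ℂ H]
  {ρ : GB →* (H →L[ℂ] H)}
  {M : Type*} [NormedAddCommGroup M] [NormedSpace ℝ M]
  [ChartedSpace M (GA ⧸ GB)] [FiberBundle H (HomFiber ρ)]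
  [IsManifold 𝓘(ℝ, M) ∞ (GA ⧸ GB)]
  [VectorBundle ℂ H (HomFiber ρ)] [VectorBundle ℝ H (HomFiber ρ)]
  [ContMDiffVectorBundle ∞ H (HomFiber ρ) 𝓘(ℝ, M)]
  [CompleteSpace FA] [CompleteSpace FB]
  (hπ : Manifold.IsSubmersion 𝓘(ℝ, FA) 𝓘(ℝ, M) ∞ (fun g : GA => (g : GA ⧸ GB)))
  (hQ : Manifold.IsSubmersion (𝓘(ℝ, FA).prod 𝓘(ℝ, H)) (𝓘(ℝ, M).prod 𝓘(ℝ, H)) ∞ (homMk ρ))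
  (hGB : IsBanachLieSubgroup (F := FA) (FB := FB) GB)
  (hρs : ContMDiff 𝓘(ℝ, FB) 𝓘(ℝ, H →L[ℂ] H) ∞ (fun w : GB => ρ w))
  {E : GroupLieAlgebra 𝓘(ℝ, FA) GA →L[ℝ] GroupLieAlgebra 𝓘(ℝ, FA) GA}
  (hE : IsReductive (F := FA) (FB := FB) GB E)

include hπ hGB hE in
omit [FiberBundle H (HomFiber ρ)] [VectorBundle ℂ H (HomFiber ρ)]
  [VectorBundle ℝ H (HomFiber ρ)] [ContMDiffVectorBundle ∞ H (HomFiber ρ) 𝓘(ℝ, M)] in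
theorem IsReductive.quotD_leftEndo (g : GA) (ξ : FA) :
    quotD FA M GB g (leftEndo (show FA →L[ℝ] FA from E) g ξ) = 0 :=
  (quotD_leftD_eq_zero_iff_of_isBanachLieSubgroup hGB hπ g _).2
    (hE.exists_lieIncl_eq (leftDInv FA g ξ))

-- A vector vertical for `G → G ⧸ GB` is a left translate of an element of the Lie algebra of `GB`,
-- which `E` fixes.
include hπ hGB hE in
omit [FiberBundle H (HomFiber ρ)] [VectorBundle ℂ H (HomFiber ρ)]
  [VectorBundle ℝ H (HomFiber ρ)] [ContMDiffVectorBundle ∞ H (HomFiber ρ) 𝓘(ℝ, M)] in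
theorem IsReductive.leftEndo_eq_self {g : GA} {ξ : FA} (hξ : quotD FA M GB g ξ = 0) :
    leftEndo (show FA →L[ℝ] FA from E) g ξ = ξ := by
  rw [← leftD_leftDInv g ξ] at hξ
  obtain ⟨Y, hY⟩ := (quotD_leftD_eq_zero_iff_of_isBanachLieSubgroup hGB hπ g _).1 hξ
  have h1 : (show FA →L[ℝ] FA from E) (leftDInv FA g ξ) = leftDInv FA g ξ := by
    rw [← hY]
    exact hE.apply_lieIncl Y
  change leftD FA g ((show FA →L[ℝ] FA from E) (leftDInv FA g ξ)) = ξ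
  rw [h1, leftD_leftDInv]

include hπ hGB hρs hE in
theorem IsReductive.projD_homConnection (x : TotalSpace H (HomFiber ρ)) (v : M × H) :
    projD M ρ x (homConnection hQ E x v) = 0 := by
  obtain ⟨p, rfl⟩ := homMk_surjective ρ x
  obtain ⟨R, hR⟩ := exists_homD_rightInverse hQ p
  rw [← hR v, hE.homConnection_homD hπ hQ hGB hρs]
  exact (projD_homD hQ hπ p _ _).trans (hE.quotD_leftEndo hπ hGB _ _)

include hπ hGB hρs hE in
theorem IsReductive.homConnection_eq_self {x : TotalSpace H (HomFiber ρ)} {v : M × H}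
    (hv : projD M ρ x v = 0) : homConnection hQ E x v = v := by
  obtain ⟨p, rfl⟩ := homMk_surjective ρ x
  obtain ⟨R, hR⟩ := exists_homD_rightInverse hQ p
  rw [← hR v, hE.homConnection_homD hπ hQ hGB hρs]
  rw [← hR v, ← Prod.mk.eta (p := R v), projD_homD hQ hπ] at hv
  exact congrArg (fun ξ => homD FA M ρ p (ξ, (R v).2)) (hE.leftEndo_eq_self hπ hGB hv)

include hπ hGB hρs hE in
/-- The horizontal part `v - Φ v` of `v` is the image of a vector which depends only on `T Π v`. -/
theorem IsReductive.exists_homConnection_eq_sub (g : GA) (f₀ : H) (u : M × H) :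
    ∃ η : FA, ∀ (f : H) (v : M × H),
      projD M ρ (homMk ρ (g, f)) v = projD M ρ (homMk ρ (g, f₀)) u →
      homConnection hQ E (homMk ρ (g, f)) v = v - homD FA M ρ (g, f) (η, 0) := by
  obtain ⟨⟨ξ₀, h₀⟩, rfl⟩ := homD_surjective hQ (g, f₀) u
  -- The component of `ξ₀` along the kernel of `E`. A lift of another vector with the same
  -- projection differs from `ξ₀` by a vertical vector, which `leftEndo` fixes, so this component
  -- does not change.
  refine ⟨ξ₀ - leftEndo (show FA →L[ℝ] FA from E) g ξ₀, fun f v hv => ?_⟩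
  obtain ⟨⟨ξ, h⟩, rfl⟩ := homD_surjective hQ (g, f) v
  rw [projD_homD hQ hπ, projD_homD hQ hπ, ← sub_eq_zero, ← map_sub] at hv
  have h1 := hE.leftEndo_eq_self hπ hGB hv
  rw [map_sub] at h1
  rw [hE.homConnection_homD hπ hQ hGB hρs, ← map_sub]
  refine congrArg _ (Prod.ext ?_ (sub_zero h).symm)
  change leftEndo (show FA →L[ℝ] FA from E) g ξ =
    ξ - (ξ₀ - leftEndo (show FA →L[ℝ] FA from E) g ξ₀)
  rw [← sub_add, ← h1, sub_add_cancel]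

-- The three vectors have equal projections, so one `η` gives all three horizontal parts. Those are
-- additive by `fiberD_homD_inl_add`, and the full vectors are additive by assumption.
include hπ hGB hρs hE in
theorem IsReductive.fiberD_homConnection_add (g : GA) (f f' : H) (v w u : M × H)
    (h1 : projD M ρ (homMk ρ (g, f)) v = projD M ρ (homMk ρ (g, f + f')) u)
    (h2 : projD M ρ (homMk ρ (g, f')) w = projD M ρ (homMk ρ (g, f + f')) u)
    (h3 : fiberD M ρ (g : GA ⧸ GB) (homMk ρ (g, f + f')) u =
      fiberD M ρ (g : GA ⧸ GB) (homMk ρ (g, f)) v +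
        fiberD M ρ (g : GA ⧸ GB) (homMk ρ (g, f')) w) :
    fiberD M ρ (g : GA ⧸ GB) (homMk ρ (g, f + f')) (homConnection hQ E (homMk ρ (g, f + f')) u) =
      fiberD M ρ (g : GA ⧸ GB) (homMk ρ (g, f)) (homConnection hQ E (homMk ρ (g, f)) v) +
        fiberD M ρ (g : GA ⧸ GB) (homMk ρ (g, f')) (homConnection hQ E (homMk ρ (g, f')) w) := by
  obtain ⟨η, hη⟩ := hE.exists_homConnection_eq_sub hπ hQ hGB hρs g (f + f') u
  rw [hη f v h1, hη f' w h2, hη (f + f') u rfl, map_sub, map_sub, map_sub,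
    fiberD_homD_inl_add hQ, h3]
  exact add_sub_add_comm _ _ _ _

include hπ hGB hρs hE in
theorem IsReductive.fiberD_homConnection_smul (g : GA) (c : ℂ) (f : H) (v u : M × H)
    (h1 : projD M ρ (homMk ρ (g, f)) v = projD M ρ (homMk ρ (g, c • f)) u)
    (h3 : fiberD M ρ (g : GA ⧸ GB) (homMk ρ (g, c • f)) u =
      c • fiberD M ρ (g : GA ⧸ GB) (homMk ρ (g, f)) v) :
    fiberD M ρ (g : GA ⧸ GB) (homMk ρ (g, c • f)) (homConnection hQ E (homMk ρ (g, c • f)) u) =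
      c • fiberD M ρ (g : GA ⧸ GB) (homMk ρ (g, f)) (homConnection hQ E (homMk ρ (g, f)) v) := by
  obtain ⟨η, hη⟩ := hE.exists_homConnection_eq_sub hπ hQ hGB hρs g (c • f) u
  rw [hη f v h1, hη (c • f) u rfl, map_sub, map_sub, fiberD_homD_inl_smul hQ, h3, smul_sub]

include hπ hGB hρs hE in
theorem IsReductive.isLinearConnection_homConnection :
    IsLinearConnection 𝓘(ℝ, M) (F := H) (V := HomFiber ρ) (homConnection hQ E) where
  isConnection :=
    { smooth := hE.contMDiff_homConnection hπ hQ hGB hρs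
      idem := by
        intro v
        obtain ⟨g, X, f, h, rfl⟩ := exists_tangentClass_eq hQ v
        rw [hE.tangentEndo_homConnection hπ hQ hGB hρs,
          hE.tangentEndo_homConnection hπ hQ hGB hρs, hE.idem]
      range_eq := by
        intro x
        ext v
        constructor
        · rintro ⟨w, rfl⟩
          exact hE.projD_homConnection hπ hQ hGB hρs x w
        · intro hv
          exact ⟨v, hE.homConnection_eq_self hπ hQ hGB hρs hv⟩ }
  map_add := by
    intro z a b v w u ⟨h1, h2, h3⟩
    obtain ⟨g, rfl⟩ := QuotientGroup.mk_surjective z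
    obtain ⟨f, rfl⟩ := (homFiberEquiv ρ g rfl).surjective a
    obtain ⟨f', rfl⟩ := (homFiberEquiv ρ g rfl).surjective b
    -- The values of the connection are vertical, so their projections all vanish and only the fibre
    -- coordinates need work.
    refine ⟨(hE.projD_homConnection hπ hQ hGB hρs _ v).trans
      (hE.projD_homConnection hπ hQ hGB hρs _ u).symm,
      (hE.projD_homConnection hπ hQ hGB hρs _ w).trans
      (hE.projD_homConnection hπ hQ hGB hρs _ u).symm, ?_⟩
    -- The type of `u` mentions the sum in the fibre, which has to be rewritten as the class of `(g,
    -- f + f')`.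
    revert u
    rw [← homFiberEquiv_add]
    intro u h1 h2 h3
    exact hE.fiberD_homConnection_add hπ hQ hGB hρs g f f' v w u h1 h2 h3
  map_smul := by
    intro c z a v u ⟨h1, h3⟩
    obtain ⟨g, rfl⟩ := QuotientGroup.mk_surjective z
    obtain ⟨f, rfl⟩ := (homFiberEquiv ρ g rfl).surjective a
    refine ⟨(hE.projD_homConnection hπ hQ hGB hρs _ v).trans
      (hE.projD_homConnection hπ hQ hGB hρs _ u).symm, ?_⟩
    revert u
    rw [← homFiberEquiv_smul]
    intro u h1 h3
    exact hE.fiberD_homConnection_smul hπ hQ hGB hρs g c f v u h1 h3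

end LinearConnection

end

/-! ### Assembly of the theorem -/

theorem theorem2p2 {FA : Type u} [NormedAddCommGroup FA] [NormedSpace ℝ FA] [CompleteSpace FA]
    {GA : Type v} [TopologicalSpace GA] [ChartedSpace FA GA] [Group GA] [LieGroup 𝓘(ℝ, FA) ∞ GA]
    {FB : Type w} [NormedAddCommGroup FB] [NormedSpace ℝ FB] [CompleteSpace FB]
    (GB : Subgroup GA) [ChartedSpace FB GB]
    (hGB : IsBanachLieSubgroup (F := FA) (FB := FB) GB)
    (E : GroupLieAlgebra 𝓘(ℝ, FA) GA →L[ℝ] GroupLieAlgebra 𝓘(ℝ, FA) GA)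
    (hE : IsReductive (F := FA) (FB := FB) GB E)
    {H : Type x} [NormedAddCommGroup H] [InnerProductSpace ℂ H] [CompleteSpace H]
    (ρ : GB →* (H →L[ℂ] H)) (hρ : Continuous ρ) :
    -- the representation is smooth, so that `dρ` makes sense
    ContMDiff 𝓘(ℝ, FB) 𝓘(ℝ, H →L[ℂ] H) ∞ (fun w : GB => ρ w) ∧
    -- the homogeneous vector bundle has a canonical smooth structure
    (∃ (M : Type u) (_ : NormedAddCommGroup M) (_ : NormedSpace ℝ M) (_ : CompleteSpace M)
      (_ : ChartedSpace M (GA ⧸ GB)) (_ : IsManifold 𝓘(ℝ, M) ∞ (GA ⧸ GB))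
      (_ : FiberBundle H (HomFiber ρ)) (_ : VectorBundle ℝ H (HomFiber ρ))
      (_ : VectorBundle ℂ H (HomFiber ρ)) (_ : ContMDiffVectorBundle ∞ H (HomFiber ρ) 𝓘(ℝ, M)),
      Manifold.IsSubmersion 𝓘(ℝ, FA) 𝓘(ℝ, M) ∞ (fun g : GA => (g : GA ⧸ GB)) ∧
      Manifold.IsSubmersion (𝓘(ℝ, FA).prod 𝓘(ℝ, H)) (𝓘(ℝ, M).prod 𝓘(ℝ, H)) ∞ (homMk ρ)) ∧
    -- with any such structure it carries the linear connection
    (∀ (M : Type u) [NormedAddCommGroup M] [NormedSpace ℝ M] [CompleteSpace M]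
      [ChartedSpace M (GA ⧸ GB)] [IsManifold 𝓘(ℝ, M) ∞ (GA ⧸ GB)]
      [FiberBundle H (HomFiber ρ)] [VectorBundle ℝ H (HomFiber ρ)]
      [VectorBundle ℂ H (HomFiber ρ)] [ContMDiffVectorBundle ∞ H (HomFiber ρ) 𝓘(ℝ, M)],
      Manifold.IsSubmersion 𝓘(ℝ, FA) 𝓘(ℝ, M) ∞ (fun g : GA => (g : GA ⧸ GB)) →
      Manifold.IsSubmersion (𝓘(ℝ, FA).prod 𝓘(ℝ, H)) (𝓘(ℝ, M).prod 𝓘(ℝ, H)) ∞ (homMk ρ) →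
      -- the description of `TD` by classes `[((g, X), (f, h))]`
      (∀ v : TangentBundle (𝓘(ℝ, M).prod 𝓘(ℝ, H)) (TotalSpace H (HomFiber ρ)),
        ∃ g X f h, tangentClass (FA := FA) M ρ g X f h = v) ∧
      (∀ g X f h g' X' f' h',
        tangentClass (FA := FA) M ρ g X f h = tangentClass M ρ g' X' f' h' ↔
          TangentEquiv (FB := FB) ρ g X f h g' X' f' h') ∧
      ∃! Φ : ∀ x : TotalSpace H (HomFiber ρ),
          TangentSpace (𝓘(ℝ, M).prod 𝓘(ℝ, H)) x →L[ℝ] TangentSpace (𝓘(ℝ, M).prod 𝓘(ℝ, H)) x,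
        IsLinearConnection 𝓘(ℝ, M) Φ ∧
        ∀ (g : GA) (X : GroupLieAlgebra 𝓘(ℝ, FA) GA) (f h : H),
          tangentEndo Φ (tangentClass M ρ g X f h) = tangentClass M ρ g (E X) f h ∧
          -- `Y` is the element `E X` of the Lie algebra of `GB`
          ∀ Y : GroupLieAlgebra 𝓘(ℝ, FB) GB, lieIncl (F := FA) (FB := FB) GB Y = E X →
            tangentClass (FA := FA) M ρ g (E X) f h = tangentClass (FA := FA) M ρ g 0 f (derivedRep ρ Y f + h)) := by
  have hρs : ContMDiff 𝓘(ℝ, FB) 𝓘(ℝ, H →L[ℂ] H) ∞ (fun w : GB => ρ w) := by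
    have := hGB.lieGroup
    exact contMDiff_of_continuous ρ hρ
  refine ⟨hρs, ?_, ?_⟩
  · have := hGB.lieGroup
    have := topologicalGroup_of_lieGroup 𝓘(ℝ, FA) ∞ (G := GA)
    obtain ⟨C, hC, ⟨L⟩, ⟨σ⟩⟩ := exists_lieSlice GB hGB
    let := σ.chartedSpaceQuotient
    have := σ.isManifold_quotient
    let := σ.fiberBundle ρ hρ
    have := σ.vectorBundle_real ρ hρ
    -- The model of the quotient is the complement `C` of the Lie algebra of `GB`; the charts are
    -- those of the slice by definition.
    exact ⟨C, inferInstance, inferInstance, hC.completeSpace_coe, σ.chartedSpaceQuotient,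
      σ.isManifold_quotient, σ.fiberBundle ρ hρ, σ.vectorBundle_real ρ hρ,
      σ.vectorBundle_complex ρ hρ, σ.contMDiffVectorBundle ρ hρ (fun _ => rfl) hρs,
      σ.isSubmersion_mk hGB.contMDiff_val (fun _ => rfl) L,
      σ.isSubmersion_homMk ρ hρ (fun _ => rfl) hGB.contMDiff_val L hρs⟩
  · intro M _ _ _ _ _ _ _ _ _ hπ hQ
    refine ⟨exists_tangentClass_eq hQ, tangentClass_eq_iff hQ hπ hGB hρs,
      homConnection hQ E, ⟨hE.isLinearConnection_homConnection hπ hQ hGB hρs,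
        fun g X f h => ⟨hE.tangentEndo_homConnection hπ hQ hGB hρs g X f h, fun Y hY => ?_⟩⟩, ?_⟩
    · rw [← hY, ← tangentClass_add_lieIncl hQ hGB.contMDiff_val hρs, zero_add]
    · rintro Ψ ⟨-, hΨ⟩
      funext x
      ext1 v
      -- Uniqueness: every tangent vector is a class, and on classes the value is prescribed.
      obtain ⟨g, X, f, h, hv⟩ := exists_tangentClass_eq (FA := FA) hQ
        (⟨x, v⟩ : TangentBundle (𝓘(ℝ, M).prod 𝓘(ℝ, H)) (TotalSpace H (HomFiber ρ)))
      have h1 := (hΨ g X f h).1.trans (hE.tangentEndo_homConnection hπ hQ hGB hρs g X f h).symm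
      rw [hv] at h1
      exact TotalSpace.mk_injective x h1
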